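/- **Setting.** Let $\mathbb K=\mathbb R$ (with $\partial_\pm=\pm\infty$) or $\mathbb K=[-1,1]$ (with $\partial_\pm=\pm1$), let $\mathbb K^\circ$ be its interior, and let $H:\mathbb K\times\mathbb R\to\mathbb R$; put $\mathcal L(x,v)=\sup_{p\in\mathbb R}(pv-H(x,p))\in(-\infty,\infty]$. Derivatives in $x$ at $x=\pm1$ are one-sided. *Condition (H).* $H(x,0)=0$ for all $x\in\mathbb K$, and: 1. $H$ is $C^2$ with $\partial_p^2H>0$ on $\mathbb K\times\mathbb R$; if $\mathbb K=[-1,1]$, $H$ extends to a $C^2$ function on $(-1-\epsilon,1+\epsilon)\times\mathbb R$ for some $\epsilon>0$. 2. For every compact $Q\subseteq\mathbb K^\circ$ there is $\theta:[0,\infty)\to[0,\infty)$ with: $\theta(r)/r\to\infty$ as $r\to\infty$; for each $R\ge0$ there is $k\ge0$ with $\theta(r+s)\le k(1+\theta(r))$ for all $r\ge0$, $s\in[0,R]$; and there are constants $c_Q,C_Q$ with $\mathcal L(x,v)\ge\theta(|v|)-c_Q$ and $|\partial_x\mathcal L(x,v)|+|\partial_v\mathcal L(x,v)|\le C_Q\,\theta(|v|)$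 for all $x\in Q$, $v\in\mathbb R$. 3. $\lim_{|p|\to\infty}\inf_{x\in Q}H(x,p)/|p|=\infty$ for every compact $Q\subseteq\mathbb K^\circ$; if $\mathbb K=[-1,1]$, also $\lim_{p\to\infty}H(-1,p)/p=\infty$ and $\lim_{p\to-\infty}H(1,p)/(-p)=\infty$. 4. $\operatorname{argmin}_pH(x,p)\to\pm\infty$ as $x\to\partial_\pm$. 5. There are $(y_n^+,q_n^+)\in\mathbb K^\circ\times(0,\infty)$ with $(y_n^+,q_n^+)\to(\partial_+,\infty)$, $\partial_pH(y_n^+,q)\ge0$ for $q\ge q_n^+$ and $-\partial_xH(y,q_n^+)\ge0$ for $y\in\mathbb K$, $y\ge y_n^+$; and $(y_n^-,q_n^-)\in\mathbb K^\circ\times(-\infty,0)$ with $(y_n^-,q_n^-)\to(\partial_-,-\infty)$, $\partial_pH(y_n^-,q)\le0$ for $q\le q_n^-$ and $-\partial_xH(y,q_n^-)\le0$ for $y\in\mathbb K$, $y\le y_n^-$. *Assumptions on $H$.* If $\mathbb K=\mathbb R$, then either $H(x,p)=\frac12p^2-pW'(x)$ for some $W\in C^3(\mathbb R)$ for which there is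 $L\ge0$ with $-(W'(x)-W'(y))\le L(x-y)$ for all $x>y$; or $H$ satisfies (H) and there is $\Upsilon\in C^1(\mathbb R)$ with compact sublevel sets $\{\Upsilon\le c\}$ and $\sup_xH(x,\Upsilon'(x))<\infty$. If $\mathbb K=[-1,1]$, then either $$H(x,p)=v_+(x)(e^{2p}-1)+v_-(x)(e^{-2p}-1),$$ where $v_\pm:[-1,1]\to[0,\infty)$ have $C^2$ extensions to an open set containing $[-1,1]$, $v_-(-1)=0$ and $v_->0$ on $(-1,1]$, $v_+(1)=0$ and $v_+>0$ on $[-1,1)$, $v_+'(1)<0$ and $v_-'(-1)>0$; or $H$ satisfies (H) and there is $S:[-1,1]\to[0,\infty]$, finite and $C^2$ on $(-1,1)$, such that: $S(x(t))$ is non-increasing in $t$ along every solution of $\dot x=\partial_pH(x,0)$ in $[-1,1]$; $H(x,S'(x)-p)=H(x,p)$ on $(-1,1)\times\mathbb R$; $x\mapsto\mathcal L(x,0)$ is non-increasing on a neighbourhood of $-1$ and non-decreasing on a neighbourhood of $1$ in $[-1,1]$; and $\frac{\mathcal L(x,0)-\mathcal L(\pm1,0)}{S(x)-S(\pm1)}\to\infty$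 as $x\to\pm1$. *Assumption on $I_0$.* $I_0:\mathbb K\to\mathbb R$ is continuous, $C^1$ on $\mathbb K^\circ$, and $I_0'(x)\to\pm\infty$ as $x\to\partial_\pm$. **Notions.** The Hamilton equations are $\dot\gamma=\partial_pH(\gamma,\eta)$, $\dot\eta=-\partial_xH(\gamma,\eta)$, for trajectories in $\mathbb K\times\mathbb R$. Put $\mathcal G=\{(x,I_0'(x)):x\in\mathbb K^\circ\}$, and let $\mathcal G_t$ be the set of positions $(\gamma(t),\eta(t))$ at time $t$ of the solutions that start in $\mathcal G$ and whose maximal time of existence exceeds $t$. $\mathcal G_t$ has an overhang at $x\in\mathbb K^\circ$ if $(x,y_1),(x,y_2)\in\mathcal G_t$ for some $y_1\ne y_2$. A point is stationary if every solution started in it stays there. A rotating loop is a set $\{(\gamma(s),\eta(s)):0\le s\le t_0\}$ with $t_0>0$, where $(\gamma,\eta)$ is a solution started in a non-stationary point and $(\gamma(t_0),\eta(t_0))=(\gamma(0),\eta(0))$. A $C^1$ linearization at $(x_0,0)$, with $x_0\in\mathbb K^\circ$, is a $C^1$ diffeomorphism $\Psi:U\to V$ between open neighbourhoods of $(x_0,0)$,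 $U\subseteq\mathbb K\times\mathbb R$, with $\Psi(x_0,0)=(x_0,0)$ and $D\Psi(x_0,0)=\mathrm{Id}$, such that a trajectory $(\gamma,\eta)$ in $U$ solves the Hamilton equations if and only if $(\xi,\zeta)=\Psi(\gamma,\eta)$ solves $$\dot\xi=\partial_x\partial_pH(x_0,0)(\xi-x_0)+\partial_p^2H(x_0,0)\,\zeta,\qquad \dot\zeta=-\partial_x^2H(x_0,0)(\xi-x_0)-\partial_x\partial_pH(x_0,0)\,\zeta.$$ **Theorem.** Under these assumptions on $H$ and $I_0$: (a) Let $x_0\in\mathbb K^\circ$ be such that $(x_0,0)$ is stationary and $I_0'(x_0)=0$, and put $m=\partial_x\partial_pH(x_0,0)$, $c=\partial_p^2H(x_0,0)$. Suppose that $I_0$ is $C^2$ in a neighbourhood of $x_0$ with $I_0''(x_0)<\min\{-\frac{2m}{c},0\}$, and that the Hamiltonian flow admits a $C^1$ linearization at $(x_0,0)$. Let $$t_0=\begin{cases}-\dfrac1{2m}\log\Big(1+\big(\tfrac{c}{2m}I_0''(x_0)\big)^{-1}\Big)&\text{if }m\ne0,\\[2mm]-\dfrac1{c\,I_0''(x_0)}&\text{if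 }m=0.\end{cases}$$ Then $\mathcal G_t$ has an overhang at $x_0$ for all $t>t_0$. (b) Suppose that $H$ is $C^3$, and let $m_1<m_2$ in $\mathbb K^\circ$ be such that $\partial_pH(m_1,0)=0=\partial_pH(m_2,0)$, $\partial_pH(x,0)\ne0$ for all $x\in(m_1,m_2)$, $\partial_x\partial_pH(m_1,0)\ne0$ and $\partial_x\partial_pH(m_2,0)\ne0$. Suppose that $\mathcal G$ meets $\{(x,p)\in(m_1,m_2)\times\mathbb R:H(x,p)<0\}$. Then there is a rotating loop that meets $\mathcal G$, and there are $t_0>0$ and $x_0\in(m_1,m_2)$ such that $\mathcal G_t$ has an overhang at $x_0$ for all $t\ge t_0$. -/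

import Mathlib

open Set Filter Topology

namespace SpinFlow

/-- The two settings: spins in `ℝ` (the averages live in `𝕂 = ℝ`) and spins in `{-1, 1}`
(the averages live in `𝕂 = [-1, 1]`). -/
inductive Model where
  | line : Model
  | interval : Model

namespace Model

/-- The state space `𝕂`, as a subset of `ℝ`. -/
def space : Model → Set ℝ
  | line => Set.univ
  | interval => Set.Icc (-1) 1

/-- The filter of points tending to the left end `∂₋` of `𝕂` from inside. -/
def toLeft : Model → Filter ℝ
  | line => atBot
  | interval => 𝓝[>] (-1)

/-- The filter of points tending to the right end `∂₊` of `𝕂` from inside. -/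
def toRight : Model → Filter ℝ
  | line => atTop
  | interval => 𝓝[<] 1

end Model

/-! A Hamiltonian on `𝕂 × ℝ` is a function `H : ℝ → ℝ → ℝ`, `H x p`, of which only the values with
`x ∈ 𝕂` are ever used. -/

/-- `∂_p H (x, p)`. -/
noncomputable def dP (H : ℝ → ℝ → ℝ) (x p : ℝ) : ℝ := deriv (H x) p

/-- `∂_x H (x, p)`, a one-sided derivative where `x` is an end point of `𝕂`. -/
noncomputable def dX (M : Model) (H : ℝ → ℝ → ℝ) (x p : ℝ) : ℝ :=
  derivWithin (fun y => H y p) M.space x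

/-- The Lagrangian `𝓛(x, v) = sup_p (p v - H(x, p))`, with values in the extended reals. -/
noncomputable def lagrangian (H : ℝ → ℝ → ℝ) (x v : ℝ) : EReal :=
  ⨆ p : ℝ, ((p * v - H x p : ℝ) : EReal)

/-- The class `C^{k,∂}(𝕂)`. -/
structure IsCBoundary (M : Model) (k : ℕ) (g : ℝ → ℝ) : Prop where
  contDiffOn : ContDiffOn ℝ k g (interior M.space)
  continuousOn : ContinuousOn g M.space
  tendsto_right : Tendsto (deriv g) M.toRight atTop
  tendsto_left : Tendsto (deriv g) M.toLeft atBot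

/-- Conditions on the limiting drift `-W'` of the interacting diffusions. -/
structure DiffusionDrift (W : ℝ → ℝ) : Prop where
  contDiff : ContDiff ℝ 3 W
  oneSidedLipschitz : ∃ L : ℝ, 0 ≤ L ∧ ∀ x y, y < x → -(deriv W x - deriv W y) ≤ L * (x - y)

/-- Conditions on the limiting jump rates `v₊`, `v₋` of the Glauber dynamics; here `vp` and `vm`
are the rates together with their `C²` extension to an open set containing `[-1, 1]`. -/
structure JumpRates (vp vm : ℝ → ℝ) : Prop where
  vm_zero : vm (-1) = 0
  vm_pos : ∀ x ∈ Icc (-1 : ℝ) 1, x ≠ -1 → 0 < vm x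
  vp_zero : vp 1 = 0
  vp_pos : ∀ x ∈ Icc (-1 : ℝ) 1, x ≠ 1 → 0 < vp x
  regular : ∃ V : Set ℝ, IsOpen V ∧ Icc (-1) 1 ⊆ V ∧ ContDiffOn ℝ 2 vp V ∧ ContDiffOn ℝ 2 vm V
  vp_deriv : deriv vp 1 < 0
  vm_deriv : 0 < deriv vm (-1)

/-- Lower and derivative bounds of the Lagrangian on a compact set `Q ⊆ 𝕂°` through a superlinear
function `θ : [0, ∞) → [0, ∞)`. -/
structure LagrangianBounds (H : ℝ → ℝ → ℝ) (Q : Set ℝ) (θ : ℝ → ℝ) : Prop where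
  nonneg : ∀ r, 0 ≤ r → 0 ≤ θ r
  superlinear : Tendsto (fun r => r⁻¹ * θ r) atTop atTop
  doubling : ∀ R : ℝ, 0 ≤ R → ∃ k : ℝ, 0 ≤ k ∧
    ∀ s ∈ Icc 0 R, ∀ r, 0 ≤ r → θ (r + s) ≤ k * (1 + θ r)
  lower : ∃ c : ℝ, ∀ x ∈ Q, ∀ v : ℝ, ((θ |v| - c : ℝ) : EReal) ≤ lagrangian H x v
  derivs : ∃ C : ℝ, ∀ x ∈ Q, ∀ v : ℝ,
    |deriv (fun y => (lagrangian H y v).toReal) x|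
      + |deriv (fun w => (lagrangian H x w).toReal) v| ≤ C * θ |v|

/-- The main structural assumption on the Hamiltonian. -/
structure MainHamiltonian (M : Model) (H : ℝ → ℝ → ℝ) : Prop where
  zero : ∀ x ∈ M.space, H x 0 = 0
  contDiffOn : ContDiffOn ℝ 2 (Function.uncurry H) (M.space ×ˢ univ)
  convex : ∀ x ∈ M.space, ∀ p, 0 < dP (dP H) x p
  extension : M = Model.interval → ∃ ε : ℝ, 0 < ε ∧ ∃ Hext : ℝ → ℝ → ℝ,
    ContDiffOn ℝ 2 (Function.uncurry Hext) (Ioo (-1 - ε) (1 + ε) ×ˢ univ) ∧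
    ∀ x ∈ Icc (-1 : ℝ) 1, ∀ p, H x p = Hext x p
  bounds : ∀ Q : Set ℝ, IsCompact Q → Q ⊆ interior M.space →
    ∃ θ : ℝ → ℝ, LagrangianBounds H Q θ
  superlinear : ∀ Q : Set ℝ, IsCompact Q → Q ⊆ interior M.space →
    ∀ C : ℝ, ∀ᶠ p in cocompact ℝ, ∀ x ∈ Q, C ≤ H x p / |p|
  superlinear_boundary : M = Model.interval →
    Tendsto (fun p => H (-1) p / p) atTop atTop ∧ Tendsto (fun p => H 1 p / (-p)) atBot atTop
  argmin : ∃ q : ℝ → ℝ, (∀ x ∈ interior M.space, ∀ p, H x (q x) ≤ H x p) ∧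
    Tendsto q M.toLeft atBot ∧ Tendsto q M.toRight atTop
  quadrant_right : ∃ y q : ℕ → ℝ, (∀ n, y n ∈ interior M.space) ∧ (∀ n, 0 < q n) ∧
    Tendsto y atTop M.toRight ∧ Tendsto q atTop atTop ∧
    (∀ n, ∀ r, q n ≤ r → 0 ≤ dP H (y n) r) ∧
    (∀ n, ∀ z ∈ M.space, y n ≤ z → 0 ≤ -dX M H z (q n))
  quadrant_left : ∃ y q : ℕ → ℝ, (∀ n, y n ∈ interior M.space) ∧ (∀ n, q n < 0) ∧
    Tendsto y atTop M.toLeft ∧ Tendsto q atTop atBot ∧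
    (∀ n, ∀ r, r ≤ q n → dP H (y n) r ≤ 0) ∧
    (∀ n, ∀ z ∈ M.space, z ≤ y n → -dX M H z (q n) ≤ 0)

/-- Additional condition for `𝕂 = ℝ`: a containment function. -/
def HasContainment (H : ℝ → ℝ → ℝ) : Prop :=
  ∃ Υ : ℝ → ℝ, ContDiff ℝ 1 Υ ∧ (∀ c : ℝ, IsCompact {x | Υ x ≤ c}) ∧
    BddAbove (range fun x => H x (deriv Υ x))

/-- Additional condition for `𝕂 = [-1, 1]`: a Lyapunov function `S : [-1, 1] → [0, ∞]`. -/
structure InteriorLyapunov (H : ℝ → ℝ → ℝ) (S : ℝ → ENNReal) : Prop where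
  finite : ∀ x ∈ Ioo (-1 : ℝ) 1, S x ≠ ⊤
  contDiffOn : ContDiffOn ℝ 2 (fun x => (S x).toReal) (Ioo (-1) 1)
  lyapunov : ∀ T : ℝ, ∀ x : ℝ → ℝ, (∀ s ∈ Ico 0 T, x s ∈ Icc (-1 : ℝ) 1) →
    (∀ s ∈ Ico 0 T, HasDerivWithinAt x (dP H (x s) 0) (Ico 0 T) s) →
    AntitoneOn (fun s => S (x s)) (Ico 0 T)
  symmetric : ∀ x ∈ Ioo (-1 : ℝ) 1, ∀ p,
    H x (deriv (fun y => (S y).toReal) x - p) = H x p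
  decreasing_left : ∃ U ∈ 𝓝[Icc (-1 : ℝ) 1] (-1), AntitoneOn (fun x => lagrangian H x 0) U
  increasing_right : ∃ U ∈ 𝓝[Icc (-1 : ℝ) 1] 1, MonotoneOn (fun x => lagrangian H x 0) U
  quotient_left : Tendsto (fun x => (lagrangian H x 0 - lagrangian H (-1) 0)
    / ((S x : EReal) - (S (-1) : EReal))) (𝓝[>] (-1)) (𝓝 ⊤)
  quotient_right : Tendsto (fun x => (lagrangian H x 0 - lagrangian H 1 0)
    / ((S x : EReal) - (S 1 : EReal))) (𝓝[<] 1) (𝓝 ⊤)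

/-- The admissible Hamiltonians of each of the two settings. -/
def Admissible : Model → (ℝ → ℝ → ℝ) → Prop
  | Model.line, H =>
      (∃ W : ℝ → ℝ, DiffusionDrift W ∧ ∀ x p, H x p = 1 / 2 * p ^ 2 - p * deriv W x) ∨
      (MainHamiltonian Model.line H ∧ HasContainment H)
  | Model.interval, H =>
      (∃ vp vm : ℝ → ℝ, JumpRates vp vm ∧ ∀ x ∈ Icc (-1 : ℝ) 1, ∀ p,
        H x p = vp x * (Real.exp (2 * p) - 1) + vm x * (Real.exp (-2 * p) - 1)) ∨
      (MainHamiltonian Model.interval H ∧ ∃ S : ℝ → ENNReal, InteriorLyapunov H S)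

/-- `(γ, η)` takes values in `𝕂 × ℝ` and solves the Hamilton equations on `[0, T)`. -/
structure IsHamiltonSol (M : Model) (H : ℝ → ℝ → ℝ) (T : ℝ) (γ η : ℝ → ℝ) : Prop where
  mem : ∀ s ∈ Ico 0 T, γ s ∈ M.space
  pos_eq : ∀ s ∈ Ico 0 T, HasDerivWithinAt γ (dP H (γ s) (η s)) (Ico 0 T) s
  mom_eq : ∀ s ∈ Ico 0 T, HasDerivWithinAt η (-dX M H (γ s) (η s)) (Ico 0 T) s

/-- The graph `𝓖` of `I₀'` over `𝕂°`. -/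
def gradGraph (M : Model) (I₀ : ℝ → ℝ) : Set (ℝ × ℝ) :=
  {z | z.1 ∈ interior M.space ∧ z.2 = deriv I₀ z.1}

/-- The push-forward `𝓖_t` of `𝓖` under the Hamiltonian flow: the positions at time `t` of the
solutions that start in `𝓖` and whose time of existence exceeds `t`. -/
def pushGraph (M : Model) (H : ℝ → ℝ → ℝ) (I₀ : ℝ → ℝ) (t : ℝ) : Set (ℝ × ℝ) :=
  {z | ∃ T : ℝ, ∃ γ η : ℝ → ℝ, t ∈ Ico 0 T ∧ IsHamiltonSol M H T γ η ∧
    (γ 0, η 0) ∈ gradGraph M I₀ ∧ z = (γ t, η t)}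

/-- `𝓖_t` has an overhang at `x ∈ 𝕂°`. -/
def HasOverhang (M : Model) (H : ℝ → ℝ → ℝ) (I₀ : ℝ → ℝ) (t x : ℝ) : Prop :=
  x ∈ interior M.space ∧ ∃ y₁ y₂ : ℝ, y₁ ≠ y₂ ∧
    (x, y₁) ∈ pushGraph M H I₀ t ∧ (x, y₂) ∈ pushGraph M H I₀ t

/-- `A ⊆ 𝕂 × ℝ` is preserved under `H`. -/
def Preserves (M : Model) (H : ℝ → ℝ → ℝ) (A : Set (ℝ × ℝ)) : Prop :=
  ∀ T : ℝ, ∀ γ η : ℝ → ℝ, IsHamiltonSol M H T γ η → (γ 0, η 0) ∈ A →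
    ∀ s ∈ Ico 0 T, (γ s, η s) ∈ A

/-- The point `z ∈ 𝕂 × ℝ` is stationary under `H`. -/
def IsStationary (M : Model) (H : ℝ → ℝ → ℝ) (z : ℝ × ℝ) : Prop :=
  z.1 ∈ M.space ∧ Preserves M H {z}

/-- `(ξ, ζ)` solves on `[0, T)` the linearization of the Hamilton equations at `(x₀, 0)`. -/
structure IsLinearizedSol (M : Model) (H : ℝ → ℝ → ℝ) (x₀ T : ℝ) (ξ ζ : ℝ → ℝ) : Prop where
  pos_eq : ∀ s ∈ Ico 0 T, HasDerivWithinAt ξ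
    (dX M (dP H) x₀ 0 * (ξ s - x₀) + dP (dP H) x₀ 0 * ζ s) (Ico 0 T) s
  mom_eq : ∀ s ∈ Ico 0 T, HasDerivWithinAt ζ
    (-dX M (dX M H) x₀ 0 * (ξ s - x₀) - dX M (dP H) x₀ 0 * ζ s) (Ico 0 T) s

/-- The Hamiltonian flow admits a `C¹` linearization at `(x₀, 0)`: a `C¹` diffeomorphism `Ψ` from an
open neighbourhood `U = Ψ.source` (inside `𝕂 × ℝ`) of `(x₀, 0)` to an open neighbourhood
`V = Ψ.target`, fixing `(x₀, 0)` with identity derivative there, and such that a trajectory in `U`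
solves the Hamilton equations if and only if its image solves the linearized equations. -/
def HasC1Linearization (M : Model) (H : ℝ → ℝ → ℝ) (x₀ : ℝ) : Prop :=
  ∃ Ψ : OpenPartialHomeomorph (ℝ × ℝ) (ℝ × ℝ),
    (x₀, 0) ∈ Ψ.source ∧ Ψ.source ⊆ M.space ×ˢ univ ∧
    ContDiffOn ℝ 1 Ψ Ψ.source ∧ ContDiffOn ℝ 1 Ψ.symm Ψ.target ∧
    Ψ (x₀, 0) = (x₀, 0) ∧ fderiv ℝ Ψ (x₀, 0) = ContinuousLinearMap.id ℝ (ℝ × ℝ) ∧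
    ∀ T : ℝ, ∀ γ η : ℝ → ℝ, (∀ s ∈ Ico 0 T, (γ s, η s) ∈ Ψ.source) →
      (IsHamiltonSol M H T γ η ↔
        IsLinearizedSol M H x₀ T (fun s => (Ψ (γ s, η s)).1) (fun s => (Ψ (γ s, η s)).2))

/-- The time at which the line with slope `a` becomes vertical under the linearized flow. -/
noncomputable def verticalTime (m c a : ℝ) : ℝ :=
  if m ≠ 0 then -(1 / (2 * m)) * Real.log (1 + (c / (2 * m) * a)⁻¹) else -(1 / (c * a))

/-- `𝔏` is a rotating loop: the orbit over one return time `t₀ > 0` of a non-stationary point. -/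
def IsRotatingLoop (M : Model) (H : ℝ → ℝ → ℝ) (𝔏 : Set (ℝ × ℝ)) : Prop :=
  ∃ T t₀ : ℝ, ∃ γ η : ℝ → ℝ, 0 < t₀ ∧ t₀ < T ∧ IsHamiltonSol M H T γ η ∧
    ¬ IsStationary M H (γ 0, η 0) ∧ (γ t₀, η t₀) = (γ 0, η 0) ∧
    𝔏 = (fun s => (γ s, η s)) '' Icc 0 t₀

end SpinFlow

namespace SpinFlow

/-! Every admissible Hamiltonian vanishes at zero momentum, is C² and strictly convex in the
momentum, and is coercive over compact subsets of 𝕂° (`Core`). Energy is conserved, so a trajectory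
whose position stays in a compact part of 𝕂° has bounded momentum and cannot blow up. The vector
field may therefore be cut off outside a compact set and replaced by one with a global flow
(`exists_flow_eqOn_nhds`).

(a) Under the linearized flow the tangent line of 𝓖 at (x₀, 0) becomes vertical at the critical time
and is turned over afterwards. The C¹ linearization transfers this: some trajectory that starts in 𝓖
slightly to the right of x₀ is to the left of x₀ at time t (`exists_crossing_of_linearization`). A
trajectory that starts in 𝓖 close to the right end has huge momentum and stays to the right of x₀
(`ConfinesRight`). Between the two starting points, by connectedness, lies one whose trajectory is
exactly over x₀ at time t (`exists_return`). The difficulty is that trajectories in between may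
cease to exist before t; but those that approach an end of 𝕂 must pass through a set that decides on
which side of x₀ they remain, so they can be sorted as well. The returning trajectory has non-zero
momentum, because (x₀, 0) is an equilibrium, and this equilibrium is the second point of 𝓖_t over
x₀.

(b) The region of negative energy over (m₁, m₂) is forward invariant. At energies just below zero
all points at rest lie near the two equilibria, where the force drives them back towards the middle.
Hence trajectories oscillate across a line {x = x₀} (`IsWellFlow.isSection`), and since position,
energy and sign of the velocity determine a point, they are periodic. This gives the loop. As the
energy tends to zero, the time between an upward and the following downward crossing tends to
infinity, because a rest point of energy zero is an equilibrium and is not reached in finite time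
(`IsWellFlow.exists_energy_le`). Along an arc of 𝓖 on which the energy tends to zero the crossing
times are continuous and unbounded, so each late time is an upward crossing time for one point of
the arc and a downward crossing time for another (`exists_forall_ge_mem_upSet`). Opposite velocities
over x₀ mean different momenta. -/

/-! ### Trajectories of vector fields -/

/-- A path that cannot be the first to leave an open set stays in it. -/
theorem mem_of_forall_mem_before {X : Type*} [TopologicalSpace X] {γ : ℝ → X} {U : Set X}
    (hU : IsOpen U) {s t : ℝ} (hγ : ContinuousOn γ (Icc s t)) (h0 : γ s ∈ U)
    (h : ∀ r ∈ Ioc s t, (∀ r' ∈ Ico s r, γ r' ∈ U) → γ r ∈ U) :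
    ∀ r ∈ Icc s t, γ r ∈ U := by
  by_contra! hcon
  obtain ⟨r₁, hr₁, hr₁U⟩ := hcon
  have hB : IsClosed (Icc s t ∩ γ ⁻¹' Uᶜ) :=
    hγ.preimage_isClosed_of_isClosed isClosed_Icc hU.isClosed_compl
  have hBc : IsCompact (Icc s t ∩ γ ⁻¹' Uᶜ) := isCompact_Icc.of_isClosed_subset hB inter_subset_left
  obtain ⟨r, ⟨hr, hrU⟩, hmin⟩ := hBc.exists_isLeast ⟨r₁, hr₁, hr₁U⟩
  have hsr : s < r := lt_of_le_of_ne hr.1 (fun hsr => hrU (hsr ▸ h0))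
  refine hrU (h r ⟨hsr, hr.2⟩ fun r' hr' => ?_)
  by_contra hr'U
  exact absurd (hmin ⟨⟨hr'.1, hr'.2.le.trans hr.2⟩, hr'U⟩) (not_le.2 hr'.2)

variable {E : Type*} [NormedAddCommGroup E] [NormedSpace ℝ E]

/-- `φ` is the global flow of the vector field `f`. -/
structure IsFlow (f : E → E) (φ : ℝ → E → E) : Prop where
  zero : ∀ z, φ 0 z = z
  hasDerivAt : ∀ z t, HasDerivAt (fun s => φ s z) (f (φ t z)) t
  continuous : Continuous (Function.uncurry φ)
  lipschitz : ∃ K, LipschitzWith K f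

namespace IsFlow

variable {f : E → E} {φ : ℝ → E → E}

theorem add (h : IsFlow f φ) (s t : ℝ) (z : E) : φ (s + t) z = φ s (φ t z) := by
  obtain ⟨K, hK⟩ := h.lipschitz
  have := ODE_solution_unique_univ (v := fun _ => f) (s := fun _ => univ) (K := K) (t₀ := 0)
    (f := fun s => φ (s + t) z) (g := fun s => φ s (φ t z))
    (fun _ => hK.lipschitzOnWith)
    (fun s => ⟨(h.hasDerivAt z (s + t)).comp_add_const s t, trivial⟩)
    (fun s => ⟨h.hasDerivAt _ s, trivial⟩) (by simp [h.zero])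
  exact congrFun this s

theorem neg_apply (h : IsFlow f φ) (t : ℝ) (z : E) : φ (-t) (φ t z) = z := by
  rw [← h.add, neg_add_cancel, h.zero]

theorem injective (h : IsFlow f φ) (t : ℝ) : Function.Injective (φ t) := fun z w hzw => by
  rw [← h.neg_apply t z, hzw, h.neg_apply]

theorem eq_of_zero (h : IsFlow f φ) {z : E} (hz : f z = 0) (t : ℝ) : φ t z = z := by
  obtain ⟨K, hK⟩ := h.lipschitz
  have := ODE_solution_unique_univ (v := fun _ => f) (s := fun _ => univ) (K := K) (t₀ := 0)
    (f := fun s => φ s z) (g := fun _ => z)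
    (fun _ => hK.lipschitzOnWith)
    (fun s => ⟨h.hasDerivAt _ s, trivial⟩)
    (fun s => ⟨by simpa [hz] using hasDerivAt_const s z, trivial⟩) (by simp [h.zero])
  exact congrFun this t

theorem eqOn (h : IsFlow f φ) {γ : ℝ → E} {t : ℝ} (hγ : ContinuousOn γ (Icc 0 t))
    (hγ' : ∀ s ∈ Ico 0 t, HasDerivWithinAt γ (f (γ s)) (Ici s) s) :
    ∀ s ∈ Icc 0 t, γ s = φ s (γ 0) := by
  obtain ⟨K, hK⟩ := h.lipschitz
  exact ODE_solution_unique (v := fun _ => f) (fun _ => hK) hγ hγ'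
    (fun s _ => (h.hasDerivAt _ s).continuousAt.continuousWithinAt)
    (fun s _ => (h.hasDerivAt _ s).hasDerivWithinAt) (h.zero _).symm

theorem continuous_time (h : IsFlow f φ) (z : E) : Continuous fun t => φ t z :=
  h.continuous.comp (by fun_prop : Continuous fun t : ℝ => (t, z))

theorem continuous_space (h : IsFlow f φ) (t : ℝ) : Continuous (φ t) :=
  h.continuous.comp (by fun_prop : Continuous fun z : E => (t, z))

end IsFlow

/-- A bounded Lipschitz vector field has a complete trajectory through each point. -/
theorem exists_trajectory [CompleteSpace E] {f : E → E} {K : NNReal} (hf : LipschitzWith K f)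
    {L : NNReal} (hL : ∀ z, ‖f z‖ ≤ L) (z : E) :
    ∃ α : ℝ → E, α 0 = z ∧ ∀ t, HasDerivAt α (f (α t)) t := by
  have hloc : ∀ n : ℕ, ∃ α : ℝ → E, α 0 = z ∧
      ∀ t ∈ Ioo (-(n + 1 : ℝ)) (n + 1), HasDerivAt α (f (α t)) t := by
    intro n
    have h0 : (0 : ℝ) ∈ Icc (-(n + 1 : ℝ)) (n + 1) := ⟨by linarith, by positivity⟩
    -- The bound on the speed is global, so the ball of radius `L * (n + 1)` cannot be left on this
    -- time interval.
    have hPL : IsPicardLindelof (fun _ => f) (⟨0, h0⟩ : Icc (-(n + 1 : ℝ)) (n + 1)) z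
        (L * (n + 1)) 0 L K :=
      ⟨fun _ _ => hf.lipschitzOnWith, fun _ _ => continuousOn_const, fun _ _ w _ => hL w, by
        simp⟩
    obtain ⟨α, hα0, hα⟩ := hPL.exists_eq_forall_mem_Icc_hasDerivWithinAt₀
    exact ⟨α, hα0, fun t ht => (hα t (Ioo_subset_Icc_self ht)).hasDerivAt (Icc_mem_nhds ht.1 ht.2)⟩
  choose α hα0 hα using hloc
  have hagree : ∀ n m : ℕ, n ≤ m → EqOn (α n) (α m) (Ioo (-(n + 1 : ℝ)) (n + 1)) := by
    intro n m hnm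
    have hnm' : (n : ℝ) ≤ m := by exact_mod_cast hnm
    refine ODE_solution_unique_of_mem_Ioo (v := fun _ => f) (s := fun _ => univ) (K := K) (t₀ := 0)
      (fun _ _ => hf.lipschitzOnWith) ⟨by linarith [n.cast_nonneg (α := ℝ)], by positivity⟩
      (fun t ht => ⟨hα n t ht, trivial⟩)
      (fun t ht => ⟨hα m t ⟨by linarith [ht.1], by linarith [ht.2]⟩, trivial⟩) ?_
    rw [hα0, hα0]
  -- The local solutions are glued by reading off time `t` from an interval that contains it. The
  -- index `N`, one larger than needed at `t`, serves for all times near `t`.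
  refine ⟨fun t => α ⌈|t|⌉₊ t, by simp [hα0], fun t => ?_⟩
  set N := ⌈|t|⌉₊ + 1
  have hlt : ∀ s : ℝ, |s| < ⌈|s|⌉₊ + 1 := fun s => (Nat.le_ceil _).trans_lt (lt_add_one _)
  have key : ∀ s : ℝ, ⌈|s|⌉₊ ≤ N → α ⌈|s|⌉₊ s = α N s := fun s hs =>
    hagree _ _ hs (abs_lt.1 (hlt s))
  have htN : |t| < N := by simpa [N] using hlt t
  have hev : (fun s => α ⌈|s|⌉₊ s) =ᶠ[𝓝 t] α N := by
    filter_upwards [continuous_abs.continuousAt.eventually_lt continuousAt_const htN] with s hs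
    exact key s (Nat.ceil_le.2 hs.le)
  have hder := hα N t (abs_lt.1 (by linarith))
  show HasDerivAt _ (f (α ⌈|t|⌉₊ t)) t
  rw [key t (by simp [N])]
  exact hder.congr_of_eventuallyEq hev

/-- Grönwall's inequality controls the dependence on the starting point locally uniformly in time
(for negative times, applied to `-f`). Combined with continuity in time of one fixed trajectory,
this gives joint continuity. -/
theorem exists_isFlow [CompleteSpace E] {f : E → E} {K : NNReal} (hf : LipschitzWith K f)
    {L : NNReal} (hL : ∀ z, ‖f z‖ ≤ L) : ∃ φ : ℝ → E → E, IsFlow f φ := by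
  choose α hα0 hα using exists_trajectory hf hL
  refine ⟨fun t z => α z t, hα0, hα, ?_, K, hf⟩
  have hfwd : ∀ t ≥ 0, ∀ z w, dist (α z t) (α w t) ≤ dist z w * Real.exp (K * t) := by
    intro t ht z w
    simpa using dist_le_of_trajectories_ODE (v := fun _ => f) (a := 0) (b := t) (fun _ => hf)
      (fun s _ => (hα z s).continuousAt.continuousWithinAt) (fun s _ => (hα z s).hasDerivWithinAt)
      (fun s _ => (hα w s).continuousAt.continuousWithinAt) (fun s _ => (hα w s).hasDerivWithinAt)
      (by rw [hα0, hα0]) t ⟨ht, le_rfl⟩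
  have hneg : LipschitzWith K fun z => -f z := hf.neg
  have hα' : ∀ z s, HasDerivAt (fun r => α z (-r)) (-f (α z (-s))) s := fun z s => by
    simpa [Function.comp_def] using (hα z (-s)).scomp s (hasDerivAt_neg s)
  have hbwd : ∀ t ≥ 0, ∀ z w, dist (α z (-t)) (α w (-t)) ≤ dist z w * Real.exp (K * t) := by
    intro t ht z w
    simpa using dist_le_of_trajectories_ODE (v := fun _ z => -f z) (a := 0) (b := t)
      (f := fun r => α z (-r)) (g := fun r => α w (-r)) (fun _ => hneg)
      (fun s _ => (hα' z s).continuousAt.continuousWithinAt)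
      (fun s _ => (hα' z s).hasDerivWithinAt)
      (fun s _ => (hα' w s).continuousAt.continuousWithinAt)
      (fun s _ => (hα' w s).hasDerivWithinAt)
      (by simp [hα0]) t ⟨ht, le_rfl⟩
  have hdist : ∀ t z w, dist (α z t) (α w t) ≤ dist z w * Real.exp (K * |t|) := by
    intro t z w
    rcases le_total 0 t with ht | ht
    · simpa [abs_of_nonneg ht] using hfwd t ht z w
    · simpa [abs_of_nonpos ht] using hbwd (-t) (by linarith) z w
  rw [continuous_iff_continuousAt]
  rintro ⟨t₀, z₀⟩
  have hb : Tendsto (fun p : ℝ × E => dist p.2 z₀ * Real.exp (K * |p.1|)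
      + dist (α z₀ p.1) (α z₀ t₀)) (𝓝 (t₀, z₀)) (𝓝 0) := by
    have hc : ContinuousAt (fun p : ℝ × E => α z₀ p.1) (t₀, z₀) :=
      ContinuousAt.comp (f := Prod.fst) (hα z₀ t₀).continuousAt continuousAt_fst
    have : ContinuousAt (fun p : ℝ × E => dist p.2 z₀ * Real.exp (K * |p.1|)
      + dist (α z₀ p.1) (α z₀ t₀)) (t₀, z₀) :=
      ((continuousAt_snd.dist continuousAt_const).mul
        (by fun_prop : Continuous fun p : ℝ × E => Real.exp (K * |p.1|)).continuousAt).add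
        (hc.dist continuousAt_const)
    simpa [ContinuousAt] using this
  refine tendsto_iff_dist_tendsto_zero.2 (squeeze_zero (fun _ => dist_nonneg) (fun p => ?_) hb)
  exact (dist_triangle _ (α z₀ p.1) _).trans (add_le_add (hdist _ _ _) le_rfl)

/-- A `C¹` vector field on an open set agrees near any given compact subset with a vector field
that has a global flow. -/
theorem exists_flow_eqOn_nhds [FiniteDimensional ℝ E] {F : E → E} {Ω C : Set E} (hΩ : IsOpen Ω)
    (hF : ContDiffOn ℝ 1 F Ω) (hC : IsCompact C) (hCΩ : C ⊆ Ω) :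
    ∃ f : E → E, ∃ φ : ℝ → E → E, ∃ O : Set E, IsOpen O ∧ C ⊆ O ∧ O ⊆ Ω ∧ EqOn f F O ∧
      IsFlow f φ := by
  have : CompleteSpace E := FiniteDimensional.complete ℝ E
  have : ProperSpace E := FiniteDimensional.proper ℝ E
  obtain ⟨C', hC', hCC', hC'Ω⟩ := exists_compact_between hC hΩ hCΩ
  -- Multiplication by a cutoff that is one near `C` and vanishes off `C'` makes the field C¹ with
  -- compact support, hence Lipschitz and bounded.
  obtain ⟨χ, hχ1, hχ0, -⟩ := exists_contMDiffMap_one_nhds_of_subset_interior (n := 1)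
    (modelWithCornersSelf ℝ E) hC.isClosed hCC'
  have hχ : ContDiff ℝ 1 χ := χ.contMDiff.contDiff
  obtain ⟨O, hO, hCO, hχO⟩ := eventually_nhdsSet_iff_exists.1 hχ1
  have hsupp : HasCompactSupport fun z => χ z • F z :=
    HasCompactSupport.intro hC' fun z hz => by rw [hχ0 z hz, zero_smul]
  have hsm : ContDiff ℝ 1 fun z => χ z • F z := by
    rw [contDiff_iff_contDiffAt]
    intro z
    by_cases hz : z ∈ Ω
    · exact hχ.contDiffAt.smul (hF.contDiffAt (hΩ.mem_nhds hz))
    · have : (fun z => χ z • F z) =ᶠ[𝓝 z] fun _ => 0 := by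
        filter_upwards [hC'.isClosed.isOpen_compl.mem_nhds fun h => hz (hC'Ω h)] with w hw
        rw [hχ0 w hw, zero_smul]
      exact contDiffAt_const.congr_of_eventuallyEq this
  obtain ⟨K, hK⟩ := ContDiff.lipschitzWith_of_hasCompactSupport hsupp hsm one_ne_zero
  obtain ⟨L, hL⟩ := hsupp.exists_bound_of_continuous hsm.continuous
  obtain ⟨φ, hφ⟩ := exists_isFlow hK (L := L.toNNReal) fun z => (hL z).trans (Real.le_coe_toNNReal L)
  refine ⟨_, φ, O ∩ Ω, hO.inter hΩ, subset_inter hCO hCΩ, inter_subset_right, fun z hz => ?_, hφ⟩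
  simp [hχO z hz.1]

/-! ### The Hamiltonian vector field over the interior of the state space -/

theorem Model.ordConnected_interior_space (M : Model) : (interior M.space).OrdConnected := by
  cases M
  · simp only [Model.space, interior_univ]; exact ordConnected_univ
  · simp only [Model.space, interior_Icc]; exact ordConnected_Ioo

theorem Model.Icc_subset (M : Model) {a b : ℝ} (ha : a ∈ interior M.space)
    (hb : b ∈ interior M.space) : Icc a b ⊆ interior M.space :=
  M.ordConnected_interior_space.out ha hb

/-- The part `𝕂° × ℝ` of the phase space. -/
def phase (M : Model) : Set (ℝ × ℝ) := interior M.space ×ˢ univ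

theorem isOpen_phase (M : Model) : IsOpen (phase M) := isOpen_interior.prod isOpen_univ

theorem mem_phase {M : Model} {z : ℝ × ℝ} : z ∈ phase M ↔ z.1 ∈ interior M.space := by
  simp [phase]

/-- The Hamiltonian vector field. -/
noncomputable def field (M : Model) (H : ℝ → ℝ → ℝ) (z : ℝ × ℝ) : ℝ × ℝ :=
  (dP H z.1 z.2, -dX M H z.1 z.2)

/-- At time `r`, the path `z` runs in `𝕂° × ℝ` and satisfies the Hamilton equations. -/
def IsTraj (M : Model) (H : ℝ → ℝ → ℝ) (z : ℝ → ℝ × ℝ) (r : ℝ) : Prop :=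
  z r ∈ phase M ∧ HasDerivAt z (field M H (z r)) r

theorem dX_eq_deriv {M : Model} (G : ℝ → ℝ → ℝ) {x : ℝ} (hx : x ∈ interior M.space) (p : ℝ) :
    dX M G x p = deriv (fun y => G y p) x :=
  derivWithin_of_mem_nhds (mem_interior_iff_mem_nhds.1 hx)

theorem hasFDerivAt_uncurry {M : Model} {G : ℝ → ℝ → ℝ} {z : ℝ × ℝ} (hz : z ∈ phase M)
    (hG : DifferentiableAt ℝ (Function.uncurry G) z) :
    HasFDerivAt (Function.uncurry G) (dX M G z.1 z.2 • ContinuousLinearMap.fst ℝ ℝ ℝ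
      + dP G z.1 z.2 • ContinuousLinearMap.snd ℝ ℝ ℝ) z := by
  have hx : HasDerivAt (fun y => G y z.2) (fderiv ℝ (Function.uncurry G) z (1, 0)) z.1 :=
    HasFDerivAt.comp_hasDerivAt (f := fun y : ℝ => (y, z.2)) z.1 hG.hasFDerivAt
      ((hasDerivAt_id z.1).prodMk (hasDerivAt_const z.1 z.2))
  have hp : HasDerivAt (G z.1) (fderiv ℝ (Function.uncurry G) z (0, 1)) z.2 :=
    HasFDerivAt.comp_hasDerivAt (f := fun q : ℝ => (z.1, q)) z.2 hG.hasFDerivAt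
      ((hasDerivAt_const z.2 z.1).prodMk (hasDerivAt_id z.2))
  convert hG.hasFDerivAt using 1
  rw [dX_eq_deriv G (mem_phase.1 hz), hx.deriv, dP, hp.deriv]
  ext <;> simp

theorem IsTraj.hasDerivAt_comp {M : Model} {H G : ℝ → ℝ → ℝ} {z : ℝ → ℝ × ℝ} {r : ℝ}
    (hz : IsTraj M H z r) (hG : DifferentiableAt ℝ (Function.uncurry G) (z r)) :
    HasDerivAt (fun s => G (z s).1 (z s).2)
      (dX M G (z r).1 (z r).2 * dP H (z r).1 (z r).2
        - dP G (z r).1 (z r).2 * dX M H (z r).1 (z r).2) r := by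
  refine ((hasFDerivAt_uncurry hz.1 hG).comp_hasDerivAt r hz.2).congr_deriv ?_
  simp [field, sub_eq_add_neg]

theorem IsTraj.hasDerivAt_fst {M : Model} {H : ℝ → ℝ → ℝ} {z : ℝ → ℝ × ℝ} {r : ℝ}
    (hz : IsTraj M H z r) : HasDerivAt (fun s => (z s).1) (dP H (z r).1 (z r).2) r :=
  (ContinuousLinearMap.fst ℝ ℝ ℝ).hasFDerivAt.comp_hasDerivAt r hz.2

theorem IsTraj.hasDerivAt_snd {M : Model} {H : ℝ → ℝ → ℝ} {z : ℝ → ℝ × ℝ} {r : ℝ}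
    (hz : IsTraj M H z r) : HasDerivAt (fun s => (z s).2) (-dX M H (z r).1 (z r).2) r :=
  (ContinuousLinearMap.snd ℝ ℝ ℝ).hasFDerivAt.comp_hasDerivAt r hz.2

/-- The properties shared by all admissible Hamiltonians. -/
structure Core (M : Model) (H : ℝ → ℝ → ℝ) : Prop where
  zero : ∀ x ∈ interior M.space, H x 0 = 0
  contDiffOn : ContDiffOn ℝ 2 (Function.uncurry H) (phase M)
  convex : ∀ x ∈ interior M.space, ∀ p, 0 < dP (dP H) x p
  coercive : ∀ Q : Set ℝ, IsCompact Q → Q ⊆ interior M.space → ∀ c : ℝ, ∃ B : ℝ,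
    ∀ x ∈ Q, ∀ p, H x p ≤ c → |p| ≤ B

/-! ### Convexity, conservation of energy and compact sublevel sets -/

namespace Core

variable {M : Model} {H : ℝ → ℝ → ℝ}

theorem contDiffAt (h : Core M H) {z : ℝ × ℝ} (hz : z ∈ phase M) :
    ContDiffAt ℝ 2 (Function.uncurry H) z :=
  h.contDiffOn.contDiffAt ((isOpen_phase M).mem_nhds hz)

theorem differentiableAt (h : Core M H) {z : ℝ × ℝ} (hz : z ∈ phase M) :
    DifferentiableAt ℝ (Function.uncurry H) z :=
  (h.contDiffAt hz).differentiableAt (by norm_num)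

theorem fderiv_eq (h : Core M H) {z : ℝ × ℝ} (hz : z ∈ phase M) :
    fderiv ℝ (Function.uncurry H) z = dX M H z.1 z.2 • ContinuousLinearMap.fst ℝ ℝ ℝ
      + dP H z.1 z.2 • ContinuousLinearMap.snd ℝ ℝ ℝ :=
  (hasFDerivAt_uncurry hz (h.differentiableAt hz)).fderiv

theorem contDiffOn_fderiv (h : Core M H) :
    ContDiffOn ℝ 1 (fderiv ℝ (Function.uncurry H)) (phase M) :=
  h.contDiffOn.fderiv_of_isOpen (isOpen_phase M) (by norm_num)

theorem contDiffOn_dP (h : Core M H) : ContDiffOn ℝ 1 (Function.uncurry (dP H)) (phase M) := by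
  have : ContDiffOn ℝ 1 (fun z => fderiv ℝ (Function.uncurry H) z (0, 1)) (phase M) :=
    h.contDiffOn_fderiv.clm_apply contDiffOn_const
  refine this.congr fun z hz => ?_
  simp [h.fderiv_eq hz, Function.uncurry]

theorem contDiffOn_dX (h : Core M H) : ContDiffOn ℝ 1 (Function.uncurry (dX M H)) (phase M) := by
  have : ContDiffOn ℝ 1 (fun z => fderiv ℝ (Function.uncurry H) z (1, 0)) (phase M) :=
    h.contDiffOn_fderiv.clm_apply contDiffOn_const
  refine this.congr fun z hz => ?_
  simp [h.fderiv_eq hz, Function.uncurry]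

theorem contDiffOn_field (h : Core M H) : ContDiffOn ℝ 1 (field M H) (phase M) :=
  h.contDiffOn_dP.prodMk h.contDiffOn_dX.neg

theorem differentiableAt_dP (h : Core M H) {z : ℝ × ℝ} (hz : z ∈ phase M) :
    DifferentiableAt ℝ (Function.uncurry (dP H)) z :=
  (h.contDiffOn_dP.contDiffAt ((isOpen_phase M).mem_nhds hz)).differentiableAt (by norm_num)

theorem differentiableAt_dX (h : Core M H) {z : ℝ × ℝ} (hz : z ∈ phase M) :
    DifferentiableAt ℝ (Function.uncurry (dX M H)) z :=
  (h.contDiffOn_dX.contDiffAt ((isOpen_phase M).mem_nhds hz)).differentiableAt (by norm_num)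

theorem dP_dX (h : Core M H) {z : ℝ × ℝ} (hz : z ∈ phase M) :
    dP (dX M H) z.1 z.2 = dX M (dP H) z.1 z.2 := by
  have hsym : IsSymmSndFDerivAt ℝ (Function.uncurry H) z :=
    (h.contDiffAt hz).isSymmSndFDerivAt (by simp)
  have hd : DifferentiableAt ℝ (fderiv ℝ (Function.uncurry H)) z :=
    (h.contDiffOn_fderiv.contDiffAt ((isOpen_phase M).mem_nhds hz)).differentiableAt (by norm_num)
  have key : ∀ v w : ℝ × ℝ, fderiv ℝ (fun y => fderiv ℝ (Function.uncurry H) y v) z w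
      = fderiv ℝ (fderiv ℝ (Function.uncurry H)) z w v := by
    intro v w
    rw [fderiv_clm_apply hd (differentiableAt_const v)]
    simp
  have hX : Function.uncurry (dX M H) =ᶠ[𝓝 z] fun y => fderiv ℝ (Function.uncurry H) y (1, 0) := by
    filter_upwards [(isOpen_phase M).mem_nhds hz] with y hy
    simp [h.fderiv_eq hy, Function.uncurry]
  have hP : Function.uncurry (dP H) =ᶠ[𝓝 z] fun y => fderiv ℝ (Function.uncurry H) y (0, 1) := by
    filter_upwards [(isOpen_phase M).mem_nhds hz] with y hy
    simp [h.fderiv_eq hy, Function.uncurry]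
  have h1 : fderiv ℝ (Function.uncurry (dX M H)) z (0, 1) = dP (dX M H) z.1 z.2 := by
    simp [(hasFDerivAt_uncurry hz (h.differentiableAt_dX hz)).fderiv]
  have h2 : fderiv ℝ (Function.uncurry (dP H)) z (1, 0) = dX M (dP H) z.1 z.2 := by
    simp [(hasFDerivAt_uncurry hz (h.differentiableAt_dP hz)).fderiv]
  rw [← h1, ← h2, hX.fderiv_eq, hP.fderiv_eq, key, key]
  exact hsym _ _

theorem dX_zero (h : Core M H) {x : ℝ} (hx : x ∈ interior M.space) : dX M H x 0 = 0 := by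
  rw [dX_eq_deriv H hx]
  have : (fun y => H y 0) =ᶠ[𝓝 x] fun _ => 0 := by
    filter_upwards [isOpen_interior.mem_nhds hx] with y hy using h.zero y hy
  rw [this.deriv_eq, deriv_const]

/-- The force vanishes along the whole axis p = 0, so its derivative along the axis does too. This
makes the linearization at (x₀, 0) triangular. -/
theorem dX_dX_zero (h : Core M H) {x : ℝ} (hx : x ∈ interior M.space) :
    dX M (dX M H) x 0 = 0 := by
  rw [dX_eq_deriv _ hx]
  have : (fun y => dX M H y 0) =ᶠ[𝓝 x] fun _ => 0 := by
    filter_upwards [isOpen_interior.mem_nhds hx] with y hy using h.dX_zero hy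
  rw [this.deriv_eq, deriv_const]

theorem hasDerivAt_momentum (h : Core M H) {x : ℝ} (hx : x ∈ interior M.space) (p : ℝ) :
    HasDerivAt (H x) (dP H x p) p := by
  have hz : ((x, p) : ℝ × ℝ) ∈ phase M := mem_phase.2 hx
  have := (hasFDerivAt_uncurry hz (h.differentiableAt hz)).comp_hasDerivAt (f := fun q => (x, q)) p
    ((hasDerivAt_const p x).prodMk (hasDerivAt_id p))
  simpa [Function.comp_def, Function.uncurry] using this

theorem strictMono_dP (h : Core M H) {x : ℝ} (hx : x ∈ interior M.space) :
    StrictMono (dP H x) :=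
  strictMono_of_deriv_pos (h.convex x hx)

/-- The energy grows strictly in the momentum where the velocity is positive. -/
theorem lt_of_dP_nonneg (h : Core M H) {x p q : ℝ} (hx : x ∈ interior M.space)
    (hp : 0 ≤ dP H x p) (hpq : p < q) : H x p < H x q := by
  have hmono : StrictMonoOn (H x) (Icc p q) := by
    refine strictMonoOn_of_deriv_pos (convex_Icc p q)
      (fun y _ => (h.hasDerivAt_momentum hx y).continuousAt.continuousWithinAt) fun y hy => ?_
    rw [interior_Icc] at hy
    exact hp.trans_lt (h.strictMono_dP hx hy.1)
  exact hmono ⟨le_rfl, hpq.le⟩ ⟨hpq.le, le_rfl⟩ hpq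

theorem lt_of_dP_nonpos (h : Core M H) {x p q : ℝ} (hx : x ∈ interior M.space)
    (hq : dP H x q ≤ 0) (hpq : p < q) : H x q < H x p := by
  have hmono : StrictAntiOn (H x) (Icc p q) := by
    refine strictAntiOn_of_deriv_neg (convex_Icc p q)
      (fun y _ => (h.hasDerivAt_momentum hx y).continuousAt.continuousWithinAt) fun y hy => ?_
    rw [interior_Icc] at hy
    exact (h.strictMono_dP hx hy.2).trans_le hq
  exact hmono ⟨le_rfl, hpq.le⟩ ⟨hpq.le, le_rfl⟩ hpq

theorem lt_of_dP_eq_zero (h : Core M H) {x p q : ℝ} (hx : x ∈ interior M.space)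
    (hp : dP H x p = 0) (hpq : q ≠ p) : H x p < H x q := by
  rcases lt_or_gt_of_ne hpq with hlt | hlt
  · exact h.lt_of_dP_nonpos hx hp.le hlt
  · exact h.lt_of_dP_nonneg hx hp.ge hlt

/-- Conservation of energy. -/
theorem energy_eq (h : Core M H) {z : ℝ → ℝ × ℝ} {s t : ℝ} (hst : s ≤ t)
    (hz : ∀ r ∈ Ico s t, IsTraj M H z r) (hcont : ContinuousAt z t) (ht : z t ∈ phase M) :
    H (z t).1 (z t).2 = H (z s).1 (z s).2 := by
  -- The equations are required only before `t`; at `t` continuity suffices. This lets the lemma be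
  -- applied at a first exit time.
  have hc : ContinuousOn (fun r => H (z r).1 (z r).2) (Icc s t) := by
    intro r hr
    rcases hr.2.lt_or_eq with hlt | rfl
    · exact ((hz r ⟨hr.1, hlt⟩).hasDerivAt_comp
        (h.differentiableAt (hz r ⟨hr.1, hlt⟩).1)).continuousAt.continuousWithinAt
    · exact (ContinuousAt.comp (g := Function.uncurry H) (h.differentiableAt ht).continuousAt
        hcont).continuousWithinAt
  refine constant_of_has_deriv_right_zero hc (fun r hr => ?_) t ⟨hst, le_rfl⟩
  refine ((hz r hr).hasDerivAt_comp (h.differentiableAt (hz r hr).1)).hasDerivWithinAt.congr_deriv ?_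
  ring

/-- Coercivity bounds the momentum. With conservation of energy, this set retains every trajectory
of energy at most `c` as long as its position stays in [a, b]. -/
theorem isCompact_sublevel (h : Core M H) {a b : ℝ} (ha : a ∈ interior M.space)
    (hb : b ∈ interior M.space) (c : ℝ) :
    IsCompact {z : ℝ × ℝ | z.1 ∈ Icc a b ∧ H z.1 z.2 ≤ c} := by
  have hab := M.Icc_subset ha hb
  obtain ⟨B, hB⟩ := h.coercive (Icc a b) isCompact_Icc hab c
  have hsub : Icc a b ×ˢ Icc (-B) B ⊆ phase M := fun z hz => mem_phase.2 (hab hz.1)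
  have hcl : IsClosed ((Icc a b ×ˢ Icc (-B) B) ∩ Function.uncurry H ⁻¹' Iic c) :=
    (h.contDiffOn.continuousOn.mono hsub).preimage_isClosed_of_isClosed
      (isClosed_Icc.prod isClosed_Icc) isClosed_Iic
  convert (isCompact_Icc.prod isCompact_Icc).of_isClosed_subset hcl inter_subset_left using 1
  ext z
  constructor
  · exact fun hz => ⟨⟨hz.1, abs_le.1 (hB z.1 hz.1 z.2 hz.2)⟩, hz.2⟩
  · exact fun hz => ⟨hz.1.1, hz.2⟩

end Core

/-! ### Confinement near the ends of the state space -/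

theorem eventually_lt_left_of_hasDerivAt_pos {g : ℝ → ℝ} {g' r : ℝ} (h : HasDerivAt g g' r)
    (hg' : 0 < g') : ∀ᶠ s in 𝓝[<] r, g s < g r := by
  have h1 := (hasDerivAt_iff_tendsto_slope.1 h).mono_left
    (nhdsWithin_mono r fun s (hs : s < r) => hs.ne)
  filter_upwards [h1.eventually (lt_mem_nhds hg'), self_mem_nhdsWithin] with s hs hsr
  rw [slope_def_field] at hs
  have hsr' : s - r < 0 := sub_neg.2 hsr
  by_contra! hle
  exact absurd (div_nonpos_of_nonneg_of_nonpos (sub_nonneg.2 hle) hsr'.le) (not_le.2 hs)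

theorem eventually_lt_right_of_hasDerivAt_pos {g : ℝ → ℝ} {g' r : ℝ} (h : HasDerivAt g g' r)
    (hg' : 0 < g') : ∀ᶠ s in 𝓝[>] r, g r < g s := by
  have h1 := (hasDerivAt_iff_tendsto_slope.1 h).mono_left
    (nhdsWithin_mono r fun s (hs : r < s) => hs.ne')
  filter_upwards [h1.eventually (lt_mem_nhds hg'), self_mem_nhdsWithin] with s hs hsr
  rw [slope_def_field] at hs
  have hsr' : 0 < s - r := sub_pos.2 hsr
  linarith [(div_pos_iff_of_pos_right hsr').1 hs]

/-- A function above a level before time `r` is above it at time `r`, if it cannot reach the level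
with non-positive speed. -/
theorem lt_of_forall_lt_before {g : ℝ → ℝ} {g' y s r : ℝ} (hsr : s < r) (h : HasDerivAt g g' r)
    (hlt : ∀ r' ∈ Ico s r, y < g r') (hpos : g r = y → 0 < g') : y < g r := by
  have hle : y ≤ g r := by
    refine ge_of_tendsto (h.continuousAt.tendsto.mono_left (nhdsWithin_le_nhds (s := Iio r))) ?_
    filter_upwards [Ioo_mem_nhdsLT hsr] with r' hr' using (hlt r' (Ioo_subset_Ico_self hr')).le
  refine lt_of_le_of_ne hle fun heq => ?_
  obtain ⟨r', h1, h2⟩ := ((eventually_lt_left_of_hasDerivAt_pos h (hpos heq.symm)).and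
    (Ioo_mem_nhdsLT hsr)).exists
  exact absurd (hlt r' (Ioo_subset_Ico_self h2)) (by linarith)

theorem nonneg_of_forall_lt_before {g : ℝ → ℝ} {g' s r : ℝ} (hsr : s < r) (h : HasDerivAt g g' r)
    (hlt : ∀ r' ∈ Ico s r, g r' < g r) : 0 ≤ g' := by
  by_contra! hneg
  obtain ⟨r', h1, h2⟩ := ((eventually_lt_left_of_hasDerivAt_pos h.neg (neg_pos.2 hneg)).and
    (Ioo_mem_nhdsLT hsr)).exists
  have := hlt r' (Ioo_subset_Ico_self h2)
  simp only [Pi.neg_apply] at h1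
  linarith

/-- Trajectories that pass through `(y, ∞) × (q, ∞)` stay to the right of `x₀` for at least the
time `t`, and trajectories can reach the right end of `𝕂` within time `t` only through this set. -/
structure ConfinesRight (M : Model) (H : ℝ → ℝ → ℝ) (x₀ t y q : ℝ) : Prop where
  lt : x₀ < y
  mem : y ∈ interior M.space
  trap : ∀ s τ, s ≤ τ → τ - s ≤ t → ∀ z, (∀ r ∈ Icc s τ, IsTraj M H z r) →
    y < (z s).1 → q < (z s).2 → x₀ < (z τ).1
  escape : ∀ c ∈ interior M.space, ∃ b ∈ interior M.space, c < b ∧ ∀ τ ∈ Icc 0 t, ∀ z,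
    (∀ r ∈ Icc 0 τ, IsTraj M H z r) → (z 0).1 ≤ c → (∀ r ∈ Ico 0 τ, (z r).1 < b) →
    (z τ).1 = b → ∃ s ∈ Icc 0 τ, y < (z s).1 ∧ q < (z s).2

/-- The quadrant `[y, ∞) × [q, ∞)` is not left by the flow, and the velocity at momentum `q` is
negative at points arbitrarily close to the right end. -/
structure RightQuadrant (M : Model) (H : ℝ → ℝ → ℝ) (x₀ y q : ℝ) : Prop where
  lt : x₀ < y
  mem : y ∈ interior M.space
  dP_nonneg : 0 ≤ dP H y q
  dX_nonpos : ∀ x ∈ interior M.space, y ≤ x → dX M H x q ≤ 0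
  far : ∀ c ∈ interior M.space, ∃ b ∈ interior M.space, c < b ∧ dP H b q < 0

/-- The force at momentum `q` is only known to be non-negative, so a sign argument at the boundary
would not suffice. A Lipschitz bound of the force instead prevents the momentum from reaching `q` in
finite time. While it is above `q`, strict convexity makes the velocity over `y` positive, so the
side x = `y` is not crossed either. -/
theorem RightQuadrant.preserved {M : Model} {H : ℝ → ℝ → ℝ} (hC : Core M H) {x₀ y q : ℝ}
    (h : RightQuadrant M H x₀ y q) {s τ : ℝ} {z : ℝ → ℝ × ℝ}
    (hz : ∀ r ∈ Icc s τ, IsTraj M H z r) (hs : z s ∈ Ioi y ×ˢ Ioi q) :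
    ∀ r ∈ Icc s τ, z r ∈ Ioi y ×ˢ Ioi q := by
  refine mem_of_forall_mem_before (isOpen_Ioi.prod isOpen_Ioi)
    (fun r hr => (hz r hr).2.continuousAt.continuousWithinAt) hs fun r hr hbefore => ?_
  have hsub : Icc s r ⊆ Icc s τ := Icc_subset_Icc_right hr.2
  have hzc : ContinuousOn z (Icc s r) := fun r' hr' =>
    (hz r' (hsub hr')).2.continuousAt.continuousWithinAt
  have hne : (Icc s r).Nonempty := ⟨s, le_rfl, hr.1.le⟩
  obtain ⟨r₁, hr₁, hmin⟩ := isCompact_Icc.exists_isMinOn hne (continuous_fst.comp_continuousOn hzc)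
  obtain ⟨r₂, hr₂, hmax⟩ := isCompact_Icc.exists_isMaxOn hne (continuous_fst.comp_continuousOn hzc)
  obtain ⟨r₃, hr₃, hmax'⟩ := isCompact_Icc.exists_isMaxOn hne (continuous_snd.comp_continuousOn hzc)
  have hbox : Icc (z r₁).1 (z r₂).1 ×ˢ Icc q (z r₃).2 ⊆ phase M := fun w hw =>
    mem_phase.2 (M.Icc_subset (mem_phase.1 (hz r₁ (hsub hr₁)).1)
      (mem_phase.1 (hz r₂ (hsub hr₂)).1) hw.1)
  -- On a box around the trajectory the force is at least `-K * (p - q)`, so `(p - q) * exp (K * r)`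
  -- is non-decreasing.
  obtain ⟨K, hK⟩ := (hC.contDiffOn_dX.mono hbox).exists_lipschitzOnWith one_ne_zero
    ((convex_Icc _ _).prod (convex_Icc _ _)) (isCompact_Icc.prod isCompact_Icc)
  have hslope : ∀ r' ∈ Ioo s r, 0 ≤ -dX M H (z r').1 (z r').2 + K * ((z r').2 - q) := by
    intro r' hr'
    have hr'' : r' ∈ Icc s r := Ioo_subset_Icc_self hr'
    have hmem := hbefore r' (Ioo_subset_Ico_self hr')
    have hx : (z r').1 ∈ Icc (z r₁).1 (z r₂).1 := ⟨hmin hr'', hmax hr''⟩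
    have hpq : q ≤ (z r').2 := (mem_Ioi.1 hmem.2).le
    have hp : (z r').2 ∈ Icc q (z r₃).2 := ⟨hpq, hmax' hr''⟩
    have := hK.dist_le_mul (z r') ⟨hx, hp⟩ ((z r').1, q) ⟨hx, le_rfl, hp.1.trans hp.2⟩
    simp only [Prod.dist_eq, Real.dist_eq, sub_self, abs_zero, Function.uncurry] at this
    rw [max_eq_right (abs_nonneg _), abs_of_nonneg (sub_nonneg.2 hpq)] at this
    have h1 := (abs_le.1 this).2
    have h2 := h.dX_nonpos (z r').1 (mem_phase.1 (hz r' (hsub hr'')).1) (mem_Ioi.1 hmem.1).le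
    linarith
  have hmono : MonotoneOn (fun r' => ((z r').2 - q) * Real.exp (K * r')) (Icc s r) := by
    have hder : ∀ r' ∈ Icc s r, HasDerivAt (fun r' => ((z r').2 - q) * Real.exp (K * r'))
        ((-dX M H (z r').1 (z r').2 + K * ((z r').2 - q)) * Real.exp (K * r')) r' := by
      intro r' hr'
      refine (((hz r' (hsub hr')).hasDerivAt_snd.sub_const q).mul
        ((hasDerivAt_id r').const_mul (K : ℝ)).exp).congr_deriv ?_
      simp only [id_eq]
      ring
    refine monotoneOn_of_deriv_nonneg (convex_Icc s r)
      (fun r' hr' => (hder r' hr').continuousAt.continuousWithinAt)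
      (fun r' hr' => (hder r' (interior_subset hr')).differentiableAt.differentiableWithinAt)
      fun r' hr' => ?_
    rw [(hder r' (interior_subset hr')).deriv]
    rw [interior_Icc] at hr'
    exact mul_nonneg (hslope r' hr') (Real.exp_pos _).le
  have hpr : q < (z r).2 := by
    have h1 := hmono ⟨le_rfl, hr.1.le⟩ ⟨hr.1.le, le_rfl⟩ hr.1.le
    have h2 : 0 < ((z s).2 - q) * Real.exp (K * s) :=
      mul_pos (sub_pos.2 hs.2) (Real.exp_pos _)
    exact sub_pos.1 (pos_of_mul_pos_left (h2.trans_le h1) (Real.exp_pos _).le)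
  refine ⟨lt_of_forall_lt_before hr.1 (hz r ⟨hr.1.le, hr.2⟩).hasDerivAt_fst
    (fun r' hr' => (hbefore r' hr').1) fun heq => ?_, hpr⟩
  rw [heq]
  exact h.dP_nonneg.trans_lt (hC.strictMono_dP h.mem hpr)

/-- A first arrival at `b` from the left needs non-negative velocity. At a point `b` with negative
velocity at momentum `q`, convexity then forces the momentum above `q`, which is inside the
quadrant. -/
theorem RightQuadrant.confinesRight {M : Model} {H : ℝ → ℝ → ℝ} (hC : Core M H) {x₀ y q : ℝ}
    (h : RightQuadrant M H x₀ y q) (t : ℝ) : ConfinesRight M H x₀ t y q where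
  lt := h.lt
  mem := h.mem
  trap s τ hsτ _ z hz hy hq :=
    h.lt.trans (h.preserved hC hz ⟨hy, hq⟩ τ ⟨hsτ, le_rfl⟩).1
  escape c hc := by
    obtain ⟨b, hb, hcb, hneg⟩ := h.far (max c y) (by
      rcases max_choice c y with h' | h' <;> rw [h']
      exacts [hc, h.mem])
    refine ⟨b, hb, (le_max_left _ _).trans_lt hcb, fun τ hτ z hz h0 hlt heq => ?_⟩
    have hτ0 : 0 < τ := lt_of_le_of_ne hτ.1 fun h0τ => by
      rw [← h0τ] at heq
      linarith [le_max_left c y]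
    refine ⟨τ, ⟨hτ.1, le_rfl⟩, by linarith [le_max_right c y], ?_⟩
    by_contra! hle
    have h1 := nonneg_of_forall_lt_before hτ0 (hz τ ⟨hτ.1, le_rfl⟩).hasDerivAt_fst
      (fun r hr => (hlt r hr).trans_eq heq.symm)
    rw [heq] at h1
    linarith [(hC.strictMono_dP hb).monotone hle]

/-! ### Interacting diffusions -/

theorem DiffusionDrift.neg_le_deriv_deriv {W : ℝ → ℝ} {L : ℝ}
    (hL : ∀ x y, y < x → -(deriv W x - deriv W y) ≤ L * (x - y)) (hW : ContDiff ℝ 3 W) (x : ℝ) :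
    -L ≤ deriv (deriv W) x := by
  have hd : DifferentiableAt ℝ (deriv W) x :=
    ((contDiff_succ_iff_deriv (n := 2)).1 hW).2.2.differentiable (by norm_num) x
  have hmono : Monotone fun x => deriv W x + L * x := by
    intro a b hab
    rcases hab.lt_or_eq with hlt | rfl
    · have := hL b a hlt
      simp only
      linarith
    · rfl
  have h1 : HasDerivAt (fun x => deriv W x + L * x) (deriv (deriv W) x + L * 1) x :=
    hd.hasDerivAt.add ((hasDerivAt_id x).const_mul L)
  have h2 := hmono.deriv_nonneg (x := x)
  rw [h1.deriv] at h2
  linarith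

/-- The force is p W''(x) ≥ -L p for p ≥ 0, so a positive momentum decays at most at rate `L`: if it
is large at first, it stays large enough during a time `t` to prevent crossing `y`. Conversely,
while the momentum is at most `q` to the right of `y`, the one-sided Lipschitz bound makes the
velocity grow at most linearly in the position, and only a bounded distance is covered within time
`t`. -/
theorem confinesRight_of_diffusion {W : ℝ → ℝ} {H : ℝ → ℝ → ℝ} (hW : DiffusionDrift W)
    (hH : ∀ x p, H x p = 1 / 2 * p ^ 2 - p * deriv W x) (x₀ t : ℝ) :
    ∃ y q, ConfinesRight Model.line H x₀ t y q := by
  obtain ⟨L, hL0, hL⟩ := hW.oneSidedLipschitz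
  have hW2 := DiffusionDrift.neg_le_deriv_deriv hL hW.contDiff
  have hWd : Differentiable ℝ (deriv W) :=
    ((contDiff_succ_iff_deriv (n := 2)).1 hW.contDiff).2.2.differentiable (by norm_num)
  have huniv : ∀ x : ℝ, x ∈ interior Model.line.space := fun x => by simp [Model.space]
  have hdP : ∀ x p, dP H x p = p - deriv W x := by
    intro x p
    have h1 : HasDerivAt (H x) (1 / 2 * (2 * p ^ (2 - 1) * 1) - 1 * deriv W x) p := by
      rw [show H x = fun p => 1 / 2 * p ^ 2 - p * deriv W x from funext (hH x)]
      exact (((hasDerivAt_id p).pow 2).const_mul (1 / 2)).sub ((hasDerivAt_id p).mul_const _)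
    rw [dP, h1.deriv]
    ring
  have hdX : ∀ x p, dX Model.line H x p = -(p * deriv (deriv W) x) := by
    intro x p
    rw [dX_eq_deriv H (huniv x), show (fun y => H y p) = fun y => 1 / 2 * p ^ 2 - p * deriv W y from
      funext fun y => hH y p]
    exact (((hWd x).hasDerivAt.const_mul p).const_sub _).deriv
  set y := x₀ + 1 with hy
  -- Momentum above `h` beats the drift at `y`; the factor in `q` compensates the decay of the
  -- momentum during time `t`.
  set h := |deriv W y| + 1 with hh
  have hhpos : 0 < h := by positivity
  set q := h * Real.exp (L * t) with hq
  have hqpos : 0 < q := by positivity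
  refine ⟨y, q, by linarith, huniv y, ?_, ?_⟩
  · intro s τ hsτ hτ z hz hys hqs
    have hmono : ∀ r ∈ Icc s τ, (∀ r' ∈ Ico s r, 0 < (z r').2) →
        (z s).2 * Real.exp (L * s) ≤ (z r).2 * Real.exp (L * r) := by
      intro r hr hpos
      have hder : ∀ r' ∈ Icc s r, HasDerivAt (fun r' => (z r').2 * Real.exp (L * r'))
          ((z r').2 * (deriv (deriv W) (z r').1 + L) * Real.exp (L * r')) r' := by
        intro r' hr'
        refine ((hz r' ⟨hr'.1, hr'.2.trans hr.2⟩).hasDerivAt_snd.mul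
          ((hasDerivAt_id r').const_mul L).exp).congr_deriv ?_
        simp only [id_eq, hdX]
        ring
      refine monotoneOn_of_deriv_nonneg (convex_Icc s r)
        (fun r' hr' => (hder r' hr').continuousAt.continuousWithinAt)
        (fun r' hr' => (hder r' (interior_subset hr')).differentiableAt.differentiableWithinAt)
        (fun r' hr' => ?_) ⟨le_rfl, hr.1⟩ ⟨hr.1, le_rfl⟩ hr.1
      rw [(hder r' (interior_subset hr')).deriv]
      rw [interior_Icc] at hr'
      exact mul_nonneg (mul_nonneg (hpos r' (Ioo_subset_Ico_self hr')).le
        (by linarith [hW2 (z r').1])) (Real.exp_pos _).le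
    have hpos : ∀ r ∈ Icc s τ, (z r).2 ∈ Ioi (0 : ℝ) :=
      mem_of_forall_mem_before (γ := fun r => (z r).2) isOpen_Ioi
        (fun r hr => (hz r hr).hasDerivAt_snd.continuousAt.continuousWithinAt)
        (mem_Ioi.2 (hqpos.trans hqs)) fun r hr hbefore => by
          have h1 := hmono r ⟨hr.1.le, hr.2⟩ hbefore
          have h2 : 0 < (z s).2 * Real.exp (L * s) := mul_pos (hqpos.trans hqs) (Real.exp_pos _)
          exact pos_of_mul_pos_left (h2.trans_le h1) (Real.exp_pos _).le
    have hbig : ∀ r ∈ Icc s τ, h < (z r).2 := by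
      intro r hr
      have h1 := hmono r hr fun r' hr' => hpos r' ⟨hr'.1, hr'.2.le.trans hr.2⟩
      have h2 : q * Real.exp (L * s) < (z s).2 * Real.exp (L * s) :=
        mul_lt_mul_of_pos_right hqs (Real.exp_pos _)
      have h3 : h * Real.exp (L * r) ≤ q * Real.exp (L * s) := by
        rw [hq, mul_assoc, ← Real.exp_add]
        refine mul_le_mul_of_nonneg_left (Real.exp_le_exp.2 ?_) hhpos.le
        nlinarith [hr.2]
      exact lt_of_mul_lt_mul_right (h3.trans_lt (h2.trans_le h1)) (Real.exp_pos _).le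
    have hright : ∀ r ∈ Icc s τ, (z r).1 ∈ Ioi y :=
      mem_of_forall_mem_before (γ := fun r => (z r).1) isOpen_Ioi
        (fun r hr => (hz r hr).hasDerivAt_fst.continuousAt.continuousWithinAt) hys
        fun r hr hbefore => lt_of_forall_lt_before hr.1 (hz r ⟨hr.1.le, hr.2⟩).hasDerivAt_fst
          hbefore fun heq => by
            rw [hdP, heq]
            linarith [hbig r ⟨hr.1.le, hr.2⟩, le_abs_self (deriv W y)]
    have := hright τ ⟨hsτ, le_rfl⟩
    rw [mem_Ioi] at this
    linarith
  · intro c _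
    set k := |q - deriv W y| + 1 with hk
    have hkpos : 0 < k := by positivity
    -- A strict barrier: B' = k e^{Lr} + L (B - y), while on the barrier a velocity with momentum at
    -- most `q` is at most q - W'(y) + L (B - y), and the summand 1 in `k` makes the comparison
    -- strict. The target `b` is placed beyond B(t).
    set B : ℝ → ℝ := fun r => y + (max c y + 1 - y + k * r) * Real.exp (L * r) with hB
    have hd : 0 < max c y + 1 - y := by linarith [le_max_right c y]
    refine ⟨max c (B t) + 1, huniv _, by linarith [le_max_left c (B t)],
      fun τ hτ z hz h0 _ heq => ?_⟩
    by_contra! hcon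
    have hBder : ∀ r, HasDerivAt B (k * Real.exp (L * r) + L * (B r - y)) r := by
      intro r
      have := ((((hasDerivAt_id r).const_mul k).const_add (max c y + 1 - y)).mul
        ((hasDerivAt_id r).const_mul L).exp).const_add y
      refine this.congr_deriv ?_
      simp only [hB, id_eq]
      ring
    have hle := image_le_of_deriv_right_lt_deriv_boundary (a := 0) (b := τ)
      (f := fun r => (z r).1) (f' := fun r => dP H (z r).1 (z r).2)
      (fun r hr => (hz r hr).hasDerivAt_fst.continuousAt.continuousWithinAt)
      (fun r hr => (hz r (Ico_subset_Icc_self hr)).hasDerivAt_fst.hasDerivWithinAt)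
      (B := B) (by simp [hB]; linarith [le_max_left c y]) hBder
      (fun r hr heqr => by
        have h1 : 1 ≤ Real.exp (L * r) := Real.one_le_exp (mul_nonneg hL0 hr.1)
        have hBy : y < B r := by
          have : 0 < (max c y + 1 - y + k * r) * Real.exp (L * r) :=
            mul_pos (add_pos_of_pos_of_nonneg hd (mul_nonneg hkpos.le hr.1)) (Real.exp_pos _)
          simp only [hB]
          linarith
        have hyr : y < (z r).1 := by rw [heqr]; exact hBy
        have h2 := hcon r (Ico_subset_Icc_self hr) hyr
        have h3 := hL _ _ hyr
        rw [hdP, ← heqr]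
        have h4 : k ≤ k * Real.exp (L * r) := le_mul_of_one_le_right hkpos.le h1
        linarith [le_abs_self (q - deriv W y)]) (x := τ) ⟨hτ.1, le_rfl⟩
    have hBt : B τ ≤ B t := by
      simp only [hB]
      have h1 : Real.exp (L * τ) ≤ Real.exp (L * t) :=
        Real.exp_le_exp.2 (mul_le_mul_of_nonneg_left hτ.2 hL0)
      have h2 : k * τ ≤ k * t := mul_le_mul_of_nonneg_left hτ.2 hkpos.le
      have h3 : 0 ≤ k * τ := mul_nonneg hkpos.le hτ.1
      have := mul_le_mul (add_le_add_right h2 (max c y + 1 - y)) h1 (Real.exp_pos _).le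
        (by linarith)
      linarith
    have : (z τ).1 ≤ B τ := hle
    linarith [le_max_right c (B t)]

/-! ### Admissible Hamiltonians -/

theorem MainHamiltonian.core {M : Model} {H : ℝ → ℝ → ℝ} (h : MainHamiltonian M H) : Core M H where
  zero x hx := h.zero x (interior_subset hx)
  contDiffOn := h.contDiffOn.mono (prod_mono interior_subset le_rfl)
  convex x hx := h.convex x (interior_subset hx)
  coercive Q hQ hQM c := by
    obtain ⟨K, hK, hKs⟩ := mem_cocompact.1 (h.superlinear Q hQ hQM 1)
    obtain ⟨B, hB⟩ := hK.isBounded.exists_norm_le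
    refine ⟨max (max B 0) c, fun x hx p hp => ?_⟩
    by_cases hpK : p ∈ K
    · exact (hB p hpK).trans ((le_max_left _ _).trans (le_max_left _ _))
    · rcases eq_or_ne p 0 with rfl | hp0
      · simp
      · have h1 : 1 ≤ H x p / |p| := hKs hpK x hx
        have h2 := (le_div_iff₀ (abs_pos.2 hp0)).1 h1
        exact (by linarith : |p| ≤ c).trans (le_max_right _ _)

theorem hasDerivAt_diffusion (w p : ℝ) :
    HasDerivAt (fun p : ℝ => 1 / 2 * p ^ 2 - p * w) (p - w) p := by
  refine ((((hasDerivAt_id p).pow 2).const_mul (1 / 2)).sub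
    ((hasDerivAt_id p).mul_const w)).congr_deriv ?_
  simp

theorem core_of_diffusion {W : ℝ → ℝ} {H : ℝ → ℝ → ℝ} (hW : DiffusionDrift W)
    (hH : ∀ x p, H x p = 1 / 2 * p ^ 2 - p * deriv W x) : Core Model.line H := by
  obtain rfl : H = fun x p => 1 / 2 * p ^ 2 - p * deriv W x := funext₂ hH
  have hW2 : ContDiff ℝ 2 (deriv W) := ((contDiff_succ_iff_deriv (n := 2)).1 hW.contDiff).2.2
  refine ⟨fun x _ => by simp, ?_, fun x _ p => ?_, fun Q hQ _ c => ?_⟩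
  · have : ContDiff ℝ 2 fun z : ℝ × ℝ => 1 / 2 * z.2 ^ 2 - z.2 * deriv W z.1 :=
      (contDiff_const.mul (contDiff_snd.pow 2)).sub (contDiff_snd.mul (hW2.comp contDiff_fst))
    exact this.contDiffOn
  · have h1 : dP (fun x p => 1 / 2 * p ^ 2 - p * deriv W x) = fun x p => p - deriv W x :=
      funext₂ fun x p => (hasDerivAt_diffusion _ p).deriv
    rw [h1, dP, show deriv (fun p => p - deriv W x) p = 1 from
      ((hasDerivAt_id p).sub_const (deriv W x)).deriv]
    exact one_pos
  · obtain ⟨w, hw⟩ := hQ.exists_bound_of_continuousOn hW2.continuous.continuousOn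
    -- Beyond this bound, |p|/2 - |w| > |c| + 1 and |p| > 1, hence H ≥ |p| (|p|/2 - |w|) > |c|.
    refine ⟨2 * |w| + 2 * |c| + 2, fun x hx p hp => ?_⟩
    by_contra! hlt
    have h1 : p * deriv W x ≤ |p| * |w| := by
      refine (le_abs_self _).trans ?_
      rw [abs_mul]
      exact mul_le_mul_of_nonneg_left ((hw x hx).trans (le_abs_self w)) (abs_nonneg p)
    nlinarith [sq_abs p, abs_nonneg p, le_abs_self c, abs_nonneg w, abs_nonneg c]

theorem hasDerivAt_glauber (a b p : ℝ) :
    HasDerivAt (fun p : ℝ => a * (Real.exp (2 * p) - 1) + b * (Real.exp (-2 * p) - 1))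
      (2 * a * Real.exp (2 * p) - 2 * b * Real.exp (-2 * p)) p := by
  refine (((((hasDerivAt_id p).const_mul 2).exp.sub_const 1).const_mul a).add
    ((((hasDerivAt_id p).const_mul (-2)).exp.sub_const 1).const_mul b)).congr_deriv ?_
  simp only [id_eq]
  ring

theorem interior_interval_space : interior Model.interval.space = Ioo (-1 : ℝ) 1 := interior_Icc

/-! ### Glauber dynamics: coercivity and the invariant quadrant -/

section Glauber

variable {vp vm : ℝ → ℝ} {H : ℝ → ℝ → ℝ}

theorem dP_glauber (hH : ∀ x ∈ Icc (-1 : ℝ) 1, ∀ p,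
    H x p = vp x * (Real.exp (2 * p) - 1) + vm x * (Real.exp (-2 * p) - 1)) {x : ℝ}
    (hx : x ∈ Icc (-1 : ℝ) 1) :
    dP H x = fun p => 2 * vp x * Real.exp (2 * p) - 2 * vm x * Real.exp (-2 * p) := by
  funext p
  rw [dP, show H x = _ from funext (hH x hx)]
  exact (hasDerivAt_glauber _ _ p).deriv

theorem core_of_glauber (hv : JumpRates vp vm) (hH : ∀ x ∈ Icc (-1 : ℝ) 1, ∀ p,
    H x p = vp x * (Real.exp (2 * p) - 1) + vm x * (Real.exp (-2 * p) - 1)) :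
    Core Model.interval H := by
  obtain ⟨V, hV, hIV, hvp, hvm⟩ := hv.regular
  have hsub : interior Model.interval.space ⊆ V :=
    interior_subset.trans hIV
  have hpos : ∀ x ∈ interior Model.interval.space, 0 < vp x ∧ 0 < vm x := fun x hx => by
    have hx' : x ∈ Ioo (-1 : ℝ) 1 := by rwa [interior_interval_space] at hx
    exact ⟨hv.vp_pos x (Ioo_subset_Icc_self hx') hx'.2.ne,
      hv.vm_pos x (Ioo_subset_Icc_self hx') hx'.1.ne'⟩
  refine ⟨fun x hx => ?_, ?_, fun x hx p => ?_, fun Q hQ hQM c => ?_⟩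
  · rw [hH x (interior_subset hx)]; simp
  · have hmaps : MapsTo Prod.fst (phase Model.interval) V := fun z hz => hsub (mem_phase.1 hz)
    have h1 : ContDiffOn ℝ 2 (fun z : ℝ × ℝ => vp z.1 * (Real.exp (2 * z.2) - 1)
        + vm z.1 * (Real.exp (-2 * z.2) - 1)) (phase Model.interval) :=
      ((hvp.comp contDiffOn_fst hmaps).mul
        (((contDiff_const.mul contDiff_snd).exp.sub contDiff_const).contDiffOn)).add
      ((hvm.comp contDiffOn_fst hmaps).mul
        (((contDiff_const.mul contDiff_snd).exp.sub contDiff_const).contDiffOn))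
    exact h1.congr fun z hz => hH z.1 (interior_subset (mem_phase.1 hz)) z.2
  · obtain ⟨h1, h2⟩ := hpos x hx
    have h3 : HasDerivAt (dP H x)
        (4 * vp x * Real.exp (2 * p) + 4 * vm x * Real.exp (-2 * p)) p := by
      rw [dP_glauber hH (interior_subset hx)]
      refine (((((hasDerivAt_id p).const_mul 2).exp).const_mul (2 * vp x)).sub
        ((((hasDerivAt_id p).const_mul (-2)).exp).const_mul (2 * vm x))).congr_deriv ?_
      simp only [id_eq]
      ring
    rw [dP, h3.deriv]
    positivity
  · have hcp : ContinuousOn vp Q := hvp.continuousOn.mono (hQM.trans hsub)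
    have hcm : ContinuousOn vm Q := hvm.continuousOn.mono (hQM.trans hsub)
    obtain ⟨S, hS⟩ := hQ.exists_bound_of_continuousOn (hcp.add hcm)
    rcases Q.eq_empty_or_nonempty with rfl | hne
    · exact ⟨0, fun x hx => absurd hx (notMem_empty x)⟩
    obtain ⟨x₁, hx₁, hmin⟩ := hQ.exists_isMinOn hne (hcp.inf hcm)
    set m := min (vp x₁) (vm x₁)
    have hm : 0 < m := lt_min (hpos x₁ (hQM hx₁)).1 (hpos x₁ (hQM hx₁)).2
    -- One exponential term is at least m |p| and the other at least minus its rate, hence at least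
    -- -S; so m |p| ≤ c + S.
    refine ⟨(|c| + S) / m, fun x hx p hp => ?_⟩
    rw [hH x (interior_subset (hQM hx))] at hp
    obtain ⟨h1, h2⟩ := hpos x (hQM hx)
    have hmx : m ≤ min (vp x) (vm x) := hmin hx
    have hm1 := hmx.trans (min_le_left _ _)
    have hm2 := hmx.trans (min_le_right _ _)
    have hSx : vp x + vm x ≤ S := (le_abs_self _).trans (hS x hx)
    rw [le_div_iff₀ hm]
    have hc := le_abs_self c
    have e1 := Real.exp_pos (2 * p)
    have e2 := Real.exp_pos (-2 * p)
    rcases le_total 0 p with h0 | h0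
    · have h4 : p ≤ Real.exp (2 * p) - 1 := by linarith [Real.add_one_le_exp (2 * p)]
      rw [abs_of_nonneg h0]
      nlinarith [mul_le_mul hm1 h4 h0 h1.le, mul_pos h2 e2]
    · have h4 : -p ≤ Real.exp (-2 * p) - 1 := by linarith [Real.add_one_le_exp (-2 * p)]
      rw [abs_of_nonpos h0]
      nlinarith [mul_le_mul hm2 h4 (by linarith) h2.le, mul_pos h1 e1]

/-- Near 1 the slope of v₊ is below -δ and that of v₋ is bounded by `S`, so at large momentum the
decrease of v₊ decides the sign of ∂_x H. At fixed momentum the velocity becomes negative towards 1,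
because v₊ vanishes there and v₋ does not. -/
theorem rightQuadrant_of_glauber (hv : JumpRates vp vm) (hH : ∀ x ∈ Icc (-1 : ℝ) 1, ∀ p,
    H x p = vp x * (Real.exp (2 * p) - 1) + vm x * (Real.exp (-2 * p) - 1)) {x₀ : ℝ}
    (hx₀ : x₀ ∈ interior Model.interval.space) :
    ∃ y q, RightQuadrant Model.interval H x₀ y q := by
  rw [interior_interval_space] at hx₀
  obtain ⟨V, hV, hIV, hvp, hvm⟩ := hv.regular
  have h1V : (1 : ℝ) ∈ V := hIV ⟨by norm_num, le_rfl⟩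
  have hVn := hV.mem_nhds h1V
  have hdp : ContinuousAt (deriv vp) 1 :=
    (hvp.continuousOn_deriv_of_isOpen hV (by norm_num)).continuousAt hVn
  have hdm : ContinuousAt (deriv vm) 1 :=
    (hvm.continuousOn_deriv_of_isOpen hV (by norm_num)).continuousAt hVn
  have hcp : ContinuousAt vp 1 := hvp.continuousOn.continuousAt hVn
  have hcm : ContinuousAt vm 1 := hvm.continuousOn.continuousAt hVn
  set δ := -deriv vp 1 / 2 with hδ
  have hδ0 : 0 < δ := by have := hv.vp_deriv; rw [hδ]; linarith
  set S := |deriv vm 1| + 1 with hS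
  have hev : ∀ᶠ x in 𝓝 (1 : ℝ), deriv vp x < -δ ∧ |deriv vm x| < S :=
    (hdp.eventually_lt continuousAt_const (by rw [hδ]; linarith [hv.vp_deriv])).and
      (hdm.abs.eventually_lt continuousAt_const (by rw [hS]; linarith))
  obtain ⟨l, hl1, hl⟩ := (mem_nhdsLE_iff_exists_Ioc_subset (a := (1 : ℝ))).1 (mem_nhdsWithin_of_mem_nhds hev)
  rw [mem_Iio] at hl1
  obtain ⟨y, hy, hy1⟩ := exists_between (max_lt hl1 hx₀.2)
  have hyx₀ : x₀ < y := (le_max_right _ _).trans_lt hy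
  have hly : l < y := (le_max_left _ _).trans_lt hy
  have hyI : y ∈ Ioo (-1 : ℝ) 1 := ⟨hx₀.1.trans hyx₀, hy1⟩
  have hvpy : 0 < vp y := hv.vp_pos y (Ioo_subset_Icc_self hyI) hy1.ne
  have hvmy : 0 < vm y := hv.vm_pos y (Ioo_subset_Icc_self hyI) hyI.1.ne'
  -- The first entry makes v₊ outweigh v₋ in the velocity at `y`; the second makes the v₊' term
  -- outweigh the v₋' term in the force, uniformly to the right of `y`.
  set q := max (vm y / vp y) (S / δ) with hq
  have hq0 : 0 < q := (div_pos hvmy hvpy).trans_le (le_max_left _ _)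
  have hexp : q ≤ Real.exp (2 * q) - 1 := by linarith [Real.add_one_le_exp (2 * q)]
  have hexp' : Real.exp (-2 * q) ≤ 1 := Real.exp_le_one_iff.2 (by linarith)
  have hexp0 := Real.exp_pos (-2 * q)
  refine ⟨y, q, hyx₀, by rwa [interior_interval_space], ?_, fun x hx hyx => ?_, fun c hc => ?_⟩
  · rw [dP_glauber hH (Ioo_subset_Icc_self hyI)]
    have h1 : vm y ≤ q * vp y := (div_le_iff₀ hvpy).1 (le_max_left _ _)
    have h2 : q * vp y ≤ vp y * Real.exp (2 * q) := by nlinarith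
    have h3 : vm y * Real.exp (-2 * q) ≤ vm y := mul_le_of_le_one_right hvmy.le hexp'
    simp only
    linarith
  · have hxI : x ∈ Ioo (-1 : ℝ) 1 := by rwa [interior_interval_space] at hx
    have hxV := hV.mem_nhds (hIV (Ioo_subset_Icc_self hxI))
    have hp1 : HasDerivAt vp (deriv vp x) x :=
      ((hvp.contDiffAt hxV).differentiableAt (by norm_num)).hasDerivAt
    have hm1 : HasDerivAt vm (deriv vm x) x :=
      ((hvm.contDiffAt hxV).differentiableAt (by norm_num)).hasDerivAt
    have hder := (hp1.mul_const (Real.exp (2 * q) - 1)).add (hm1.mul_const (Real.exp (-2 * q) - 1))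
    have heq : (fun x' => H x' q) =ᶠ[𝓝 x] fun x' => vp x' * (Real.exp (2 * q) - 1)
        + vm x' * (Real.exp (-2 * q) - 1) := by
      filter_upwards [isOpen_Ioo.mem_nhds hxI] with x' hx' using hH x' (Ioo_subset_Icc_self hx') q
    rw [dX_eq_deriv H hx, (hder.congr_of_eventuallyEq heq).deriv]
    obtain ⟨h1, h2⟩ := hl ⟨hly.trans_le hyx, hxI.2.le⟩
    have h3 : S ≤ q * δ := (div_le_iff₀ hδ0).1 (le_max_right _ _)
    have h4 := (abs_lt.1 h2).1
    nlinarith [(abs_lt.1 h2).2, mul_nonneg hδ0.le (sub_nonneg.2 hexp),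
      mul_nonneg (by linarith : 0 ≤ -δ - deriv vp x) (by linarith : 0 ≤ Real.exp (2 * q) - 1)]
  · rw [interior_interval_space] at hc
    have hlim : ContinuousAt (fun b => 2 * vp b * Real.exp (2 * q) - 2 * vm b * Real.exp (-2 * q))
        1 := by fun_prop
    have hneg : 2 * vp 1 * Real.exp (2 * q) - 2 * vm 1 * Real.exp (-2 * q) < 0 := by
      have := hv.vm_pos 1 ⟨by norm_num, le_rfl⟩ (by norm_num)
      rw [hv.vp_zero]
      have := mul_pos this hexp0
      linarith
    obtain ⟨b, hb, hcb, hb1⟩ := (((hlim.eventually_lt continuousAt_const hneg).filter_mono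
      nhdsWithin_le_nhds).and (Ioo_mem_nhdsLT hc.2)).exists
    have hbI : b ∈ Ioo (-1 : ℝ) 1 := ⟨hc.1.trans hcb, hb1⟩
    refine ⟨b, by rwa [interior_interval_space], hcb, ?_⟩
    rw [dP_glauber hH (Ioo_subset_Icc_self hbI)]
    exact hb

end Glauber

theorem Admissible.core {M : Model} {H : ℝ → ℝ → ℝ} (h : Admissible M H) : Core M H := by
  cases M
  · rcases h with ⟨W, hW, hH⟩ | ⟨h, -⟩
    exacts [core_of_diffusion hW hH, h.core]
  · rcases h with ⟨vp, vm, hv, hH⟩ | ⟨h, -⟩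
    exacts [core_of_glauber hv hH, h.core]

/-! ### The ends of the state space and reflection -/

theorem Model.toRight_neBot (M : Model) : M.toRight.NeBot := by
  cases M <;> simp only [Model.toRight] <;> infer_instance

theorem Model.toLeft_neBot (M : Model) : M.toLeft.NeBot := by
  cases M <;> simp only [Model.toLeft] <;> infer_instance

theorem Model.eventually_toRight {M : Model} {c : ℝ} (hc : c ∈ interior M.space) :
    ∀ᶠ x in M.toRight, c < x ∧ x ∈ interior M.space := by
  cases M
  · simpa [Model.toRight, Model.space] using eventually_gt_atTop c
  · rw [interior_interval_space] at hc ⊢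
    filter_upwards [Ioo_mem_nhdsLT hc.2] with x hx using ⟨hx.1, hc.1.trans hx.1, hx.2⟩

theorem Model.eventually_toLeft {M : Model} {c : ℝ} (hc : c ∈ interior M.space) :
    ∀ᶠ x in M.toLeft, x < c ∧ x ∈ interior M.space := by
  cases M
  · simpa [Model.toLeft, Model.space] using eventually_lt_atBot c
  · rw [interior_interval_space] at hc ⊢
    filter_upwards [Ioo_mem_nhdsGT hc.1] with x hx using ⟨hx.2, hx.1, hx.2.trans hc.2⟩

theorem Model.neg_mem {M : Model} {x : ℝ} (hx : x ∈ interior M.space) :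
    -x ∈ interior M.space := by
  cases M
  · simp [Model.space]
  · rw [interior_interval_space] at hx ⊢
    exact ⟨by linarith [hx.2], by linarith [hx.1]⟩

/-- The Hamiltonian in reflected coordinates. -/
def reflect (H : ℝ → ℝ → ℝ) (x p : ℝ) : ℝ := H (-x) (-p)

theorem dP_reflect (H : ℝ → ℝ → ℝ) (x p : ℝ) : dP (reflect H) x p = -dP H (-x) (-p) :=
  deriv_comp_neg (H (-x)) p

theorem dX_reflect {M : Model} (H : ℝ → ℝ → ℝ) {x : ℝ} (hx : x ∈ interior M.space) (p : ℝ) :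
    dX M (reflect H) x p = -dX M H (-x) (-p) := by
  rw [dX_eq_deriv _ hx, dX_eq_deriv _ (Model.neg_mem hx)]
  exact deriv_comp_neg (fun y => H y (-p)) x

theorem Core.reflect {M : Model} {H : ℝ → ℝ → ℝ} (h : Core M H) : Core M (reflect H) where
  zero x hx := by simpa [SpinFlow.reflect] using h.zero (-x) (Model.neg_mem hx)
  contDiffOn := by
    have : MapsTo (fun z : ℝ × ℝ => -z) (phase M) (phase M) := fun z hz =>
      mem_phase.2 (Model.neg_mem (mem_phase.1 hz))
    exact h.contDiffOn.comp contDiff_neg.contDiffOn this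
  convex x hx p := by
    have h1 : dP (dP (SpinFlow.reflect H)) x p = dP (dP H) (-x) (-p) := by
      rw [dP, show dP (SpinFlow.reflect H) x = fun p => -dP H (-x) (-p) from
        funext (dP_reflect H x), deriv.fun_neg, deriv_comp_neg (dP H (-x)), neg_neg, dP]
    rw [h1]
    exact h.convex _ (Model.neg_mem hx) _
  coercive Q hQ hQM c := by
    obtain ⟨B, hB⟩ := h.coercive ((fun x => -x) '' Q) (hQ.image continuous_neg)
      (by rintro _ ⟨x, hx, rfl⟩; exact Model.neg_mem (hQM hx)) c
    refine ⟨B, fun x hx p hp => ?_⟩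
    rw [← abs_neg]
    exact hB (-x) ⟨x, hx, rfl⟩ (-p) hp

/-- Changing the sign of both position and momentum preserves the form of the Hamilton equations
without reversing time. Confinement at the left end is thus confinement at the right end for the
reflected Hamiltonian. -/
theorem IsTraj.reflect {M : Model} {H : ℝ → ℝ → ℝ} {z : ℝ → ℝ × ℝ} {r : ℝ}
    (h : IsTraj M H z r) : IsTraj M (reflect H) (fun s => -z s) r := by
  refine ⟨mem_phase.2 (Model.neg_mem (mem_phase.1 h.1)), h.2.fun_neg.congr_deriv ?_⟩
  have hx : (-z r).1 ∈ interior M.space := Model.neg_mem (mem_phase.1 h.1)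
  have hX := dX_reflect H hx (-z r).2
  simp only [Prod.fst_neg, Prod.snd_neg, neg_neg] at hX
  ext <;> simp [field, dP_reflect, hX]

/-- The signs on the quadrant are assumed. Close to the end the minimizer of H(x, ·) exceeds the
fixed `q`, and by convexity the velocity at `q` is negative there. -/
theorem MainHamiltonian.rightQuadrant {M : Model} {H : ℝ → ℝ → ℝ} (h : MainHamiltonian M H)
    {x₀ : ℝ} (hx₀ : x₀ ∈ interior M.space) : ∃ y q, RightQuadrant M H x₀ y q := by
  obtain ⟨Y, Q, hY, -, hYlim, -, hdP, hdX⟩ := h.quadrant_right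
  obtain ⟨k, hkmin, -, hk⟩ := h.argmin
  have := M.toRight_neBot
  obtain ⟨n, hn⟩ := (hYlim.eventually (Model.eventually_toRight hx₀)).exists
  refine ⟨Y n, Q n, hn.1, hY n, hdP n _ le_rfl, fun x hx hyx => ?_, fun c hc => ?_⟩
  · have := hdX n x (interior_subset hx) hyx
    linarith
  · obtain ⟨b, ⟨hcb, hb⟩, hbQ⟩ :=
      ((Model.eventually_toRight hc).and (hk.eventually_gt_atTop (Q n))).exists
    refine ⟨b, hb, hcb, ?_⟩
    have h0 : dP H b (k b) = 0 := IsLocalMin.deriv_eq_zero (Eventually.of_forall (hkmin b hb))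
    rw [← h0]
    exact h.core.strictMono_dP hb hbQ

theorem MainHamiltonian.rightQuadrant_reflect {M : Model} {H : ℝ → ℝ → ℝ}
    (h : MainHamiltonian M H) {x₀ : ℝ} (hx₀ : x₀ ∈ interior M.space) :
    ∃ y q, RightQuadrant M (reflect H) (-x₀) y q := by
  obtain ⟨Y, Q, hY, -, hYlim, -, hdP, hdX⟩ := h.quadrant_left
  obtain ⟨k, hkmin, hk, -⟩ := h.argmin
  have := M.toLeft_neBot
  obtain ⟨n, hn⟩ := (hYlim.eventually (Model.eventually_toLeft hx₀)).exists
  refine ⟨-Y n, -Q n, by linarith [hn.1], Model.neg_mem (hY n), ?_, fun x hx hyx => ?_,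
    fun c hc => ?_⟩
  · rw [dP_reflect, neg_neg, neg_neg]
    linarith [hdP n _ le_rfl]
  · rw [dX_reflect H hx, neg_neg]
    exact hdX n (-x) (interior_subset (Model.neg_mem hx)) (by linarith)
  · obtain ⟨b, ⟨hcb, hb⟩, hbQ⟩ :=
      ((Model.eventually_toLeft (Model.neg_mem hc)).and (hk.eventually_lt_atBot (Q n))).exists
    refine ⟨-b, Model.neg_mem hb, by linarith, ?_⟩
    have h0 : dP H b (k b) = 0 := IsLocalMin.deriv_eq_zero (Eventually.of_forall (hkmin b hb))
    rw [dP_reflect, neg_neg, neg_neg, neg_lt_zero, ← h0]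
    exact h.core.strictMono_dP hb hbQ

theorem DiffusionDrift.reflect {W : ℝ → ℝ} (h : DiffusionDrift W) :
    DiffusionDrift fun x => W (-x) where
  contDiff := h.contDiff.comp contDiff_neg
  oneSidedLipschitz := by
    obtain ⟨L, hL0, hL⟩ := h.oneSidedLipschitz
    refine ⟨L, hL0, fun x y hyx => ?_⟩
    rw [deriv_comp_neg, deriv_comp_neg]
    have := hL (-y) (-x) (by linarith)
    linarith

theorem JumpRates.reflect {vp vm : ℝ → ℝ} (h : JumpRates vp vm) :
    JumpRates (fun x => vm (-x)) (fun x => vp (-x)) where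
  vm_zero := by simpa using h.vp_zero
  vm_pos x hx hx1 := h.vp_pos (-x) ⟨by linarith [hx.2], by linarith [hx.1]⟩
    fun h' => hx1 (by linarith)
  vp_zero := h.vm_zero
  vp_pos x hx hx1 := h.vm_pos (-x) ⟨by linarith [hx.2], by linarith [hx.1]⟩
    fun h' => hx1 (by linarith)
  regular := by
    obtain ⟨V, hV, hIV, hp, hm⟩ := h.regular
    refine ⟨(fun x => -x) ⁻¹' V, hV.preimage continuous_neg,
      fun x hx => hIV ⟨by linarith [hx.2], by linarith [hx.1]⟩,
      hm.comp contDiff_neg.contDiffOn fun x hx => hx,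
      hp.comp contDiff_neg.contDiffOn fun x hx => hx⟩
  vp_deriv := by
    rw [deriv_comp_neg]
    linarith [h.vm_deriv]
  vm_deriv := by
    rw [deriv_comp_neg, neg_neg]
    linarith [h.vp_deriv]

theorem Admissible.exists_confinesRight {M : Model} {H : ℝ → ℝ → ℝ} (h : Admissible M H) {x₀ : ℝ}
    (hx₀ : x₀ ∈ interior M.space) (t : ℝ) : ∃ y q, ConfinesRight M H x₀ t y q := by
  have hcore := h.core
  have key : (∃ y q, RightQuadrant M H x₀ y q) → ∃ y q, ConfinesRight M H x₀ t y q :=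
    fun ⟨y, q, hq⟩ => ⟨y, q, hq.confinesRight hcore t⟩
  cases M
  · rcases h with ⟨W, hW, hH⟩ | ⟨h, -⟩
    exacts [confinesRight_of_diffusion hW hH x₀ t, key (h.rightQuadrant hx₀)]
  · rcases h with ⟨vp, vm, hv, hH⟩ | ⟨h, -⟩
    exacts [key (rightQuadrant_of_glauber hv hH hx₀), key (h.rightQuadrant hx₀)]

theorem Admissible.exists_confinesRight_reflect {M : Model} {H : ℝ → ℝ → ℝ} (h : Admissible M H)
    {x₀ : ℝ} (hx₀ : x₀ ∈ interior M.space) (t : ℝ) :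
    ∃ y q, ConfinesRight M (reflect H) (-x₀) t y q := by
  have hcore := h.core.reflect
  have key : (∃ y q, RightQuadrant M (reflect H) (-x₀) y q) →
      ∃ y q, ConfinesRight M (reflect H) (-x₀) t y q :=
    fun ⟨y, q, hq⟩ => ⟨y, q, hq.confinesRight hcore t⟩
  cases M
  · rcases h with ⟨W, hW, hH⟩ | ⟨h, -⟩
    · refine confinesRight_of_diffusion hW.reflect (fun x p => ?_) _ t
      rw [reflect, hH, deriv_comp_neg]
      ring
    · exact key (h.rightQuadrant_reflect hx₀)
  · rcases h with ⟨vp, vm, hv, hH⟩ | ⟨h, -⟩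
    · refine key (rightQuadrant_of_glauber hv.reflect (fun x hx p => ?_) (Model.neg_mem hx₀))
      rw [reflect, hH (-x) ⟨by linarith [hx.2], by linarith [hx.1]⟩, mul_neg, mul_neg,
        ← neg_mul, ← neg_mul, neg_neg]
      ring
    · exact key (h.rightQuadrant_reflect hx₀)

/-! ### The linearized flow -/

/-- `∫₀ˢ exp (-2 m r) dr`. -/
noncomputable def shear (m s : ℝ) : ℝ :=
  if m = 0 then s else (1 - Real.exp (-(2 * m) * s)) / (2 * m)

theorem shear_zero (m : ℝ) : shear m 0 = 0 := by simp [shear]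

theorem hasDerivAt_shear (m s : ℝ) : HasDerivAt (shear m) (Real.exp (-(2 * m) * s)) s := by
  by_cases hm : m = 0
  · have : shear m = id := by funext s; simp [shear, hm]
    rw [this]
    simpa [hm] using hasDerivAt_id s
  · have : shear m = fun s => (1 - Real.exp (-(2 * m) * s)) / (2 * m) := by
      funext s; simp [shear, hm]
    rw [this]
    refine ((((hasDerivAt_id s).const_mul (-(2 * m))).exp.const_sub 1).div_const
      (2 * m)).congr_deriv ?_
    simp only [id_eq]
    field_simp

/-- After the vertical time, the tangent line with slope `a` has been turned over. -/
theorem turned_of_verticalTime_lt {m c a t : ℝ} (hc : 0 < c) (ha : a < min (-(2 * m / c)) 0)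
    (ht : verticalTime m c a < t) : 0 < t ∧ 1 + c * a * shear m t < 0 := by
  obtain ⟨ha1, ha0⟩ := lt_min_iff.1 ha
  have hca : c * a < 0 := mul_neg_of_pos_of_neg hc ha0
  by_cases hm : m = 0
  · simp only [verticalTime, hm, ne_eq, not_true_eq_false, if_false] at ht
    have h0 : 0 < -(1 / (c * a)) := neg_pos.2 (one_div_neg.2 hca)
    refine ⟨h0.trans ht, ?_⟩
    simp only [shear, hm, if_true]
    have h1 : c * a * t < c * a * -(1 / (c * a)) := mul_lt_mul_of_neg_left ht hca
    have h2 : c * a * -(1 / (c * a)) = -1 := by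
      rw [mul_neg, mul_one_div_cancel hca.ne]
    linarith
  · simp only [verticalTime, hm, ne_eq, not_false_eq_true, if_true] at ht
    have hcam : c * a < -(2 * m) := by
      have := mul_lt_mul_of_pos_left ha1 hc
      rwa [mul_neg, mul_div_cancel₀ _ hc.ne'] at this
    set w := 1 + (c / (2 * m) * a)⁻¹ with hw
    -- Since c a < -2m, this quotient is positive, and the sign of `m` decides on which side of 1 it
    -- lies. That makes the vertical time positive for both signs.
    have hw' : w = (c * a + 2 * m) / (c * a) := by
      rw [hw]
      have := hca.ne
      have := ha0.ne
      field_simp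
    have hwpos : 0 < w := by
      rw [hw']
      exact div_pos_of_neg_of_neg (by linarith) hca
    -- The factor changes sign exactly when e^{-2mt} = w, that is, at the vertical time.
    have hsh : 1 + c * a * shear m t
        = (c * a) / (2 * m) * (w - Real.exp (-(2 * m) * t)) := by
      simp only [shear, hm, if_false]
      rw [hw']
      have := ha0.ne
      field_simp
      ring
    rw [hsh]
    rcases lt_or_gt_of_ne hm with hneg | hpos
    · have hw1 : 1 < w := by
        rw [hw', one_lt_div_of_neg hca]
        linarith
      have h1 : 0 < -(1 / (2 * m)) * Real.log w :=
        mul_pos (neg_pos.2 (one_div_neg.2 (by linarith))) (Real.log_pos hw1)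
      refine ⟨h1.trans ht, ?_⟩
      have h2 : Real.log w < -(2 * m) * t := by
        have := mul_lt_mul_of_pos_left ht (by linarith : 0 < -(2 * m))
        have h3 : -(2 * m) * (-(1 / (2 * m)) * Real.log w) = Real.log w := by field_simp
        linarith
      have h3 : w < Real.exp (-(2 * m) * t) := (Real.log_lt_iff_lt_exp hwpos).1 h2
      exact mul_neg_of_pos_of_neg (div_pos_of_neg_of_neg hca (by linarith)) (by linarith)
    · have hw1 : w < 1 := by
        rw [hw', div_lt_one_of_neg hca]
        linarith
      have h1 : 0 < -(1 / (2 * m)) * Real.log w :=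
        mul_pos_of_neg_of_neg (neg_lt_zero.2 (by positivity)) (Real.log_neg hwpos hw1)
      refine ⟨h1.trans ht, ?_⟩
      have h2 : -(2 * m) * t < Real.log w := by
        have := mul_lt_mul_of_neg_left ht (by linarith : -(2 * m) < 0)
        have h3 : -(2 * m) * (-(1 / (2 * m)) * Real.log w) = Real.log w := by field_simp
        linarith
      have h3 : Real.exp (-(2 * m) * t) < w := (Real.lt_log_iff_exp_lt hwpos).1 h2
      exact mul_neg_of_neg_of_pos (div_neg_of_neg_of_pos hca (by linarith)) (by linarith)

/-- The flow of the linearized Hamilton equations at `(x₀, 0)`. -/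
noncomputable def linFlow (x₀ m c s : ℝ) (w : ℝ × ℝ) : ℝ × ℝ :=
  (x₀ + Real.exp (m * s) * ((w.1 - x₀) + c * shear m s * w.2), Real.exp (-m * s) * w.2)

theorem continuous_linFlow (x₀ m c : ℝ) :
    Continuous fun p : ℝ × (ℝ × ℝ) => linFlow x₀ m c p.1 p.2 := by
  have : Continuous (shear m) :=
    continuous_iff_continuousAt.2 fun s => (hasDerivAt_shear m s).continuousAt
  unfold linFlow
  fun_prop

theorem linFlow_fixed (x₀ m c s : ℝ) : linFlow x₀ m c s (x₀, 0) = (x₀, 0) := by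
  simp [linFlow]

theorem linFlow_zero (x₀ m c : ℝ) (w : ℝ × ℝ) : linFlow x₀ m c 0 w = w := by
  simp [linFlow, shear_zero]

theorem hasDerivAt_linFlow_fst (x₀ m c s : ℝ) (w : ℝ × ℝ) :
    HasDerivAt (fun s => (linFlow x₀ m c s w).1)
      (m * ((linFlow x₀ m c s w).1 - x₀) + c * (linFlow x₀ m c s w).2) s := by
  have h1 : HasDerivAt (fun s => Real.exp (m * s)) (Real.exp (m * s) * m) s := by
    simpa using ((hasDerivAt_id s).const_mul m).exp
  have h2 : Real.exp (m * s) * Real.exp (-(2 * m) * s) = Real.exp (-m * s) := by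
    rw [← Real.exp_add]; congr 1; ring
  refine ((h1.mul ((((hasDerivAt_shear m s).const_mul c).mul_const w.2).const_add
    (w.1 - x₀))).const_add x₀).congr_deriv ?_
  simp only [linFlow, ← h2]
  ring

theorem hasDerivAt_linFlow_snd (x₀ m c s : ℝ) (w : ℝ × ℝ) :
    HasDerivAt (fun s => (linFlow x₀ m c s w).2) (-m * (linFlow x₀ m c s w).2) s := by
  refine ((((hasDerivAt_id s).const_mul (-m)).exp).mul_const w.2).congr_deriv ?_
  simp only [linFlow, id_eq]
  ring

/-- A linearization maps trajectories of the linearized flow to solutions. -/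
theorem isHamiltonSol_of_linearization {M : Model} {H : ℝ → ℝ → ℝ} (hC : Core M H) {x₀ m c : ℝ}
    (hx₀ : x₀ ∈ interior M.space) (hm : m = dX M (dP H) x₀ 0) (hc : c = dP (dP H) x₀ 0)
    {Ψ : OpenPartialHomeomorph (ℝ × ℝ) (ℝ × ℝ)}
    (hΨ : ∀ T : ℝ, ∀ γ η : ℝ → ℝ, (∀ s ∈ Ico 0 T, (γ s, η s) ∈ Ψ.source) →
      (IsHamiltonSol M H T γ η ↔
        IsLinearizedSol M H x₀ T (fun s => (Ψ (γ s, η s)).1) (fun s => (Ψ (γ s, η s)).2)))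
    {T : ℝ} {w : ℝ × ℝ} (hw : ∀ s ∈ Ico 0 T, linFlow x₀ m c s w ∈ Ψ.target) :
    IsHamiltonSol M H T (fun s => (Ψ.symm (linFlow x₀ m c s w)).1)
      (fun s => (Ψ.symm (linFlow x₀ m c s w)).2) := by
  have heq : ∀ s ∈ Ico 0 T, Ψ (Ψ.symm (linFlow x₀ m c s w)) = linFlow x₀ m c s w :=
    fun s hs => Ψ.right_inv (hw s hs)
  refine (hΨ T _ _ fun s hs => Ψ.map_target (hw s hs)).2 ⟨fun s hs => ?_, fun s hs => ?_⟩
  · refine ((hasDerivAt_linFlow_fst x₀ m c s w).hasDerivWithinAt.congr_of_mem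
      (fun s' hs' => congrArg Prod.fst (heq s' hs')) hs).congr_deriv ?_
    show _ = dX M (dP H) x₀ 0 * ((Ψ (Ψ.symm (linFlow x₀ m c s w))).1 - x₀)
      + dP (dP H) x₀ 0 * (Ψ (Ψ.symm (linFlow x₀ m c s w))).2
    rw [heq s hs, ← hm, ← hc]
  · refine ((hasDerivAt_linFlow_snd x₀ m c s w).hasDerivWithinAt.congr_of_mem
      (fun s' hs' => congrArg Prod.snd (heq s' hs')) hs).congr_deriv ?_
    show _ = -dX M (dX M H) x₀ 0 * ((Ψ (Ψ.symm (linFlow x₀ m c s w))).1 - x₀)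
      - dX M (dP H) x₀ 0 * (Ψ (Ψ.symm (linFlow x₀ m c s w))).2
    rw [heq s hs, ← hm, hC.dX_dX_zero hx₀]
    ring

/-- A linearizable point is an equilibrium, and if the graph of `D` has been turned over at time
`t`, then a trajectory that starts in it to the right of `x₀` is to the left of `x₀` at time `t`. -/
theorem exists_crossing_of_linearization {M : Model} {H : ℝ → ℝ → ℝ} (hC : Core M H)
    {x₀ m c a t : ℝ} (hx₀ : x₀ ∈ interior M.space) (hm : m = dX M (dP H) x₀ 0)
    (hc : c = dP (dP H) x₀ 0) {D : ℝ → ℝ} (hD0 : D x₀ = 0) (hD : HasDerivAt D a x₀)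
    (hlin : HasC1Linearization M H x₀) (hturn : 1 + c * a * shear m t < 0) :
    IsHamiltonSol M H (t + 1) (fun _ => x₀) (fun _ => 0) ∧
    ∃ γ η : ℝ → ℝ, IsHamiltonSol M H (t + 1) γ η ∧ x₀ < γ 0 ∧ η 0 = D (γ 0) ∧ γ t < x₀ ∧
      ∀ s ∈ Ico 0 (t + 1), γ s ∈ interior M.space := by
  obtain ⟨Ψ, hsrc, hsub, hΨ1, -, hfix, hid, hΨ⟩ := hlin
  have htgt : (x₀, (0 : ℝ)) ∈ Ψ.target := by
    have := Ψ.map_source hsrc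
    rwa [hfix] at this
  have hsymm : Ψ.symm (x₀, 0) = (x₀, 0) := by
    have := Ψ.left_inv hsrc
    rwa [hfix] at this
  have hsub' : Ψ.source ⊆ phase M := by
    refine (Ψ.open_source.subset_interior_iff.2 hsub).trans ?_
    rw [interior_prod_eq, interior_univ, phase]
  -- The constant solution of the linear system pulls back to the constant path at (x₀, 0).
  have hconst := isHamiltonSol_of_linearization hC hx₀ hm hc hΨ (T := t + 1) (w := (x₀, 0))
    fun s _ => by rwa [linFlow_fixed]
  simp only [linFlow_fixed, hsymm] at hconst
  refine ⟨hconst, ?_⟩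
  have hdΨ : HasFDerivAt Ψ (ContinuousLinearMap.id ℝ (ℝ × ℝ)) (x₀, 0) := by
    rw [← hid]
    exact ((hΨ1.contDiffAt (Ψ.open_source.mem_nhds hsrc)).differentiableAt one_ne_zero).hasFDerivAt
  have hdΨs : HasFDerivAt Ψ.symm (ContinuousLinearMap.id ℝ (ℝ × ℝ)) (x₀, 0) :=
    Ψ.hasFDerivAt_symm (f' := ContinuousLinearEquiv.refl ℝ (ℝ × ℝ)) htgt (by rw [hsymm]; exact hdΨ)
  set w : ℝ → ℝ × ℝ := fun x => Ψ (x, D x) with hw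
  have hw0 : w x₀ = (x₀, 0) := by rw [hw]; simp only [hD0, hfix]
  have hdw : HasDerivAt w (1, a) x₀ := by
    have h1 : HasDerivAt (fun x => (x, D x)) ((1 : ℝ), a) x₀ := (hasDerivAt_id x₀).prodMk hD
    have h2 : HasFDerivAt Ψ (ContinuousLinearMap.id ℝ (ℝ × ℝ)) (x₀, D x₀) := by rwa [hD0]
    exact h2.comp_hasDerivAt (f := fun x => (x, D x)) x₀ h1
  -- Because Ψ and its inverse have identity derivative at (x₀, 0), the position at time `t` depends
  -- on the starting position with the same derivative as under the linear flow, and this derivative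
  -- is negative.
  have hdv : HasDerivAt (fun x => linFlow x₀ m c t (w x))
      (Real.exp (m * t) * (1 + c * shear m t * a), Real.exp (-m * t) * a) x₀ := by
    have hfst : HasDerivAt (fun x => (w x).1) 1 x₀ :=
      (ContinuousLinearMap.fst ℝ ℝ ℝ).hasFDerivAt.comp_hasDerivAt x₀ hdw
    have hsnd : HasDerivAt (fun x => (w x).2) a x₀ :=
      (ContinuousLinearMap.snd ℝ ℝ ℝ).hasFDerivAt.comp_hasDerivAt x₀ hdw
    exact ((((hfst.sub_const x₀).add (hsnd.const_mul (c * shear m t))).const_mul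
      (Real.exp (m * t))).const_add x₀).prodMk (hsnd.const_mul (Real.exp (-m * t)))
  have hdg : HasDerivAt (fun x => -(Ψ.symm (linFlow x₀ m c t (w x))).1)
      (-(Real.exp (m * t) * (1 + c * shear m t * a))) x₀ := by
    have h1 : HasFDerivAt Ψ.symm (ContinuousLinearMap.id ℝ (ℝ × ℝ)) (linFlow x₀ m c t (w x₀)) := by
      rwa [hw0, linFlow_fixed]
    have h2 := h1.comp_hasDerivAt x₀ hdv
    exact ((ContinuousLinearMap.fst ℝ ℝ ℝ).hasFDerivAt.comp_hasDerivAt x₀ h2).neg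
  have hgneg : 0 < -(Real.exp (m * t) * (1 + c * shear m t * a)) := by
    have : 1 + c * shear m t * a < 0 := by linarith
    exact neg_pos.2 (mul_neg_of_pos_of_neg (Real.exp_pos _) this)
  have hev1 := eventually_lt_right_of_hasDerivAt_pos hdg hgneg
  -- By compactness of the time interval, linear trajectories from near the fixed point remain in
  -- the domain of the inverse up to time `t + 1`.
  have hev2 : ∀ᶠ v in 𝓝 (x₀, (0 : ℝ)), ∀ s ∈ Icc 0 (t + 1), linFlow x₀ m c s v ∈ Ψ.target := by
    refine isCompact_Icc.eventually_forall_of_forall_eventually fun s _ => ?_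
    refine ((continuous_linFlow x₀ m c).comp continuous_swap).continuousAt.eventually_mem
      (Ψ.open_target.mem_nhds ?_)
    simpa [linFlow_fixed] using htgt
  have hev3 : ∀ᶠ x in 𝓝 x₀, (x, D x) ∈ Ψ.source :=
    (continuousAt_id.prodMk hD.continuousAt).eventually_mem
      (Ψ.open_source.mem_nhds (by simpa [hD0] using hsrc))
  have hwc : Tendsto w (𝓝 x₀) (𝓝 (x₀, 0)) := by
    have := hdw.continuousAt.tendsto
    rwa [hw0] at this
  obtain ⟨x, ⟨⟨hx1, hx2⟩, hx3⟩, hx4⟩ := (((hev1.and ((hwc.eventually hev2).filter_mono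
    nhdsWithin_le_nhds)).and (hev3.filter_mono nhdsWithin_le_nhds)).and
    self_mem_nhdsWithin).exists
  have hmemT : ∀ s ∈ Ico 0 (t + 1), linFlow x₀ m c s (w x) ∈ Ψ.target :=
    fun s hs => hx2 s (Ico_subset_Icc_self hs)
  have hstart : Ψ.symm (linFlow x₀ m c 0 (w x)) = (x, D x) := by
    rw [linFlow_zero, hw]
    exact Ψ.left_inv hx3
  refine ⟨_, _, isHamiltonSol_of_linearization hC hx₀ hm hc hΨ hmemT, ?_, ?_, ?_, fun s hs => ?_⟩
  · simpa only [hstart] using hx4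
  · simp only [hstart]
  · simp only [hw0, linFlow_fixed, hsymm] at hx1
    linarith
  · exact mem_phase.1 (hsub' (Ψ.map_target (hmemT s hs)))

/-! ### Overhangs over linearizable equilibria -/

theorem IsHamiltonSol.of_isTraj {M : Model} {H : ℝ → ℝ → ℝ} {T : ℝ} {z : ℝ → ℝ × ℝ}
    (hz : ∀ s ∈ Ico 0 T, IsTraj M H z s) :
    IsHamiltonSol M H T (fun s => (z s).1) (fun s => (z s).2) where
  mem s hs := interior_subset (mem_phase.1 (hz s hs).1)
  pos_eq s hs := (hz s hs).hasDerivAt_fst.hasDerivWithinAt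
  mom_eq s hs := (hz s hs).hasDerivAt_snd.hasDerivWithinAt

/-- The trajectories that stay in an open set until a given time and then are in an open set start
in an open set. -/
theorem isOpen_setOf_flow_mem {E : Type*} [NormedAddCommGroup E] [NormedSpace ℝ E] {f : E → E}
    {φ : ℝ → E → E} (hφ : IsFlow f φ) {O R : Set E} (hO : IsOpen O) (hR : IsOpen R) {I : Set ℝ}
    (hI : IsOpen I) {ι : ℝ → E} (hι : ContinuousOn ι I) (s : ℝ) :
    IsOpen {x | x ∈ I ∧ (∀ r ∈ Icc 0 s, φ r (ι x) ∈ O) ∧ φ s (ι x) ∈ R} := by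
  have h0 : IsOpen {z | ∀ r ∈ Icc 0 s, φ r z ∈ O} := by
    rw [isOpen_iff_mem_nhds]
    intro z hz
    exact isCompact_Icc.eventually_forall_of_forall_eventually fun r hr =>
      (hφ.continuous.comp continuous_swap).continuousAt.eventually_mem (hO.mem_nhds (hz r hr))
  exact hι.isOpen_inter_preimage hI (h0.inter (hR.preimage (hφ.continuous_space s)))

/-- If a trajectory starts in the graph of `D` to the right of the equilibrium `(x₀, 0)` and is to
the left of `x₀` at time `t`, then some trajectory that starts in the graph to the right of `x₀`
is over `x₀` with non-zero momentum at time `t`. -/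
theorem exists_return {M : Model} {H : ℝ → ℝ → ℝ} (hC : Core M H) {x₀ t y q y' q' : ℝ}
    (ht : 0 ≤ t)
    (hR : ConfinesRight M H x₀ t y q) (hL : ConfinesRight M (reflect H) (-x₀) t y' q')
    {D : ℝ → ℝ} (hD : ContinuousOn D (interior M.space)) (hDlim : Tendsto D M.toRight atTop)
    (hfix : dP H x₀ 0 = 0) {T : ℝ} (htT : t < T) {γ η : ℝ → ℝ} (hsol : IsHamiltonSol M H T γ η)
    (hγ0 : x₀ < γ 0) (hη0 : η 0 = D (γ 0)) (hγt : γ t < x₀)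
    (hmem : ∀ s ∈ Ico 0 T, γ s ∈ interior M.space) :
    ∃ T' > t, ∃ z : ℝ → ℝ × ℝ, (∀ s ∈ Ico 0 T', IsTraj M H z s) ∧
      (z 0).2 = D (z 0).1 ∧ (z t).1 = x₀ ∧ (z t).2 ≠ 0 := by
  have hsub : Icc 0 t ⊆ Ico 0 T := fun s hs => ⟨hs.1, hs.2.trans_lt htT⟩
  have h0t : (0 : ℝ) ∈ Icc 0 t := ⟨le_rfl, ht⟩
  set x₁ := γ 0 with hx₁
  have hx₁M : x₁ ∈ interior M.space := hmem 0 (hsub h0t)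
  have hγc : ContinuousOn γ (Icc 0 t) := fun s hs =>
    ((hsol.pos_eq s (hsub hs)).continuousWithinAt).mono hsub
  have hηc : ContinuousOn η (Icc 0 t) := fun s hs =>
    ((hsol.mom_eq s (hsub hs)).continuousWithinAt).mono hsub
  set ι : ℝ → ℝ × ℝ := fun x => (x, D x) with hι
  have hιc : ContinuousOn ι (interior M.space) := continuousOn_id.prodMk hD
  -- a starting point far to the right
  have := M.toRight_neBot
  obtain ⟨x₂, ⟨⟨hx₁₂, hx₂M⟩, hyx₂⟩, hqx₂⟩ := (((Model.eventually_toRight hx₁M).and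
    (Model.eventually_toRight hR.mem)).and (hDlim.eventually_gt_atTop q)).exists
  obtain ⟨s₁, hs₁, hmax⟩ := isCompact_Icc.exists_isMaxOn ⟨0, h0t⟩ hγc
  obtain ⟨s₂, hs₂, hmin⟩ := isCompact_Icc.exists_isMinOn ⟨0, h0t⟩ hγc
  -- The walls `a` and `b` enclose all starting points and the given crossing trajectory, and a
  -- trajectory from [x₁, x₂] can reach them only through the confining sets.
  obtain ⟨b, hb, hcb, hescR⟩ := hR.escape (max x₂ (γ s₁)) (by
    rcases max_choice x₂ (γ s₁) with h | h <;> rw [h]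
    exacts [hx₂M, hmem s₁ (hsub hs₁)])
  obtain ⟨b', hb', hcb', hescL⟩ := hL.escape (-(γ s₂)) (Model.neg_mem (hmem s₂ (hsub hs₂)))
  set a := -b' with ha
  have haM : a ∈ interior M.space := Model.neg_mem hb'
  have haγ : ∀ s ∈ Icc 0 t, a < γ s := fun s hs => by
    have : γ s₂ ≤ γ s := hmin hs
    linarith
  have hγb : ∀ s ∈ Icc 0 t, γ s < b := fun s hs => by
    have : γ s ≤ γ s₁ := hmax hs
    linarith [le_max_right x₂ (γ s₁)]
  have hx₂b : x₂ < b := (le_max_left _ _).trans_lt hcb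
  have hax₁ : a < x₁ := haγ 0 h0t
  have hI : Icc x₁ x₂ ⊆ interior M.space := M.Icc_subset hx₁M hx₂M
  -- With `e` bounding the energies of the arc, its trajectories stay in the compact set `C₁` while
  -- between the walls. `C₂` is added so that the given trajectory is also one of the global flow.
  obtain ⟨e, he⟩ := (isCompact_Icc (a := x₁) (b := x₂)).exists_bound_of_continuousOn
    (f := fun x => H x (D x)) (hC.contDiffOn.continuousOn.comp (hιc.mono hI)
      fun x hx => mem_phase.2 (hI hx))
  set C₁ := {z : ℝ × ℝ | z.1 ∈ Icc a b ∧ H z.1 z.2 ≤ e} with hC₁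
  set C₂ := (fun s => (γ s, η s)) '' Icc 0 t with hC₂
  have hCc : IsCompact (C₁ ∪ C₂) := (hC.isCompact_sublevel haM hb e).union
    (isCompact_Icc.image_of_continuousOn (hγc.prodMk hηc))
  have hCsub : C₁ ∪ C₂ ⊆ phase M := by
    rintro z (hz | ⟨s, hs, rfl⟩)
    · exact mem_phase.2 (M.Icc_subset haM hb hz.1)
    · exact mem_phase.2 (hmem s (hsub hs))
  obtain ⟨f, φ, O, hO, hCO, hOM, hfO, hφ⟩ :=
    exists_flow_eqOn_nhds (isOpen_phase M) hC.contDiffOn_field hCc hCsub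
  have htraj : ∀ z r, φ r z ∈ O → IsTraj M H (fun s => φ s z) r := fun z r hr =>
    ⟨hOM hr, (hφ.hasDerivAt z r).congr_deriv (hfO hr)⟩
  have hιC : ∀ x ∈ Icc x₁ x₂, ι x ∈ C₁ := fun x hx =>
    ⟨⟨hax₁.le.trans hx.1, hx.2.trans hx₂b.le⟩, (le_abs_self _).trans (he x hx)⟩
  -- the starting points of trajectories that end to the right, respectively to the left
  let A : ℝ → Set (ℝ × ℝ) → Set ℝ := fun s R =>
    {x | x ∈ interior M.space ∧ (∀ r ∈ Icc 0 s, φ r (ι x) ∈ O) ∧ φ s (ι x) ∈ R}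
  have hA : ∀ s R, IsOpen R → IsOpen (A s R) := fun s R hR' =>
    isOpen_setOf_flow_mem hφ hO hR' isOpen_interior hιc s
  set Rp : Set (ℝ × ℝ) := Ioi y ×ˢ Ioi q with hRp
  set Rm : Set (ℝ × ℝ) := Iio (-y') ×ˢ Iio (-q') with hRm
  -- Entering a confining set at some time up to `t` already classifies a starting point, whatever
  -- happens to its trajectory later. So the sets are defined without assuming existence up to `t`,
  -- and they are open.
  set P := (⋃ s ∈ Icc 0 t, A s Rp) ∪ A t (Ioi x₀ ×ˢ univ) with hP
  set N := (⋃ s ∈ Icc 0 t, A s Rm) ∪ A t (Iio x₀ ×ˢ univ) with hN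
  have hPo : IsOpen P := (isOpen_biUnion fun s _ => hA s _ (isOpen_Ioi.prod isOpen_Ioi)).union
    (hA t _ (isOpen_Ioi.prod isOpen_univ))
  have hNo : IsOpen N := (isOpen_biUnion fun s _ => hA s _ (isOpen_Iio.prod isOpen_Iio)).union
    (hA t _ (isOpen_Iio.prod isOpen_univ))
  have hPend : ∀ x ∈ P, ∃ s ∈ Icc 0 t, (∀ r ∈ Icc 0 s, φ r (ι x) ∈ O) ∧
      ∀ τ ∈ Icc s t, (∀ r ∈ Icc 0 τ, φ r (ι x) ∈ O) → x₀ < (φ τ (ι x)).1 := by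
    rintro x (hx | hx)
    · obtain ⟨s, hs, -, hxO, hxR⟩ := mem_iUnion₂.1 hx
      refine ⟨s, hs, hxO, fun τ hτ hτO => ?_⟩
      exact hR.trap s τ hτ.1 (by linarith [hτ.2, hs.1]) (fun r => φ r (ι x))
        (fun r hr => htraj _ _ (hτO r ⟨hs.1.trans hr.1, hr.2⟩)) hxR.1 hxR.2
    · refine ⟨t, ⟨ht, le_rfl⟩, hx.2.1, fun τ hτ _ => ?_⟩
      rw [le_antisymm hτ.2 hτ.1]
      exact hx.2.2.1
  have hNend : ∀ x ∈ N, ∃ s ∈ Icc 0 t, (∀ r ∈ Icc 0 s, φ r (ι x) ∈ O) ∧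
      ∀ τ ∈ Icc s t, (∀ r ∈ Icc 0 τ, φ r (ι x) ∈ O) → (φ τ (ι x)).1 < x₀ := by
    rintro x (hx | hx)
    · obtain ⟨s, hs, -, hxO, hxR⟩ := mem_iUnion₂.1 hx
      refine ⟨s, hs, hxO, fun τ hτ hτO => ?_⟩
      have := hL.trap s τ hτ.1 (by linarith [hτ.2, hs.1]) (fun r => -φ r (ι x))
        (fun r hr => (htraj _ _ (hτO r ⟨hs.1.trans hr.1, hr.2⟩)).reflect)
        (lt_neg.1 hxR.1) (lt_neg.1 hxR.2)
      simpa using this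
    · refine ⟨t, ⟨ht, le_rfl⟩, hx.2.1, fun τ hτ _ => ?_⟩
      rw [le_antisymm hτ.2 hτ.1]
      exact hx.2.2.1
  -- At the later of the two classifying times the trajectory is still genuine, and it would be on
  -- both sides of x₀.
  have hdisj : ∀ x, x ∈ P → x ∉ N := by
    intro x hxP hxN
    obtain ⟨s, hs, hsO, hs'⟩ := hPend x hxP
    obtain ⟨r, hr, hrO, hr'⟩ := hNend x hxN
    rcases le_total s r with hsr | hrs
    · exact lt_asymm (hs' r ⟨hsr, hr.2⟩ hrO) (hr' r ⟨le_rfl, hr.2⟩ hrO)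
    · exact lt_asymm (hs' s ⟨le_rfl, hs.2⟩ hsO) (hr' s ⟨hrs, hs.2⟩ hsO)
  have hx₂P : x₂ ∈ P := by
    refine Or.inl (mem_iUnion₂.2 ⟨0, h0t, hx₂M, fun r hr => ?_, ?_⟩)
    · rw [le_antisymm hr.2 hr.1, hφ.zero]
      exact hCO (Or.inl (hιC x₂ ⟨hx₁₂.le, le_rfl⟩))
    · rw [hφ.zero]
      exact ⟨hyx₂.1, hqx₂⟩
  have hx₁N : x₁ ∈ N := by
    have heq : ∀ s ∈ Icc 0 t, (γ s, η s) = φ s (ι x₁) := by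
      have := hφ.eqOn (γ := fun s => (γ s, η s)) (hγc.prodMk hηc) fun s hs => by
        have hsC : (γ s, η s) ∈ O := hCO (Or.inr ⟨s, Ico_subset_Icc_self hs, rfl⟩)
        have hsT := hsub (Ico_subset_Icc_self hs)
        rw [hfO hsC]
        have h1 := (hsol.pos_eq s hsT).prodMk (hsol.mom_eq s hsT)
        exact h1.mono_of_mem_nhdsWithin (mem_of_superset
          (Ico_mem_nhdsGE hsT.2) (Ico_subset_Ico_left hs.1))
      simpa only [← hx₁, hη0] using this
    refine Or.inr ⟨hx₁M, fun r hr => ?_, ?_⟩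
    · rw [← heq r hr]
      exact hCO (Or.inr ⟨r, hr, rfl⟩)
    · rw [← heq t ⟨ht, le_rfl⟩]
      exact ⟨hγt, trivial⟩
  obtain ⟨x, hx, hxP, hxN⟩ : ∃ x ∈ Icc x₁ x₂, x ∉ P ∧ x ∉ N := by
    by_contra! hcon
    obtain ⟨x, -, hxP, hxN⟩ := isPreconnected_Icc P N hPo hNo
      (fun x hx => or_iff_not_imp_left.2 fun h => hcon x hx h) ⟨x₂, ⟨hx₁₂.le, le_rfl⟩, hx₂P⟩
      ⟨x₁, ⟨le_rfl, hx₁₂.le⟩, hx₁N⟩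
    exact hdisj x hxP hxN
  -- the trajectory from `x` neither escapes nor ends to one side of `x₀`
  have hstay : ∀ r ∈ Icc 0 t, φ r (ι x) ∈ O ∩ (Ioo a b ×ˢ univ) := by
    refine mem_of_forall_mem_before (hO.inter (isOpen_Ioo.prod isOpen_univ))
      (hφ.continuous_time _).continuousOn ?_ fun r hr hbefore => ?_
    · rw [hφ.zero]
      exact ⟨hCO (Or.inl (hιC x hx)), ⟨hax₁.trans_le hx.1, hx.2.trans_lt hx₂b⟩, trivial⟩
    · have hcl : φ r (ι x) ∈ Icc a b ×ˢ univ := by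
        refine (isClosed_Icc.prod isClosed_univ).mem_of_tendsto
          ((hφ.continuous_time (ι x)).continuousAt.tendsto.mono_left
            (nhdsWithin_le_nhds (s := Iio r))) ?_
        filter_upwards [Ioo_mem_nhdsLT hr.1] with r' hr'
        have := (hbefore r' (Ioo_subset_Ico_self hr')).2
        exact ⟨Ioo_subset_Icc_self this.1, trivial⟩
      have hen : H (φ r (ι x)).1 (φ r (ι x)).2 ≤ e := by
        have := hC.energy_eq hr.1.le (z := fun r => φ r (ι x))
          (fun r' hr' => htraj _ _ (hbefore r' hr').1) (hφ.continuous_time _).continuousAt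
          (mem_phase.2 (M.Icc_subset haM hb hcl.1))
        rw [this, hφ.zero]
        exact (hιC x hx).2
      have hrO : φ r (ι x) ∈ O := hCO (Or.inl ⟨hcl.1, hen⟩)
      have hO' : ∀ r' ∈ Icc 0 r, φ r' (ι x) ∈ O := fun r' hr' => by
        rcases hr'.2.lt_or_eq with hlt | rfl
        exacts [(hbefore r' ⟨hr'.1, hlt⟩).1, hrO]
      refine ⟨hrO, ⟨lt_of_le_of_ne hcl.1.1 fun heq => ?_, lt_of_le_of_ne hcl.1.2 fun heq => ?_⟩,
        trivial⟩
      · obtain ⟨s, hs, hs1, hs2⟩ := hescL r ⟨hr.1.le, hr.2⟩ (fun r => -φ r (ι x))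
          (fun r' hr' => (htraj _ _ (hO' r' hr')).reflect)
          (by
            simp only [hφ.zero, Prod.fst_neg]
            have h1 : γ s₂ ≤ x₁ := hmin h0t
            have h2 := hx.1
            simp only [hι]
            linarith)
          (fun r' hr' => by
            have := (hbefore r' hr').2.1.1
            simp only [Prod.fst_neg]
            linarith)
          (by simp only [Prod.fst_neg]; linarith)
        exact hxN (Or.inl (mem_iUnion₂.2 ⟨s, ⟨hs.1, hs.2.trans hr.2⟩, hI hx,
          fun r' hr' => hO' r' ⟨hr'.1, hr'.2.trans hs.2⟩, lt_neg.1 hs1, lt_neg.1 hs2⟩))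
      · obtain ⟨s, hs, hs1, hs2⟩ := hescR r ⟨hr.1.le, hr.2⟩ (fun r => φ r (ι x))
          (fun r' hr' => htraj _ _ (hO' r' hr'))
          (by simp only [hφ.zero]; exact hx.2.trans (le_max_left _ _))
          (fun r' hr' => (hbefore r' hr').2.1.2) heq
        exact hxP (Or.inl (mem_iUnion₂.2 ⟨s, ⟨hs.1, hs.2.trans hr.2⟩, hI hx,
          fun r' hr' => hO' r' ⟨hr'.1, hr'.2.trans hs.2⟩, hs1, hs2⟩))
  have hOt : ∀ r ∈ Icc 0 t, φ r (ι x) ∈ O := fun r hr => (hstay r hr).1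
  have hxt : (φ t (ι x)).1 = x₀ := by
    refine le_antisymm (not_lt.1 fun hlt => ?_) (not_lt.1 fun hlt => ?_)
    · exact hxP (Or.inr ⟨hI hx, hOt, hlt, trivial⟩)
    · exact hxN (Or.inr ⟨hI hx, hOt, hlt, trivial⟩)
  have htO := hOt t ⟨ht, le_rfl⟩
  -- Membership in 𝓖_t requires existence strictly beyond `t`; openness of `O` supplies it.
  obtain ⟨T', hT', hT'O⟩ := (mem_nhdsGE_iff_exists_Ico_subset (a := t)).1
    (mem_nhdsWithin_of_mem_nhds
      ((hφ.continuous_time (ι x)).continuousAt.preimage_mem_nhds (hO.mem_nhds htO)))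
  refine ⟨T', hT', fun r => φ r (ι x), fun s hs => htraj _ _ ?_, by simp [hφ.zero, hι], hxt,
    fun h0 => ?_⟩
  · rcases le_total s t with hst | hts
    exacts [hOt s ⟨hs.1, hst⟩, hT'O ⟨hts, hs.2⟩]
  -- With zero momentum the trajectory would be at an equilibrium, so by injectivity of the flow it
  -- would have started there; but it starts at x ≥ x₁ > x₀.
  · have heq : φ t (ι x) = (x₀, 0) := Prod.ext hxt h0
    have hx₀M : x₀ ∈ interior M.space := by
      have := mem_phase.1 (hOM htO)
      rwa [hxt] at this
    have hf0 : f (x₀, 0) = 0 := by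
      rw [heq] at htO
      rw [hfO htO, field, hfix, hC.dX_zero hx₀M, neg_zero]
      rfl
    have h2 : ι x = (x₀, 0) := hφ.injective t (by rw [heq, hφ.eq_of_zero hf0])
    have h3 : x = x₀ := congrArg Prod.fst h2
    linarith [hx.1]

theorem hasOverhang_of_linearization {M : Model} {H : ℝ → ℝ → ℝ} {I₀ : ℝ → ℝ}
    (hH : Admissible M H) (hI : IsCBoundary M 1 I₀) {x₀ : ℝ} (hx₀ : x₀ ∈ interior M.space)
    (hI0 : deriv I₀ x₀ = 0)
    (hI2 : deriv (deriv I₀) x₀ < min (-(2 * dX M (dP H) x₀ 0 / dP (dP H) x₀ 0)) 0)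
    (hlin : HasC1Linearization M H x₀) {t : ℝ}
    (ht : verticalTime (dX M (dP H) x₀ 0) (dP (dP H) x₀ 0) (deriv (deriv I₀) x₀) < t) :
    HasOverhang M H I₀ t x₀ := by
  have hC := hH.core
  obtain ⟨ht0, hturn⟩ := turned_of_verticalTime_lt (hC.convex x₀ hx₀ 0) hI2 ht
  -- A non-zero value of `deriv` certifies differentiability, since the default value is zero.
  have hD : HasDerivAt (deriv I₀) (deriv (deriv I₀) x₀) x₀ :=
    (differentiableAt_of_deriv_ne_zero (lt_min_iff.1 hI2).2.ne).hasDerivAt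
  obtain ⟨hconst, γ, η, hsol, hγ0, hη0, hγt, hmem⟩ :=
    exists_crossing_of_linearization hC hx₀ rfl rfl hI0 hD hlin hturn
  have h0 : (0 : ℝ) ∈ Ico 0 (t + 1) := ⟨le_rfl, by linarith⟩
  have hfix : dP H x₀ 0 = 0 :=
    (uniqueDiffOn_Ico 0 (t + 1) 0 h0).eq_deriv _ (hconst.pos_eq 0 h0)
      (hasDerivWithinAt_const _ _ _)
  obtain ⟨y, q, hR⟩ := hH.exists_confinesRight hx₀ t
  obtain ⟨y', q', hL⟩ := hH.exists_confinesRight_reflect hx₀ t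
  have hDc : ContinuousOn (deriv I₀) (interior M.space) :=
    hI.contDiffOn.continuousOn_deriv_of_isOpen isOpen_interior (by norm_num)
  obtain ⟨T, hT, z, hz, hz0, hzt, hzne⟩ := exists_return hC ht0.le hR hL hDc hI.tendsto_right hfix
    (by linarith : t < t + 1) hsol hγ0 hη0 hγt hmem
  refine ⟨hx₀, 0, (z t).2, hzne.symm, ?_, ?_⟩
  · exact ⟨t + 1, _, _, ⟨ht0.le, by linarith⟩, hconst, ⟨hx₀, hI0.symm⟩, rfl⟩
  · refine ⟨T, _, _, ⟨ht0.le, hT⟩, IsHamiltonSol.of_isTraj hz, ⟨?_, hz0⟩, by rw [← hzt]⟩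
    exact mem_phase.1 (hz 0 ⟨le_rfl, ht0.trans hT⟩).1

/-! ### Hitting times of transversal sections -/

/-- A point `(x, u)` moving with `ẋ = u` on the line crosses `0` downwards, if it turns towards `0`
whenever it is at rest, and its motion is not eventually monotone. -/
theorem exists_downcrossing {x u w : ℝ → ℝ} (hx : ∀ r, 0 ≤ r → HasDerivAt x (u r) r)
    (hu : ∀ r, 0 ≤ r → HasDerivAt u (w r) r)
    (hpos : ∀ r, 0 ≤ r → u r = 0 → 0 < x r → w r < 0)
    (hneg : ∀ r, 0 ≤ r → u r = 0 → x r < 0 → 0 < w r)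
    (hne : ∀ r, 0 ≤ r → x r = 0 → u r ≠ 0)
    (hmono : ∀ T, 0 ≤ T → ¬ MonotoneOn x (Ici T)) (hanti : ∀ T, 0 ≤ T → ¬ AntitoneOn x (Ici T)) :
    ∃ r, 0 ≤ r ∧ x r = 0 ∧ u r < 0 := by
  by_contra! hno
  have hup : ∀ r, 0 ≤ r → x r = 0 → 0 < u r := fun r hr h0 =>
    lt_of_le_of_ne (hno r hr h0) (hne r hr h0).symm
  have hM : ∀ T, 0 ≤ T → ¬ ∀ r, T < r → 0 ≤ u r := fun T hT h =>
    hmono T hT (monotoneOn_of_deriv_nonneg (convex_Ici T)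
      (fun r hr => (hx r (hT.trans hr)).continuousAt.continuousWithinAt)
      (fun r hr => (hx r (hT.trans (interior_subset hr))).differentiableAt.differentiableWithinAt)
      fun r hr => by
        rw [interior_Ici] at hr
        rw [(hx r (hT.trans (le_of_lt hr))).deriv]
        exact h r hr)
  have hA : ∀ T, 0 ≤ T → ¬ ∀ r, T < r → u r ≤ 0 := fun T hT h =>
    hanti T hT (antitoneOn_of_deriv_nonpos (convex_Ici T)
      (fun r hr => (hx r (hT.trans hr)).continuousAt.continuousWithinAt)
      (fun r hr => (hx r (hT.trans (interior_subset hr))).differentiableAt.differentiableWithinAt)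
      fun r hr => by
        rw [interior_Ici] at hr
        rw [(hx r (hT.trans (le_of_lt hr))).deriv]
        exact h r hr)
  -- Without a downward crossing, `x` stays non-negative once it is so. From then on the velocity
  -- can change sign only from plus to minus, so the motion is eventually monotone.
  by_cases hcase : ∃ r₁, 0 ≤ r₁ ∧ 0 ≤ x r₁
  · obtain ⟨r₁, hr₁, hx₁⟩ := hcase
    have hge : ∀ r, r₁ ≤ r → 0 ≤ x r := fun r hr => by
      have := image_le_of_deriv_right_lt_deriv_boundary (f := fun r => -x r) (f' := fun r => -u r)
        (a := r₁) (b := r) (B := fun _ => 0) (B' := fun _ => 0)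
        (fun s hs => (hx s (hr₁.trans hs.1)).neg.continuousAt.continuousWithinAt)
        (fun s hs => (hx s (hr₁.trans hs.1)).neg.hasDerivWithinAt) (by simpa using hx₁)
        (fun s => hasDerivAt_const s 0)
        (fun s hs h0 => by
          have := hup s (hr₁.trans hs.1) (neg_eq_zero.1 h0)
          linarith) (x := r) ⟨hr, le_rfl⟩
      linarith
    have hgt : ∀ r, r₁ < r → 0 < x r := fun r hr => by
      refine lt_of_le_of_ne (hge r hr.le) fun h0 => ?_
      have hr0 : 0 ≤ r := hr₁.trans hr.le
      obtain ⟨s, hs1, hs2⟩ := ((eventually_lt_left_of_hasDerivAt_pos (hx r hr0)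
        (hup r hr0 h0.symm)).and (Ioo_mem_nhdsLT hr)).exists
      linarith [hge s hs2.1.le]
    by_cases hcase2 : ∃ r₂, r₁ < r₂ ∧ u r₂ ≤ 0
    · obtain ⟨r₂, hr₂, hu₂⟩ := hcase2
      refine hA r₂ (hr₁.trans hr₂.le) fun r hr => ?_
      exact image_le_of_deriv_right_lt_deriv_boundary (f := u) (f' := w)
        (a := r₂) (b := r) (B := fun _ => 0) (B' := fun _ => 0)
        (fun s hs => (hu s (by linarith [hs.1])).continuousAt.continuousWithinAt)
        (fun s hs => (hu s (by linarith [hs.1])).hasDerivWithinAt) hu₂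
        (fun s => hasDerivAt_const s 0)
        (fun s hs h0 => hpos s (by linarith [hs.1]) h0 (hgt s (hr₂.trans_le hs.1)))
        (x := r) ⟨hr.le, le_rfl⟩
    · push Not at hcase2
      exact hM r₁ hr₁ fun r hr => (hcase2 r hr).le
  -- If `x` is always negative, the velocity can change sign only from minus to plus, and the motion
  -- is again eventually monotone.
  · push Not at hcase
    by_cases hcase2 : ∃ r₂, 0 ≤ r₂ ∧ 0 ≤ u r₂
    · obtain ⟨r₂, hr₂, hu₂⟩ := hcase2
      refine hM r₂ hr₂ fun r hr => ?_
      have := image_le_of_deriv_right_lt_deriv_boundary (f := fun r => -u r) (f' := fun r => -w r)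
        (a := r₂) (b := r) (B := fun _ => 0) (B' := fun _ => 0)
        (fun s hs => (hu s (hr₂.trans hs.1)).neg.continuousAt.continuousWithinAt)
        (fun s hs => (hu s (hr₂.trans hs.1)).neg.hasDerivWithinAt) (by simpa using hu₂)
        (fun s => hasDerivAt_const s 0)
        (fun s hs h0 => by
          have hs0 := hr₂.trans hs.1
          have := hneg s hs0 (neg_eq_zero.1 h0) (hcase s hs0)
          linarith) (x := r) ⟨hr.le, le_rfl⟩
      linarith
    · push Not at hcase2
      exact hA 0 le_rfl fun r hr => (hcase2 r hr.le).le

/-- The points where `g` crosses `0` upwards. -/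
def upSet {X : Type*} (g u : X → ℝ) : Set X := {z | g z = 0 ∧ 0 < u z}

theorem disjoint_upSet_neg {X : Type*} {g u : X → ℝ} {z : X} (hz : z ∈ upSet g u) :
    z ∉ upSet (fun z => -g z) (fun z => -u z) := fun h => by
  have := hz.2
  have := h.2
  linarith

theorem disjoint_neg_upSet {X : Type*} {g u : X → ℝ} {z : X}
    (hz : z ∈ upSet (fun z => -g z) (fun z => -u z)) : z ∉ upSet g u := fun h =>
  disjoint_upSet_neg h hz

section Hitting

variable {X : Type*} [TopologicalSpace X]

/-- The first time at which the trajectory of `z` is in `S`. -/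
noncomputable def hit (ψ : ℝ → X → X) (S : Set X) (z : X) : ℝ :=
  sInf {r | 0 ≤ r ∧ ψ r z ∈ S}

/-- A closed section `{g = 0, u > 0}`, where `u` is the speed of `g`, that is reached from every
point. -/
structure IsSection (ψ : ℝ → X → X) (g u : X → ℝ) : Prop where
  continuous : Continuous (Function.uncurry ψ)
  zero : ∀ z, ψ 0 z = z
  add : ∀ r s z, 0 ≤ r → 0 ≤ s → ψ (r + s) z = ψ r (ψ s z)
  continuous_g : Continuous g
  continuous_u : Continuous u
  hasDerivAt : ∀ z r, 0 < r → HasDerivAt (fun s => g (ψ s z)) (u (ψ r z)) r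
  ne : ∀ z, g z = 0 → u z ≠ 0
  hits : ∀ z, ∃ r, 0 ≤ r ∧ g (ψ r z) = 0 ∧ 0 < u (ψ r z)

namespace IsSection

variable {ψ : ℝ → X → X} {g u : X → ℝ}

theorem isClosed (h : IsSection ψ g u) : IsClosed (upSet g u) := by
  have : upSet g u = g ⁻¹' {0} ∩ u ⁻¹' Ici 0 := by
    ext z
    exact ⟨fun hz => ⟨hz.1, hz.2.le⟩, fun hz => ⟨hz.1, lt_of_le_of_ne hz.2 (h.ne z hz.1).symm⟩⟩
  rw [this]
  exact (isClosed_singleton.preimage h.continuous_g).inter (isClosed_Ici.preimage h.continuous_u)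

theorem hit_mem (h : IsSection ψ g u) (z : X) :
    0 ≤ hit ψ (upSet g u) z ∧ ψ (hit ψ (upSet g u) z) z ∈ upSet g u := by
  have hc : Continuous fun r => ψ r z :=
    h.continuous.comp (by fun_prop : Continuous fun r : ℝ => (r, z))
  have hcl : IsClosed {r | 0 ≤ r ∧ ψ r z ∈ upSet g u} :=
    isClosed_Ici.inter (h.isClosed.preimage hc)
  exact hcl.csInf_mem (h.hits z) ⟨0, fun r hr => hr.1⟩

theorem hit_le (_ : IsSection ψ g u) {z : X} {r : ℝ} (hr : 0 ≤ r) (hz : ψ r z ∈ upSet g u) :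
    hit ψ (upSet g u) z ≤ r :=
  csInf_le ⟨0, fun _ hr => hr.1⟩ ⟨hr, hz⟩

theorem hit_pos (h : IsSection ψ g u) {z : X} (hz : z ∉ upSet g u) :
    0 < hit ψ (upSet g u) z := by
  refine lt_of_le_of_ne (h.hit_mem z).1 fun h0 => hz ?_
  have := (h.hit_mem z).2
  rwa [← h0, h.zero] at this

/-- Lower semicontinuity holds because the section is closed and is missed on compact time intervals
before the hit. Upper semicontinuity is transversality: `g` changes sign across the hitting time,
nearby trajectories inherit this, and their zeros there have positive speed. Points of the section
are excluded because the hitting time drops to zero on it. -/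
theorem continuousAt_hit (h : IsSection ψ g u) {z : X} (hz : z ∉ upSet g u) :
    ContinuousAt (hit ψ (upSet g u)) z := by
  set τ := hit ψ (upSet g u) z with hτ
  have hτ0 : 0 < τ := h.hit_pos hz
  obtain ⟨-, hτg, hτu⟩ := h.hit_mem z
  have hc : ∀ z, Continuous fun r => ψ r z := fun z =>
    h.continuous.comp (by fun_prop : Continuous fun r : ℝ => (r, z))
  have hs : ∀ r, Continuous (ψ r) := fun r =>
    h.continuous.comp (by fun_prop : Continuous fun z : X => (r, z))
  refine tendsto_order.2 ⟨fun a ha => ?_, fun b hb => ?_⟩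
  · obtain ⟨a', haa', ha'τ⟩ := exists_between ha
    have hev : ∀ᶠ w in 𝓝 z, ∀ r ∈ Icc 0 a', ψ r w ∉ upSet g u := by
      refine isCompact_Icc.eventually_forall_of_forall_eventually fun r hr => ?_
      refine (h.continuous.comp continuous_swap).continuousAt.eventually_mem
        (h.isClosed.isOpen_compl.mem_nhds fun hmem => ?_)
      exact absurd (h.hit_le hr.1 hmem) (not_le.2 (hr.2.trans_lt ha'τ))
    filter_upwards [hev] with w hw
    refine haa'.trans_le (not_lt.1 fun hlt => ?_)
    exact hw _ ⟨(h.hit_mem w).1, hlt.le⟩ (h.hit_mem w).2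
  · have hev : ∀ᶠ p in 𝓝 (τ, z), 0 < u (ψ p.1 p.2) :=
      (h.continuous_u.comp h.continuous).continuousAt.eventually (lt_mem_nhds hτu)
    rw [nhds_prod_eq] at hev
    obtain ⟨pa, hpa, pb, hpb, hpab⟩ := eventually_prod_iff.1 hev
    obtain ⟨ε, hε, hball⟩ := Metric.eventually_nhds_iff_ball.1 hpa
    have hder := h.hasDerivAt z τ hτ0
    have hmax : max 0 (τ - ε) < τ := max_lt hτ0 (by linarith)
    have hmin : τ < min b (τ + ε) := lt_min hb (by linarith)
    obtain ⟨r₁, hr₁, hr₁'⟩ := ((eventually_lt_left_of_hasDerivAt_pos hder hτu).and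
      (Ioo_mem_nhdsLT hmax)).exists
    obtain ⟨r₂, hr₂, hr₂'⟩ := ((eventually_lt_right_of_hasDerivAt_pos hder hτu).and
      (Ioo_mem_nhdsGT hmin)).exists
    rw [hτg] at hr₁ hr₂
    have hr₁0 : 0 ≤ r₁ := (le_max_left _ _).trans hr₁'.1.le
    have hle : r₁ ≤ r₂ := (hr₁'.2.trans hr₂'.1).le
    filter_upwards [hpb, (h.continuous_g.comp (hs r₁)).continuousAt.eventually (gt_mem_nhds hr₁),
      (h.continuous_g.comp (hs r₂)).continuousAt.eventually (lt_mem_nhds hr₂)] with w hw hw₁ hw₂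
    obtain ⟨r, hr, hr0⟩ := intermediate_value_Icc hle
      (h.continuous_g.comp (hc w)).continuousOn ⟨hw₁.le, hw₂.le⟩
    have hrball : r ∈ Metric.ball τ ε := by
      rw [Metric.mem_ball, Real.dist_eq, abs_lt]
      have h1 := (le_max_right 0 (τ - ε)).trans_lt hr₁'.1
      have h2 := hr₂'.2.trans_le (min_le_right b (τ + ε))
      exact ⟨by linarith [hr.1], by linarith [hr.2]⟩
    have hmem : ψ r w ∈ upSet g u := ⟨hr0, hpab (hball r hrball) hw⟩
    exact (h.hit_le (hr₁0.trans hr.1) hmem).trans_lt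
      (hr.2.trans_lt (hr₂'.2.trans_le (min_le_left _ _)))

/-- The first point of the trajectory in the section depends continuously on the start. -/
theorem continuousAt_hitPoint (h : IsSection ψ g u) {z : X} (hz : z ∉ upSet g u) :
    ContinuousAt (fun w => ψ (hit ψ (upSet g u) w) w) z :=
  ContinuousAt.comp (g := Function.uncurry ψ) (f := fun w => (hit ψ (upSet g u) w, w))
    h.continuous.continuousAt ((h.continuousAt_hit hz).prodMk continuousAt_id)

end IsSection

/-- If the travelling time between the two sides of a section is unbounded along a connected set
of starting points, then at all late times both sides are met. -/
theorem exists_forall_ge_mem_upSet {ψ : ℝ → X → X} {g u : X → ℝ} (h : IsSection ψ g u)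
    (h' : IsSection ψ (fun z => -g z) (fun z => -u z)) {Y : Type*} [TopologicalSpace Y]
    [PreconnectedSpace Y] {κ : Y → X} (hκ : Continuous κ) (hκS : ∀ y, κ y ∉ upSet g u) (y₀ : Y)
    (hunb : ∀ K : ℝ, ∃ y, K ≤ hit ψ (upSet (fun z => -g z) (fun z => -u z))
      (ψ (hit ψ (upSet g u) (κ y)) (κ y))) :
    ∃ t₀ : ℝ, 0 < t₀ ∧ ∀ t, t₀ ≤ t → (∃ y, ψ t (κ y) ∈ upSet g u) ∧
      ∃ y, ψ t (κ y) ∈ upSet (fun z => -g z) (fun z => -u z) := by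
  set S := upSet g u with hS
  set S' := upSet (fun z => -g z) (fun z => -u z) with hS'
  let p₁ : Y → X := fun y => ψ (hit ψ S (κ y)) (κ y)
  let p₂ : Y → X := fun y => ψ (hit ψ S' (p₁ y)) (p₁ y)
  have hp₁S : ∀ y, p₁ y ∈ S := fun y => (h.hit_mem _).2
  have hp₂S : ∀ y, p₂ y ∈ S' := fun y => (h'.hit_mem _).2
  have hp₁ : Continuous p₁ := continuous_iff_continuousAt.2 fun y =>
    ContinuousAt.comp (f := κ) (h.continuousAt_hitPoint (hκS y)) hκ.continuousAt
  have hp₂ : Continuous p₂ := continuous_iff_continuousAt.2 fun y =>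
    ContinuousAt.comp (f := p₁) (h'.continuousAt_hitPoint (disjoint_upSet_neg (hp₁S y)))
      hp₁.continuousAt
  have hτ₁ : Continuous fun y => hit ψ S (κ y) := continuous_iff_continuousAt.2 fun y =>
    ContinuousAt.comp (f := κ) (h.continuousAt_hit (hκS y)) hκ.continuousAt
  have hτ₂ : Continuous fun y => hit ψ S' (p₁ y) := continuous_iff_continuousAt.2 fun y =>
    ContinuousAt.comp (f := p₁) (h'.continuousAt_hit (disjoint_upSet_neg (hp₁S y)))
      hp₁.continuousAt
  have hτ₃ : Continuous fun y => hit ψ S (p₂ y) := continuous_iff_continuousAt.2 fun y =>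
    ContinuousAt.comp (f := p₂) (h.continuousAt_hit (disjoint_neg_upSet (hp₂S y)))
      hp₂.continuousAt
  have hn₁ : ∀ y, 0 ≤ hit ψ S (κ y) := fun y => (h.hit_mem _).1
  have hn₂ : ∀ y, 0 ≤ hit ψ S' (p₁ y) := fun y => (h'.hit_mem _).1
  have hn₃ : ∀ y, 0 ≤ hit ψ S (p₂ y) := fun y => (h.hit_mem _).1
  -- `f₂` is the time of the first downward crossing after the first upward one, and `f₃` that of
  -- the next upward crossing. Both are continuous and dominate the unbounded travelling time, so
  -- they attain every value from `f₃ y₀` on.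
  let f₂ : Y → ℝ := fun y => hit ψ S' (p₁ y) + hit ψ S (κ y)
  let f₃ : Y → ℝ := fun y => hit ψ S (p₂ y) + f₂ y
  have hf₂ : ∀ y, ψ (f₂ y) (κ y) = p₂ y := fun y => h.add _ _ _ (hn₂ y) (hn₁ y)
  have hf₃ : ∀ y, ψ (f₃ y) (κ y) ∈ S := fun y => by
    have h1 := h.add _ (f₂ y) (κ y) (hn₃ y) (add_nonneg (hn₂ y) (hn₁ y))
    rw [hf₂] at h1
    have h2 : ψ (hit ψ S (p₂ y)) (p₂ y) ∈ S := (h.hit_mem _).2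
    rwa [← h1] at h2
  have hpos : 0 < hit ψ S (κ y₀) := h.hit_pos (hκS y₀)
  have hf₂y : 0 < f₂ y₀ := add_pos_of_nonneg_of_pos (hn₂ y₀) hpos
  refine ⟨f₃ y₀, add_pos_of_nonneg_of_pos (hn₃ y₀) hf₂y, fun t ht => ⟨?_, ?_⟩⟩
  · obtain ⟨y₁, hy₁⟩ := hunb t
    have hle : t ≤ f₃ y₁ := by
      have h1 := hn₁ y₁
      have h3 := hn₃ y₁
      have h2 : t ≤ hit ψ S' (p₁ y₁) := hy₁
      simp only [f₃, f₂]
      linarith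
    obtain ⟨y, hy⟩ := mem_range_of_exists_le_of_exists_ge (hτ₃.add (hτ₂.add hτ₁)) ⟨y₀, ht⟩ ⟨y₁, hle⟩
    exact ⟨y, hy ▸ hf₃ y⟩
  · obtain ⟨y₁, hy₁⟩ := hunb t
    have hle : t ≤ f₂ y₁ := by
      have h1 := hn₁ y₁
      have h2 : t ≤ hit ψ S' (p₁ y₁) := hy₁
      simp only [f₂]
      linarith
    have hle' : f₂ y₀ ≤ t := (le_add_of_nonneg_left (hn₃ y₀)).trans ht
    obtain ⟨y, hy⟩ := mem_range_of_exists_le_of_exists_ge (hτ₂.add hτ₁) ⟨y₀, hle'⟩ ⟨y₁, hle⟩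
    refine ⟨y, ?_⟩
    have h2 : p₂ y ∈ S' := hp₂S y
    rw [← hf₂] at h2
    rwa [← hy]

end Hitting

/-! ### The region of negative energy between two equilibria -/

/-- Two hyperbolic equilibria of `ẋ = ∂_p H(x, 0)` without equilibria in between. -/
structure Well (M : Model) (H : ℝ → ℝ → ℝ) (m₁ m₂ : ℝ) : Prop where
  left : m₁ ∈ interior M.space
  right : m₂ ∈ interior M.space
  dP_left : dP H m₁ 0 = 0
  dP_right : dP H m₂ 0 = 0
  dP_ne : ∀ x ∈ Ioo m₁ m₂, dP H x 0 ≠ 0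
  ne_left : dX M (dP H) m₁ 0 ≠ 0
  ne_right : dX M (dP H) m₂ 0 ≠ 0

/-- The points of negative energy over `(m₁, m₂)`. -/
def negRegion (H : ℝ → ℝ → ℝ) (m₁ m₂ : ℝ) : Set (ℝ × ℝ) :=
  {z | z.1 ∈ Ioo m₁ m₂ ∧ H z.1 z.2 < 0}

/-- The points of non-positive energy over `[m₁, m₂]`. -/
def nonposRegion (H : ℝ → ℝ → ℝ) (m₁ m₂ : ℝ) : Set (ℝ × ℝ) :=
  {z | z.1 ∈ Icc m₁ m₂ ∧ H z.1 z.2 ≤ 0}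

/-- Near a hyperbolic equilibrium `m`, the force at rest points towards `m`. -/
theorem eventually_dX_sign {M : Model} {H : ℝ → ℝ → ℝ} (hC : Core M H) {m : ℝ}
    (hm : m ∈ interior M.space) (h0 : dP H m 0 = 0) (hne : dX M (dP H) m 0 ≠ 0) :
    ∀ᶠ z in 𝓝 (m, (0 : ℝ)), dP H z.1 z.2 = 0 →
      (m < z.1 → dX M H z.1 z.2 < 0) ∧ (z.1 < m → 0 < dX M H z.1 z.2) := by
  have hz : (m, (0 : ℝ)) ∈ phase M := mem_phase.2 hm
  set μ := dX M (dP H) m 0 with hμ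
  set c := dP (dP H) m 0 with hc
  have hc0 : 0 < c := hC.convex m hm 0
  have hU : HasFDerivAt (Function.uncurry (dP H)) (μ • ContinuousLinearMap.fst ℝ ℝ ℝ
      + c • ContinuousLinearMap.snd ℝ ℝ ℝ) (m, 0) :=
    hasFDerivAt_uncurry hz (hC.differentiableAt_dP hz)
  have hX : HasFDerivAt (Function.uncurry (dX M H)) ((0 : ℝ) • ContinuousLinearMap.fst ℝ ℝ ℝ
      + μ • ContinuousLinearMap.snd ℝ ℝ ℝ) (m, 0) := by
    have h1 := hasFDerivAt_uncurry hz (hC.differentiableAt_dX hz)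
    rw [hC.dP_dX hz, hC.dX_dX_zero hm] at h1
    exact h1
  -- In this combination the momentum cancels to first order, leaving -μ² (x - m). At rest the
  -- velocity term vanishes, so c ∂_x H is -μ² (x - m) up to a small error.
  have hV := (hX.const_mul c).sub (hU.const_mul μ)
  set k := 1 + 2 * |μ| / c with hk
  have hk0 : 0 < k := by positivity
  have hμ2 : 0 < μ ^ 2 := by positivity
  have e1 := hU.isLittleO.bound (half_pos hc0)
  have e2 := hV.isLittleO.bound (by positivity : 0 < μ ^ 2 / (2 * k))
  filter_upwards [e1, e2] with z h1 h2 hz0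
  have hX0 : dX M H m 0 = 0 := hC.dX_zero hm
  simp only [Function.uncurry, hz0, h0, hX0, add_apply,
    sub_apply, smul_apply, ContinuousLinearMap.coe_fst',
    ContinuousLinearMap.coe_snd', Prod.fst_sub, Prod.snd_sub, smul_eq_mul, Prod.norm_def,
    Real.norm_eq_abs, sub_zero, mul_zero, zero_mul, zero_add, zero_sub, Pi.sub_apply] at h1 h2
  set ξ := z.1 - m with hξ
  set p := z.2 with hp
  -- At rest the linear relation μ ξ + c p ≈ 0 bounds the momentum by the displacement, so the error
  -- is at most half the main term.
  have hmax : max |ξ| |p| ≤ k * |ξ| := by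
    have hkξ : 2 * |μ| / c * |ξ| * c = 2 * |μ| * |ξ| := by field_simp
    have hnn : 0 ≤ 2 * |μ| / c * |ξ| := by positivity
    refine max_le (by rw [hk]; linarith [abs_nonneg ξ]) ?_
    rcases le_total |p| |ξ| with hle | hle
    · rw [hk]; linarith
    · rw [max_eq_right hle, abs_neg] at h1
      have h3 : c * |p| ≤ |μ * ξ + c * p| + |μ| * |ξ| := by
        have := abs_sub (μ * ξ + c * p) (μ * ξ)
        rw [add_sub_cancel_left, abs_mul, abs_mul, abs_of_pos hc0] at this
        exact this
      have h4 : c * |p| ≤ c * (2 * |μ| / c * |ξ|) := by linarith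
      have h5 := le_of_mul_le_mul_left h4 hc0
      rw [hk]; linarith [abs_nonneg ξ]
  have hbd : |c * dX M H z.1 z.2 + μ ^ 2 * ξ| ≤ μ ^ 2 / 2 * |ξ| := by
    have h3 : μ ^ 2 / (2 * k) * max |ξ| |p| ≤ μ ^ 2 / (2 * k) * (k * |ξ|) :=
      mul_le_mul_of_nonneg_left hmax (by positivity)
    have h4 : μ ^ 2 / (2 * k) * (k * |ξ|) = μ ^ 2 / 2 * |ξ| := by field_simp
    refine le_trans (le_of_eq ?_) (h2.trans (h3.trans_eq h4))
    congr 1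
    ring
  rw [abs_le] at hbd
  constructor
  · intro hlt
    have hξ0 : 0 < ξ := sub_pos.2 hlt
    rw [abs_of_pos hξ0] at hbd
    have : c * dX M H z.1 z.2 < 0 := by nlinarith [mul_pos hμ2 hξ0]
    exact neg_of_mul_neg_right this hc0.le
  · intro hlt
    have hξ0 : ξ < 0 := sub_neg.2 hlt
    rw [abs_of_neg hξ0] at hbd
    have : 0 < c * dX M H z.1 z.2 := by nlinarith [mul_pos hμ2 (neg_pos.2 hξ0)]
    exact pos_of_mul_pos_right this hc0.le

/-! ### Geometry of the region of negative energy -/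

namespace Well

variable {M : Model} {H : ℝ → ℝ → ℝ} {m₁ m₂ : ℝ}

theorem mem_interior (h : Well M H m₁ m₂) {x : ℝ} (hx : x ∈ Icc m₁ m₂) :
    x ∈ interior M.space := M.Icc_subset h.left h.right hx

theorem nonposRegion_subset (h : Well M H m₁ m₂) : nonposRegion H m₁ m₂ ⊆ phase M :=
  fun _ hz => mem_phase.2 (h.mem_interior hz.1)

theorem negRegion_subset : negRegion H m₁ m₂ ⊆ nonposRegion H m₁ m₂ :=
  fun _ hz => ⟨Ioo_subset_Icc_self hz.1, hz.2.le⟩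

theorem isCompact_nonposRegion (hC : Core M H) (h : Well M H m₁ m₂) :
    IsCompact (nonposRegion H m₁ m₂) := hC.isCompact_sublevel h.left h.right 0

theorem isOpen_negRegion (hC : Core M H) (h : Well M H m₁ m₂) : IsOpen (negRegion H m₁ m₂) := by
  have hopen : IsOpen (Ioo m₁ m₂ ×ˢ (univ : Set ℝ)) := isOpen_Ioo.prod isOpen_univ
  have hsub : Ioo m₁ m₂ ×ˢ (univ : Set ℝ) ⊆ phase M := fun z hz =>
    mem_phase.2 (h.mem_interior (Ioo_subset_Icc_self hz.1))
  have heq : negRegion H m₁ m₂ = Ioo m₁ m₂ ×ˢ univ ∩ Function.uncurry H ⁻¹' Iio 0 := by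
    ext z
    exact ⟨fun hz => ⟨⟨hz.1, trivial⟩, hz.2⟩, fun hz => ⟨hz.1.1, hz.2⟩⟩
  rw [heq]
  exact (hC.contDiffOn.continuousOn.mono hsub).isOpen_inter_preimage hopen isOpen_Iio

/-- Over an equilibrium, zero momentum minimizes the energy, with value zero. So a point of negative
energy cannot lie over the ends of the interval. -/
theorem energy_nonneg_of_eq (hC : Core M H) (h : Well M H m₁ m₂) {x : ℝ} (hx : x = m₁ ∨ x = m₂)
    (p : ℝ) : 0 ≤ H x p := by
  have key : ∀ m ∈ interior M.space, dP H m 0 = 0 → 0 ≤ H m p := fun m hm hm0 => by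
    rcases eq_or_ne p 0 with rfl | hp
    · exact (hC.zero m hm).ge
    · rw [← hC.zero m hm]
      exact (hC.lt_of_dP_eq_zero hm hm0 hp).le
  rcases hx with rfl | rfl
  exacts [key _ h.left h.dP_left, key _ h.right h.dP_right]

theorem mem_negRegion (hC : Core M H) (h : Well M H m₁ m₂) {z : ℝ × ℝ} (hz : z.1 ∈ Icc m₁ m₂)
    (hneg : H z.1 z.2 < 0) : z ∈ negRegion H m₁ m₂ := by
  refine ⟨⟨lt_of_le_of_ne hz.1 fun h' => ?_, lt_of_le_of_ne hz.2 fun h' => ?_⟩, hneg⟩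
  · exact absurd (h.energy_nonneg_of_eq hC (Or.inl h'.symm) z.2) (not_le.2 hneg)
  · exact absurd (h.energy_nonneg_of_eq hC (Or.inr h') z.2) (not_le.2 hneg)

/-- A rest point is the strict minimum of H(x, ·), and H(x, 0) = 0; non-negative energy therefore
forces zero momentum, and then only the end points are at rest. -/
theorem eq_equilibrium (hC : Core M H) (h : Well M H m₁ m₂) {z : ℝ × ℝ}
    (hz : z.1 ∈ Icc m₁ m₂) (h0 : 0 ≤ H z.1 z.2) (hP : dP H z.1 z.2 = 0) :
    (z.1 = m₁ ∨ z.1 = m₂) ∧ z.2 = 0 := by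
  have hzM := h.mem_interior hz
  have hz2 : z.2 = 0 := by
    by_contra hne
    have := hC.lt_of_dP_eq_zero hzM hP (Ne.symm hne)
    rw [hC.zero _ hzM] at this
    linarith
  refine ⟨?_, hz2⟩
  by_contra! hcon
  rw [hz2] at hP
  exact h.dP_ne z.1 ⟨lt_of_le_of_ne hz.1 (Ne.symm hcon.1), lt_of_le_of_ne hz.2 hcon.2⟩ hP

theorem continuousOn_energy (hC : Core M H) (h : Well M H m₁ m₂) :
    ContinuousOn (Function.uncurry H) (nonposRegion H m₁ m₂) :=
  hC.contDiffOn.continuousOn.mono h.nonposRegion_subset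

theorem continuousOn_velocity (hC : Core M H) (h : Well M H m₁ m₂) :
    ContinuousOn (Function.uncurry (dP H)) (nonposRegion H m₁ m₂) :=
  hC.contDiffOn_dP.continuousOn.mono h.nonposRegion_subset

/-- At energies just below zero, the points at rest are close to the two equilibria. -/
theorem exists_energy_bound (hC : Core M H) (h : Well M H m₁ m₂) {x₀ : ℝ}
    (hx₀ : x₀ ∈ Ioo m₁ m₂) : ∃ δ > 0, ∀ z ∈ negRegion H m₁ m₂, -δ < H z.1 z.2 →
      dP H z.1 z.2 = 0 → (z.1 < x₀ → dX M H z.1 z.2 < 0) ∧ (x₀ < z.1 → 0 < dX M H z.1 z.2) ∧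
        z.1 ≠ x₀ := by
  obtain ⟨N₁, hN₁, hN₁o, hN₁m⟩ := eventually_nhds_iff.1
    ((eventually_dX_sign hC h.left h.dP_left h.ne_left).and
      (continuousAt_fst.eventually (gt_mem_nhds hx₀.1)))
  obtain ⟨N₂, hN₂, hN₂o, hN₂m⟩ := eventually_nhds_iff.1
    ((eventually_dX_sign hC h.right h.dP_right h.ne_right).and
      (continuousAt_fst.eventually (lt_mem_nhds hx₀.2)))
  -- Rest points away from the equilibria form a compact set of negative energy; its maximal energy
  -- provides δ.
  set K := (nonposRegion H m₁ m₂ ∩ Function.uncurry (dP H) ⁻¹' {0}) ∩ (N₁ ∪ N₂)ᶜ with hK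
  have hDc := h.isCompact_nonposRegion hC
  have hKc : IsCompact K := by
    refine hDc.of_isClosed_subset ?_ (inter_subset_left.trans inter_subset_left)
    exact ((h.continuousOn_velocity hC).preimage_isClosed_of_isClosed hDc.isClosed
      isClosed_singleton).inter (hN₁o.union hN₂o).isClosed_compl
  have hKneg : ∀ z ∈ K, H z.1 z.2 < 0 := by
    rintro z ⟨⟨hz, hz0⟩, hzN⟩
    refine lt_of_le_of_ne hz.2 fun h0 => hzN ?_
    obtain ⟨hz1 | hz1, hz2⟩ := h.eq_equilibrium hC hz.1 h0.ge hz0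
    · left; rwa [show z = (m₁, 0) from Prod.ext hz1 hz2]
    · right; rwa [show z = (m₂, 0) from Prod.ext hz1 hz2]
  obtain ⟨δ, hδ, hδK⟩ : ∃ δ > 0, ∀ z ∈ K, H z.1 z.2 ≤ -δ := by
    rcases K.eq_empty_or_nonempty with hemp | hne
    · exact ⟨1, one_pos, fun z hz => by rw [hemp] at hz; exact absurd hz (notMem_empty z)⟩
    · obtain ⟨z, hz, hmax⟩ := hKc.exists_isMaxOn hne ((h.continuousOn_energy hC).mono
        (inter_subset_left.trans inter_subset_left))
      exact ⟨-H z.1 z.2, neg_pos.2 (hKneg z hz), fun w hw => by rw [neg_neg]; exact hmax hw⟩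
  refine ⟨δ, hδ, fun z hz hzδ hz0 => ?_⟩
  have hzN : z ∈ N₁ ∪ N₂ := by
    by_contra hzN
    exact absurd (hδK z ⟨⟨negRegion_subset hz, hz0⟩, hzN⟩) (not_le.2 hzδ)
  rcases hzN with hzN | hzN
  · obtain ⟨h1, h2⟩ := hN₁ z hzN
    exact ⟨fun _ => (h1 hz0).1 hz.1.1, fun hlt => absurd h2 (not_lt.2 hlt.le), h2.ne⟩
  · obtain ⟨h1, h2⟩ := hN₂ z hzN
    exact ⟨fun hlt => absurd h2 (not_lt.2 hlt.le), fun _ => (h1 hz0).2 hz.1.2, h2.ne'⟩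

end Well

/-- A global flow that agrees with the Hamiltonian flow near the region of non-positive energy. -/
structure IsWellFlow (M : Model) (H : ℝ → ℝ → ℝ) (m₁ m₂ : ℝ) (f : ℝ × ℝ → ℝ × ℝ)
    (φ : ℝ → ℝ × ℝ → ℝ × ℝ) : Prop where
  core : Core M H
  well : Well M H m₁ m₂
  flow : IsFlow f φ
  eqOn : EqOn f (field M H) (nonposRegion H m₁ m₂)

namespace IsWellFlow

variable {M : Model} {H : ℝ → ℝ → ℝ} {m₁ m₂ : ℝ} {f : ℝ × ℝ → ℝ × ℝ} {φ : ℝ → ℝ × ℝ → ℝ × ℝ}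

theorem isTraj (h : IsWellFlow M H m₁ m₂ f φ) {z : ℝ × ℝ} {r : ℝ}
    (hr : φ r z ∈ nonposRegion H m₁ m₂) : IsTraj M H (fun s => φ s z) r :=
  ⟨h.well.nonposRegion_subset hr, (h.flow.hasDerivAt z r).congr_deriv (h.eqOn hr)⟩

/-- At a first exit time the point would be in the closed region with its negative energy conserved,
which places it over the open interval again. -/
theorem mem_negRegion (h : IsWellFlow M H m₁ m₂ f φ) {z : ℝ × ℝ} (hz : z ∈ negRegion H m₁ m₂)
    {t : ℝ} (ht : 0 ≤ t) : φ t z ∈ negRegion H m₁ m₂ := by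
  refine mem_of_forall_mem_before (γ := fun r => φ r z) (h.well.isOpen_negRegion h.core)
    (h.flow.continuous_time z).continuousOn (by rwa [h.flow.zero]) (fun r hr hbefore => ?_) t
    ⟨ht, le_rfl⟩
  have hcl : φ r z ∈ nonposRegion H m₁ m₂ := by
    refine (h.well.isCompact_nonposRegion h.core).isClosed.mem_of_tendsto
      ((h.flow.continuous_time z).continuousAt.tendsto.mono_left
        (nhdsWithin_le_nhds (s := Iio r))) ?_
    filter_upwards [Ioo_mem_nhdsLT hr.1] with r' hr'
    exact Well.negRegion_subset (hbefore r' (Ioo_subset_Ico_self hr'))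
  have hen := h.core.energy_eq hr.1.le (z := fun r => φ r z)
    (fun r' hr' => h.isTraj (Well.negRegion_subset (hbefore r' hr')))
    (h.flow.continuous_time z).continuousAt (h.well.nonposRegion_subset hcl)
  refine h.well.mem_negRegion h.core hcl.1 ?_
  rw [hen, h.flow.zero]
  exact hz.2

theorem isTraj_of_mem (h : IsWellFlow M H m₁ m₂ f φ) {z : ℝ × ℝ} (hz : z ∈ negRegion H m₁ m₂)
    {r : ℝ} (hr : 0 ≤ r) : IsTraj M H (fun s => φ s z) r :=
  h.isTraj (Well.negRegion_subset (h.mem_negRegion hz hr))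

theorem energy_eq (h : IsWellFlow M H m₁ m₂ f φ) {z : ℝ × ℝ} (hz : z ∈ negRegion H m₁ m₂)
    {t : ℝ} (ht : 0 ≤ t) : H (φ t z).1 (φ t z).2 = H z.1 z.2 := by
  have := h.core.energy_eq ht (z := fun r => φ r z) (fun r hr => h.isTraj_of_mem hz hr.1)
    (h.flow.continuous_time z).continuousAt (h.isTraj_of_mem hz ht).1
  rwa [h.flow.zero] at this

/-- Along a trajectory of energy just below zero, the position has no limit. -/
theorem not_tendsto_fst (h : IsWellFlow M H m₁ m₂ f φ) {δ x₀ : ℝ}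
    (hδ : ∀ z ∈ negRegion H m₁ m₂, -δ < H z.1 z.2 →
      dP H z.1 z.2 = 0 → (z.1 < x₀ → dX M H z.1 z.2 < 0) ∧ (x₀ < z.1 → 0 < dX M H z.1 z.2) ∧
        z.1 ≠ x₀) {z : ℝ × ℝ} (hz : z ∈ negRegion H m₁ m₂) (hzδ : -δ < H z.1 z.2) (l : ℝ) :
    ¬ Tendsto (fun r => (φ r z).1) atTop (𝓝 l) := by
  intro hlim
  have hDc := h.well.isCompact_nonposRegion h.core
  -- The forward trajectory of a limit point has constant position. Its velocity and acceleration
  -- vanish, hence so does ∂_x H, contrary to the sign at rest points.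
  obtain ⟨z', hz', k, hk, hkz⟩ := hDc.tendsto_subseq (x := fun n : ℕ => φ n z)
    fun n => Well.negRegion_subset (h.mem_negRegion hz n.cast_nonneg)
  have hen : H z'.1 z'.2 = H z.1 z.2 := by
    have h1 : Tendsto (fun n => Function.uncurry H (φ (k n) z)) atTop
        (𝓝 (Function.uncurry H z')) :=
      ((h.core.differentiableAt (h.well.nonposRegion_subset hz')).continuousAt.tendsto).comp hkz
    refine tendsto_nhds_unique h1 (tendsto_const_nhds.congr fun n => ?_)
    exact (h.energy_eq hz (k n).cast_nonneg).symm
  have hz'D : z' ∈ negRegion H m₁ m₂ :=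
    h.well.mem_negRegion h.core hz'.1 (by rw [hen]; exact hz.2)
  have hx : ∀ r, (φ r z').1 = l := by
    intro r
    have h1 : Tendsto (fun n => (φ r (φ (k n) z)).1) atTop (𝓝 (φ r z').1) :=
      (continuous_fst.comp (h.flow.continuous_space r)).continuousAt.tendsto.comp hkz
    refine tendsto_nhds_unique h1 ?_
    have h2 : Tendsto (fun n => r + (k n : ℝ)) atTop atTop :=
      tendsto_atTop_add_const_left _ _ (tendsto_natCast_atTop_atTop.comp hk.tendsto_atTop)
    refine (hlim.comp h2).congr fun n => ?_
    simp only [Function.comp_apply, h.flow.add]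
  have hu : ∀ r, 0 ≤ r → dP H (φ r z').1 (φ r z').2 = 0 := by
    intro r hr
    refine (h.isTraj_of_mem hz'D hr).hasDerivAt_fst.unique ?_
    simp only [hx]
    exact hasDerivAt_const r l
  have h1 : (0 : ℝ) ≤ 1 := zero_le_one
  have hw := (h.isTraj_of_mem hz'D h1).hasDerivAt_comp
    (h.core.differentiableAt_dP (h.isTraj_of_mem hz'D h1).1)
  have hw0 : HasDerivAt (fun s => dP H (φ s z').1 (φ s z').2) 0 1 := by
    refine (hasDerivAt_const 1 0).congr_of_eventuallyEq ?_
    filter_upwards [lt_mem_nhds (zero_lt_one' ℝ)] with s hs using hu s hs.le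
  have heq := hw.unique hw0
  simp only [hu 1 h1, mul_zero, zero_sub, neg_eq_zero] at heq
  have hcv := h.core.convex _ (mem_phase.1 (h.isTraj_of_mem hz'D h1).1) (φ 1 z').2
  have hX := (mul_eq_zero.1 heq).resolve_left hcv.ne'
  obtain ⟨hl, hr, hne⟩ := hδ _ (h.mem_negRegion hz'D h1)
    (by rw [h.energy_eq hz'D h1, hen]; exact hzδ) (hu 1 h1)
  rcases lt_or_gt_of_ne hne with hlt | hlt
  · exact (hl hlt).ne hX
  · exact (hr hlt).ne' hX

theorem not_monotoneOn_fst (h : IsWellFlow M H m₁ m₂ f φ) {δ x₀ : ℝ}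
    (hδ : ∀ z ∈ negRegion H m₁ m₂, -δ < H z.1 z.2 →
      dP H z.1 z.2 = 0 → (z.1 < x₀ → dX M H z.1 z.2 < 0) ∧ (x₀ < z.1 → 0 < dX M H z.1 z.2) ∧
        z.1 ≠ x₀) {z : ℝ × ℝ} (hz : z ∈ negRegion H m₁ m₂) (hzδ : -δ < H z.1 z.2) {T : ℝ}
    (hT : 0 ≤ T) : ¬ MonotoneOn (fun r => (φ r z).1) (Ici T) ∧
      ¬ AntitoneOn (fun r => (φ r z).1) (Ici T) := by
  have hb : ∀ r, 0 ≤ r → (φ r z).1 ∈ Icc m₁ m₂ := fun r hr =>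
    Ioo_subset_Icc_self (h.mem_negRegion hz hr).1
  have hev : (fun r => (φ (max r T) z).1) =ᶠ[atTop] fun r => (φ r z).1 := by
    filter_upwards [eventually_ge_atTop T] with r hr
    rw [max_eq_left hr]
  have hmax : ∀ r, 0 ≤ max r T := fun r => hT.trans (le_max_right _ _)
  constructor
  · intro hmono
    have hm : Monotone fun r => (φ (max r T) z).1 := fun r s hrs =>
      hmono (mem_Ici.2 (le_max_right r T)) (mem_Ici.2 (le_max_right s T)) (max_le_max_right T hrs)
    refine h.not_tendsto_fst hδ hz hzδ _ ((tendsto_atTop_ciSup hm ⟨m₂, ?_⟩).congr' hev)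
    rintro _ ⟨r, rfl⟩
    exact (hb _ (hmax r)).2
  · intro hanti
    have hm : Antitone fun r => (φ (max r T) z).1 := fun r s hrs =>
      hanti (mem_Ici.2 (le_max_right r T)) (mem_Ici.2 (le_max_right s T)) (max_le_max_right T hrs)
    refine h.not_tendsto_fst hδ hz hzδ _ ((tendsto_atTop_ciInf hm ⟨m₁, ?_⟩).congr' hev)
    rintro _ ⟨r, rfl⟩
    exact (hb _ (hmax r)).1

/-- Trajectories that start over `x₀` and come to rest before time `T` have energy bounded away
from zero. -/
theorem exists_energy_le (h : IsWellFlow M H m₁ m₂ f φ) {x₀ : ℝ} (hx₀ : x₀ ∈ Ioo m₁ m₂) (T : ℝ) :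
    ∃ κ > 0, ∀ w ∈ negRegion H m₁ m₂, w.1 = x₀ → ∀ r ∈ Icc 0 T,
      dP H (φ r w).1 (φ r w).2 = 0 → H w.1 w.2 ≤ -κ := by
  -- The closure inherits forward invariance and conservation of energy by continuity, and it is
  -- compact, so the limit case of energy zero can be examined.
  set D := closure (negRegion H m₁ m₂) with hD
  have hDc := h.well.isCompact_nonposRegion h.core
  have hDsub : D ⊆ nonposRegion H m₁ m₂ := closure_minimal Well.negRegion_subset hDc.isClosed
  have hDinv : ∀ w ∈ D, ∀ r, 0 ≤ r → φ r w ∈ D := fun w hw r hr =>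
    map_mem_closure (h.flow.continuous_space r) hw fun z hz => h.mem_negRegion hz hr
  have hDen : ∀ w ∈ D, ∀ r, 0 ≤ r → H (φ r w).1 (φ r w).2 = H w.1 w.2 := by
    intro w hw r hr
    obtain ⟨v, hv, hvw⟩ := mem_closure_iff_seq_limit.1 hw
    have hcont : ∀ z ∈ D, ContinuousAt (Function.uncurry H) z := fun z hz =>
      (h.core.differentiableAt (h.well.nonposRegion_subset (hDsub hz))).continuousAt
    have h1 : Tendsto (fun n => Function.uncurry H (φ r (v n))) atTop
        (𝓝 (Function.uncurry H (φ r w))) :=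
      (hcont _ (hDinv w hw r hr)).tendsto.comp
        ((h.flow.continuous_space r).continuousAt.tendsto.comp hvw)
    refine tendsto_nhds_unique h1 (((hcont w hw).tendsto.comp hvw).congr fun n => ?_)
    exact (h.energy_eq (hv n) hr).symm
  set B := Icc 0 T ×ˢ (D ∩ Prod.fst ⁻¹' {x₀}) with hB
  have hBc : IsCompact B := isCompact_Icc.prod
    ((hDc.of_isClosed_subset isClosed_closure hDsub).inter_right
      (isClosed_singleton.preimage continuous_fst))
  set Z := B ∩ (fun p : ℝ × (ℝ × ℝ) => Function.uncurry (dP H) (φ p.1 p.2)) ⁻¹' {0} with hZ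
  have hZc : IsCompact Z := by
    refine hBc.of_isClosed_subset ?_ inter_subset_left
    refine ContinuousOn.preimage_isClosed_of_isClosed ?_ hBc.isClosed isClosed_singleton
    exact (h.well.continuousOn_velocity h.core).comp h.flow.continuous.continuousOn
      fun p hp => hDsub (hDinv p.2 hp.2.1 p.1 hp.1.1)
  -- At energy zero the rest point would be an equilibrium, so the trajectory would have been there
  -- from the start, not over x₀.
  have hneg : ∀ p ∈ Z, H p.2.1 p.2.2 < 0 := by
    rintro ⟨r, w⟩ ⟨⟨hr, hw, hwx⟩, hp0⟩
    refine lt_of_le_of_ne (hDsub hw).2 fun h0 => ?_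
    have hφD := hDsub (hDinv w hw r hr.1)
    obtain ⟨hx, hy⟩ := h.well.eq_equilibrium h.core hφD.1 (by rw [hDen w hw r hr.1, h0]) hp0
    have hf : f (φ r w) = 0 := by
      rw [h.eqOn hφD, field, hy, h.core.dX_zero (h.well.mem_interior hφD.1)]
      rcases hx with hx | hx <;> rw [hx]
      · rw [h.well.dP_left, neg_zero]; rfl
      · rw [h.well.dP_right, neg_zero]; rfl
    have hw' : w = φ r w := by
      refine h.flow.injective r ?_
      rw [h.flow.eq_of_zero hf]
    rw [← hw'] at hx
    simp only [mem_preimage, mem_singleton_iff] at hwx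
    rw [hwx] at hx
    rcases hx with hx | hx
    exacts [hx₀.1.ne' hx, hx₀.2.ne hx]
  rcases Z.eq_empty_or_nonempty with hemp | hne
  · refine ⟨1, one_pos, fun w hw hwx r hr h0 => ?_⟩
    have : (r, w) ∈ Z := ⟨⟨hr, subset_closure hw, hwx⟩, h0⟩
    rw [hemp] at this
    exact absurd this (notMem_empty _)
  · obtain ⟨p, hp, hmax⟩ := hZc.exists_isMaxOn hne (f := fun p => Function.uncurry H p.2)
      ((h.well.continuousOn_energy h.core).comp continuous_snd.continuousOn
        fun p hp => hDsub hp.1.2.1)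
    refine ⟨-H p.2.1 p.2.2, neg_pos.2 (hneg p hp), fun w hw hwx r hr h0 => ?_⟩
    have hmem : (r, w) ∈ Z := ⟨⟨hr, subset_closure hw, hwx⟩, h0⟩
    rw [neg_neg]
    exact hmax hmem

end IsWellFlow

/-! ### Rotating loops and persistent overhangs -/

/-- The points of energy in `(-δ, 0)` over `(m₁, m₂)`. -/
def annulus (H : ℝ → ℝ → ℝ) (m₁ m₂ δ : ℝ) : Set (ℝ × ℝ) :=
  {z | z ∈ negRegion H m₁ m₂ ∧ -δ < H z.1 z.2}

namespace IsWellFlow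

variable {M : Model} {H : ℝ → ℝ → ℝ} {m₁ m₂ : ℝ} {f : ℝ × ℝ → ℝ × ℝ} {φ : ℝ → ℝ × ℝ → ℝ × ℝ}

theorem mem_annulus (h : IsWellFlow M H m₁ m₂ f φ) {δ : ℝ} {z : ℝ × ℝ}
    (hz : z ∈ annulus H m₁ m₂ δ) {t : ℝ} (ht : 0 ≤ t) : φ t z ∈ annulus H m₁ m₂ δ :=
  ⟨h.mem_negRegion hz.1 ht, by rw [h.energy_eq hz.1 ht]; exact hz.2⟩

/-- The forward flow on the annulus. -/
def semiflow (h : IsWellFlow M H m₁ m₂ f φ) (δ r : ℝ) (z : annulus H m₁ m₂ δ) :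
    annulus H m₁ m₂ δ :=
  ⟨φ (max r 0) z, h.mem_annulus z.2 (le_max_right r 0)⟩

theorem coe_semiflow (h : IsWellFlow M H m₁ m₂ f φ) {δ r : ℝ} (hr : 0 ≤ r)
    (z : annulus H m₁ m₂ δ) : (h.semiflow δ r z : ℝ × ℝ) = φ r z := by
  change φ (max r 0) z = φ r z
  rw [max_eq_left hr]

/-- The trajectories in the annulus rotate: they cross the line over `x₀` in both directions. -/
theorem isSection (h : IsWellFlow M H m₁ m₂ f φ) {δ x₀ : ℝ}
    (hδ : ∀ z ∈ negRegion H m₁ m₂, -δ < H z.1 z.2 →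
      dP H z.1 z.2 = 0 → (z.1 < x₀ → dX M H z.1 z.2 < 0) ∧ (x₀ < z.1 → 0 < dX M H z.1 z.2) ∧
        z.1 ≠ x₀) :
    IsSection (h.semiflow δ) (fun z => z.1.1 - x₀) (fun z => dP H z.1.1 z.1.2) ∧
    IsSection (h.semiflow δ) (fun z => -(z.1.1 - x₀)) (fun z => -dP H z.1.1 z.1.2) := by
  have hcont : Continuous (Function.uncurry (h.semiflow δ)) :=
    Continuous.subtype_mk (h.flow.continuous.comp (by fun_prop :
      Continuous fun p : ℝ × annulus H m₁ m₂ δ => (max p.1 0, (p.2 : ℝ × ℝ)))) _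
  have hzero : ∀ z, h.semiflow δ 0 z = z := fun z => Subtype.ext (by
    rw [h.coe_semiflow le_rfl, h.flow.zero])
  have hadd : ∀ r s z, 0 ≤ r → 0 ≤ s →
      h.semiflow δ (r + s) z = h.semiflow δ r (h.semiflow δ s z) := fun r s z hr hs =>
    Subtype.ext (by
      rw [h.coe_semiflow (add_nonneg hr hs), h.coe_semiflow hr, h.coe_semiflow hs, h.flow.add])
  have hg : Continuous fun z : annulus H m₁ m₂ δ => z.1.1 - x₀ := by fun_prop
  have hu : Continuous fun z : annulus H m₁ m₂ δ => dP H z.1.1 z.1.2 :=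
    (h.well.continuousOn_velocity h.core).comp_continuous continuous_subtype_val
      fun z => Well.negRegion_subset z.2.1
  have hx : ∀ (z : annulus H m₁ m₂ δ) r, 0 ≤ r →
      HasDerivAt (fun s => (φ s z).1 - x₀) (dP H (φ r z).1 (φ r z).2) r := fun z r hr =>
    (h.isTraj_of_mem z.2.1 hr).hasDerivAt_fst.sub_const x₀
  have hder : ∀ (z : annulus H m₁ m₂ δ) r, 0 < r →
      HasDerivAt (fun s => (h.semiflow δ s z).1.1 - x₀)
        (dP H (h.semiflow δ r z).1.1 (h.semiflow δ r z).1.2) r := by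
    intro z r hr
    rw [h.coe_semiflow hr.le]
    refine (hx z r hr.le).congr_of_eventuallyEq ?_
    filter_upwards [lt_mem_nhds hr] with s hs
    rw [h.coe_semiflow hs.le]
  -- At rest only -∂_p²H ∂_x H remains, so by convexity the acceleration is opposite in sign to ∂_x
  -- H and points towards x₀.
  have hw : ∀ (z : annulus H m₁ m₂ δ) r, 0 ≤ r → HasDerivAt (fun s => dP H (φ s z).1 (φ s z).2)
      (dX M (dP H) (φ r z).1 (φ r z).2 * dP H (φ r z).1 (φ r z).2
        - dP (dP H) (φ r z).1 (φ r z).2 * dX M H (φ r z).1 (φ r z).2) r := fun z r hr =>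
    (h.isTraj_of_mem z.2.1 hr).hasDerivAt_comp
      (h.core.differentiableAt_dP (h.isTraj_of_mem z.2.1 hr).1)
  have hcv : ∀ (z : annulus H m₁ m₂ δ) r, 0 ≤ r → 0 < dP (dP H) (φ r z).1 (φ r z).2 :=
    fun z r hr => h.core.convex _ (mem_phase.1 (h.isTraj_of_mem z.2.1 hr).1) _
  have hne : ∀ z : annulus H m₁ m₂ δ, z.1.1 - x₀ = 0 → dP H z.1.1 z.1.2 ≠ 0 := fun z hz h0 =>
    (hδ z z.2.1 z.2.2 h0).2.2 (sub_eq_zero.1 hz)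
  have hs : ∀ (z : annulus H m₁ m₂ δ) r, 0 ≤ r → dP H (φ r z).1 (φ r z).2 = 0 →
      ((φ r z).1 - x₀ < 0 → dX M H (φ r z).1 (φ r z).2 < 0) ∧
      (0 < (φ r z).1 - x₀ → 0 < dX M H (φ r z).1 (φ r z).2) := by
    intro z r hr h0
    have hm := h.mem_annulus z.2 hr
    obtain ⟨h1, h2, -⟩ := hδ _ hm.1 hm.2 h0
    exact ⟨fun hlt => h1 (sub_neg.1 hlt), fun hlt => h2 (sub_pos.1 hlt)⟩
  have hmono : ∀ (z : annulus H m₁ m₂ δ) T, 0 ≤ T →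
      ¬ MonotoneOn (fun r => (φ r z).1 - x₀) (Ici T) := fun z T hT hm =>
    (h.not_monotoneOn_fst hδ z.2.1 z.2.2 hT).1 fun r hr s hs' hrs => by
      have := hm hr hs' hrs
      simp only at this
      linarith
  have hanti : ∀ (z : annulus H m₁ m₂ δ) T, 0 ≤ T →
      ¬ AntitoneOn (fun r => (φ r z).1 - x₀) (Ici T) := fun z T hT hm =>
    (h.not_monotoneOn_fst hδ z.2.1 z.2.2 hT).2 fun r hr s hs' hrs => by
      have := hm hr hs' hrs
      simp only at this
      linarith
  refine ⟨⟨hcont, hzero, hadd, hg, hu, hder, hne, fun z => ?_⟩,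
    ⟨hcont, hzero, hadd, hg.neg, hu.neg, fun z r hr => (hder z r hr).fun_neg,
      fun z hz h0 => hne z (neg_eq_zero.1 hz) (neg_eq_zero.1 h0), fun z => ?_⟩⟩
  -- An upward crossing is a downward crossing of the motion with reversed sign.
  · obtain ⟨r, hr, hr0, hru⟩ := exists_downcrossing (fun r hr => (hx z r hr).fun_neg)
      (fun r hr => (hw z r hr).fun_neg)
      (fun r hr h0 hpos => by
        rw [neg_eq_zero.1 h0, mul_zero, zero_sub, neg_neg]
        exact mul_neg_of_pos_of_neg (hcv z r hr) ((hs z r hr (neg_eq_zero.1 h0)).1 (by linarith)))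
      (fun r hr h0 hneg => by
        rw [neg_eq_zero.1 h0, mul_zero, zero_sub, neg_neg]
        exact mul_pos (hcv z r hr) ((hs z r hr (neg_eq_zero.1 h0)).2 (by linarith)))
      (fun r hr h0 hu0 => hne ⟨φ r z, h.mem_annulus z.2 hr⟩ (neg_eq_zero.1 h0)
        (neg_eq_zero.1 hu0))
      (fun T hT hm => hanti z T hT fun r hr s hs' hrs => neg_le_neg_iff.1 (hm hr hs' hrs))
      (fun T hT hm => hmono z T hT fun r hr s hs' hrs => neg_le_neg_iff.1 (hm hr hs' hrs))
    refine ⟨r, hr, ?_⟩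
    rw [h.coe_semiflow hr]
    exact ⟨neg_eq_zero.1 hr0, neg_lt_zero.1 hru⟩
  · obtain ⟨r, hr, hr0, hru⟩ := exists_downcrossing (fun r hr => hx z r hr)
      (fun r hr => hw z r hr)
      (fun r hr h0 hpos => by
        rw [h0, mul_zero, zero_sub, neg_lt_zero]
        exact mul_pos (hcv z r hr) ((hs z r hr h0).2 hpos))
      (fun r hr h0 hneg => by
        rw [h0, mul_zero, zero_sub, neg_pos]
        exact mul_neg_of_pos_of_neg (hcv z r hr) ((hs z r hr h0).1 hneg))
      (fun r hr h0 hu0 => hne ⟨φ r z, h.mem_annulus z.2 hr⟩ h0 hu0)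
      (hmono z) (hanti z)
    refine ⟨r, hr, ?_⟩
    rw [h.coe_semiflow hr]
    exact ⟨neg_eq_zero.2 hr0, neg_pos.2 hru⟩

/-- Trajectories that rotate are periodic. -/
theorem exists_period (h : IsWellFlow M H m₁ m₂ f φ) {δ x₀ : ℝ}
    (hδ : ∀ z ∈ negRegion H m₁ m₂, -δ < H z.1 z.2 →
      dP H z.1 z.2 = 0 → (z.1 < x₀ → dX M H z.1 z.2 < 0) ∧ (x₀ < z.1 → 0 < dX M H z.1 z.2) ∧
        z.1 ≠ x₀) {z : ℝ × ℝ} (hz : z ∈ annulus H m₁ m₂ δ) :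
    (∃ τ > 0, φ τ z = z) ∧ ∃ a, 0 ≤ a ∧ (φ a z).1 = x₀ := by
  obtain ⟨hS, hS'⟩ := h.isSection hδ
  set ψ := h.semiflow δ
  have hval : ∀ r, 0 ≤ r → ∀ w, (ψ r w : ℝ × ℝ) = φ r w := fun r hr w => h.coe_semiflow hr w
  obtain ⟨ha0, ha⟩ := hS.hit_mem ⟨z, hz⟩
  set a := hit ψ _ (⟨z, hz⟩ : annulus H m₁ m₂ δ)
  set w := ψ a ⟨z, hz⟩ with hw
  -- Going through a downward crossing first makes the return time to the upward section positive.
  have hb0 := hS'.hit_pos (disjoint_upSet_neg ha)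
  obtain ⟨-, hb⟩ := hS'.hit_mem w
  set b := hit ψ _ w
  obtain ⟨hc0, hc⟩ := hS.hit_mem (ψ b w)
  set c := hit ψ _ (ψ b w)
  rw [← hS.add c b w hc0 hb0.le] at hc
  have hcb : 0 < c + b := add_pos_of_nonneg_of_pos hc0 hb0
  obtain ⟨hw1, hw2⟩ := ha
  obtain ⟨hv1, hv2⟩ := hc
  change 0 < dP H w.1.1 w.1.2 at hw2
  change 0 < dP H (ψ (c + b) w).1.1 (ψ (c + b) w).1.2 at hv2
  have hx₀ : w.1.1 = x₀ := sub_eq_zero.1 hw1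
  have hx₀' : (ψ (c + b) w).1.1 = x₀ := sub_eq_zero.1 hv1
  have hen : H (ψ (c + b) w).1.1 (ψ (c + b) w).1.2 = H w.1.1 w.1.2 := by
    rw [hval _ hcb.le]
    exact h.energy_eq w.2.1 hcb.le
  have hxM : x₀ ∈ interior M.space := hx₀ ▸ h.well.mem_interior (Ioo_subset_Icc_self w.2.1.1)
  -- Over x₀, on the half-line of positive velocity, the energy is strictly increasing in the
  -- momentum, so equal energies give equal momenta.
  have hsnd : (ψ (c + b) w).1.2 = w.1.2 := by
    rw [hx₀, hx₀'] at hen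
    rw [hx₀'] at hv2
    rw [hx₀] at hw2
    rcases lt_trichotomy (ψ (c + b) w).1.2 w.1.2 with hlt | heq | hlt
    · exact absurd hen (h.core.lt_of_dP_nonneg hxM hv2.le hlt).ne
    · exact heq
    · exact absurd hen (h.core.lt_of_dP_nonneg hxM hw2.le hlt).ne'
  have hfix : φ (c + b) (φ a z) = φ a z := by
    have h1 : (ψ (c + b) w).1 = w.1 := Prod.ext (hx₀'.trans hx₀.symm) hsnd
    rwa [hval _ hcb.le, hw, hval _ ha0] at h1
  refine ⟨⟨c + b, hcb, h.flow.injective a ?_⟩, a, ha0, ?_⟩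
  · rw [← h.flow.add, add_comm, h.flow.add, hfix]
  · rw [← hx₀, hw, hval _ ha0]

end IsWellFlow

/-- To the right of some point, a graph that meets the region of negative energy has energies in
`(-δ, 0)` that tend to `0` at this point. -/
theorem Well.exists_arc {M : Model} {H : ℝ → ℝ → ℝ} {m₁ m₂ : ℝ} (hC : Core M H)
    (h : Well M H m₁ m₂) {D : ℝ → ℝ} (hD : ContinuousOn D (interior M.space)) {x : ℝ}
    (hx : (x, D x) ∈ negRegion H m₁ m₂) {δ : ℝ} (hδ : 0 < δ) (x₀ : ℝ) :
    ∃ a b, a < b ∧ (∀ y ∈ Ioc a b, (y, D y) ∈ annulus H m₁ m₂ δ ∧ y ≠ x₀) ∧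
      ∀ κ > 0, ∃ y ∈ Ioc a b, -κ < H y (D y) := by
  have hsub : Icc m₁ x ⊆ interior M.space :=
    (Icc_subset_Icc_right hx.1.2.le).trans fun y hy => h.mem_interior hy
  have hE : ∀ y ∈ interior M.space, ContinuousAt (fun y => H y (D y)) y := fun y hy =>
    ContinuousAt.comp (g := Function.uncurry H) (f := fun y => (y, D y))
      (hC.differentiableAt (mem_phase.2 hy)).continuousAt
      (continuousAt_id.prodMk (hD.continuousAt (isOpen_interior.mem_nhds hy)))
  have hEc : ContinuousOn (fun y => H y (D y)) (Icc m₁ x) := fun y hy =>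
    (hE y (hsub hy)).continuousWithinAt
  have hcl : IsClosed (Icc m₁ x ∩ (fun y => H y (D y)) ⁻¹' Ici 0) :=
    hEc.preimage_isClosed_of_isClosed isClosed_Icc isClosed_Ici
  -- The last point before `x` with non-negative energy exists because m₁ is one. Just to its right
  -- the energy is negative and, by continuity, arbitrarily close to zero.
  obtain ⟨a, ⟨ha, haE⟩, hmax⟩ :=
    (isCompact_Icc.of_isClosed_subset hcl inter_subset_left).exists_isGreatest
      ⟨m₁, ⟨le_rfl, hx.1.1.le⟩, h.energy_nonneg_of_eq hC (Or.inl rfl) _⟩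
  have hax : a < x := lt_of_le_of_ne ha.2 fun heq => by
    have h1 : 0 ≤ H a (D a) := haE
    rw [heq] at h1
    exact absurd hx.2 (not_lt.2 h1)
  have hneg : ∀ y ∈ Ioc a x, H y (D y) < 0 := fun y hy => by
    by_contra! hge
    exact absurd (hmax ⟨⟨ha.1.trans hy.1.le, hy.2⟩, hge⟩) (not_le.2 hy.1)
  have hev : ∀ κ > 0, ∀ᶠ y in 𝓝[>] a, -κ < H y (D y) := fun κ hκ =>
    ((hE a (hsub ha)).eventually (lt_mem_nhds
      (lt_of_lt_of_le (neg_lt_zero.2 hκ) haE))).filter_mono nhdsWithin_le_nhds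
  have hne : ∀ᶠ y in 𝓝[>] a, y ≠ x₀ := by
    rcases lt_or_ge a x₀ with hlt | hge
    · filter_upwards [Ioo_mem_nhdsGT hlt] with y hy using hy.2.ne
    · filter_upwards [self_mem_nhdsWithin] with y hy using (hge.trans_lt hy).ne'
  obtain ⟨b, hab, hb⟩ := (mem_nhdsGT_iff_exists_Ioc_subset (a := a)).1
    (((hev δ hδ).and hne).and (Ioc_mem_nhdsGT hax))
  refine ⟨a, b, hab, fun y hy => ?_, fun κ hκ => ?_⟩
  · obtain ⟨⟨h1, h2⟩, h3⟩ := hb hy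
    exact ⟨⟨⟨⟨ha.1.trans_lt h3.1, h3.2.trans_lt hx.1.2⟩, hneg y h3⟩, h1⟩, h2⟩
  · obtain ⟨y, hy1, hy2⟩ := ((hev κ hκ).and (Ioc_mem_nhdsGT hab)).exists
    exact ⟨y, hy2, hy1⟩

/-- The arc of 𝓖 given by `Well.exists_arc` serves twice: each of its points lies on a periodic
orbit, and the periods along it are unbounded, so the arc winds up and crosses {x = x₀} in both
directions at all late times. -/
theorem exists_loop_and_overhang {M : Model} {H : ℝ → ℝ → ℝ} {I₀ : ℝ → ℝ} (hC : Core M H)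
    (hI : IsCBoundary M 1 I₀) {m₁ m₂ : ℝ} (hW : Well M H m₁ m₂) (hlt : m₁ < m₂)
    (hne : (gradGraph M I₀ ∩ {z | z.1 ∈ Ioo m₁ m₂ ∧ H z.1 z.2 < 0}).Nonempty) :
    (∃ L : Set (ℝ × ℝ), IsRotatingLoop M H L ∧ (gradGraph M I₀ ∩ L).Nonempty) ∧
      ∃ t₀ : ℝ, 0 < t₀ ∧ ∃ x₀ ∈ Ioo m₁ m₂, ∀ t : ℝ, t₀ ≤ t → HasOverhang M H I₀ t x₀ := by
  have hDc : ContinuousOn (deriv I₀) (interior M.space) :=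
    hI.contDiffOn.continuousOn_deriv_of_isOpen isOpen_interior (by norm_num)
  obtain ⟨f, φ, O, -, hO, -, hfO, hφ⟩ := exists_flow_eqOn_nhds (isOpen_phase M)
    hC.contDiffOn_field (hW.isCompact_nonposRegion hC) hW.nonposRegion_subset
  have h : IsWellFlow M H m₁ m₂ f φ := ⟨hC, hW, hφ, fun z hz => hfO (hO hz)⟩
  obtain ⟨x₀, hx₀⟩ := nonempty_Ioo.2 hlt
  obtain ⟨δ, hδ0, hδ⟩ := hW.exists_energy_bound hC hx₀
  obtain ⟨⟨x, p⟩, ⟨-, hp⟩, hx⟩ := hne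
  obtain rfl : p = deriv I₀ x := hp
  obtain ⟨a, b, hab, harc, hκ⟩ := hW.exists_arc hC hDc hx hδ0 x₀
  have hgraph : ∀ y ∈ Ioc a b, (y, deriv I₀ y) ∈ gradGraph M I₀ := fun y hy =>
    ⟨hW.mem_interior (Ioo_subset_Icc_self (harc y hy).1.1.1), rfl⟩
  have hsol : ∀ z ∈ annulus H m₁ m₂ δ, ∀ T,
      IsHamiltonSol M H T (fun s => (φ s z).1) (fun s => (φ s z).2) := fun z hz T =>
    IsHamiltonSol.of_isTraj fun s hs => h.isTraj_of_mem hz.1 hs.1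
  constructor
  · have hb : b ∈ Ioc a b := ⟨hab, le_rfl⟩
    obtain ⟨hbA, hbx⟩ := harc b hb
    obtain ⟨⟨τ, hτ, hper⟩, r, hr, hrx⟩ := h.exists_period hδ hbA
    -- The starting point is not stationary, because its trajectory passes over x₀ and it does not
    -- itself lie over x₀.
    refine ⟨_, ⟨τ + 1, τ, _, _, hτ, by linarith, hsol _ hbA _, fun hst => hbx ?_, ?_, rfl⟩,
      (b, deriv I₀ b), hgraph b hb, 0, ⟨le_rfl, hτ.le⟩, ?_⟩
    · have h1 := hst.2 (r + 1) _ _ (hsol _ hbA (r + 1)) rfl r ⟨hr, by linarith⟩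
      have h2 := congrArg Prod.fst (mem_singleton_iff.1 h1)
      simp only [h.flow.zero] at h2
      rw [← hrx, h2]
    · simp only [hper, h.flow.zero]
    · simp only [h.flow.zero]
  · obtain ⟨hS, hS'⟩ := h.isSection hδ
    have : PreconnectedSpace (Ioc a b) := Subtype.preconnectedSpace isPreconnected_Ioc
    let κ : Ioc a b → annulus H m₁ m₂ δ := fun y => ⟨(y, deriv I₀ y), (harc y y.2).1⟩
    have hκc : Continuous κ := by
      refine Continuous.subtype_mk (continuous_subtype_val.prodMk ?_) _
      exact hDc.comp_continuous continuous_subtype_val fun y => (hgraph y y.2).1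
    obtain ⟨t₀, ht₀, hov⟩ := exists_forall_ge_mem_upSet hS hS' hκc
      (fun y hy => (harc y y.2).2 (sub_eq_zero.1 hy.1)) ⟨b, hab, le_rfl⟩ (fun K => by
        -- Between an upward and a downward crossing the velocity vanishes. If this happened within
        -- time `K`, the energy would be at most -ε; a point of the arc with energy above -ε thus
        -- travels for at least `K`.
        obtain ⟨ε, hε, hle⟩ := h.exists_energy_le hx₀ K
        obtain ⟨y, hy, hyε⟩ := hκ ε hε
        refine ⟨⟨y, hy⟩, ?_⟩
        by_contra! hlt
        obtain ⟨hs0, hs⟩ := hS.hit_mem (κ ⟨y, hy⟩)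
        set w := h.semiflow δ (hit (h.semiflow δ) _ (κ ⟨y, hy⟩)) (κ ⟨y, hy⟩) with hw
        obtain ⟨hr0, hr⟩ := hS'.hit_mem w
        set r := hit (h.semiflow δ) (upSet (fun z => -(z.1.1 - x₀)) _) w
        have hcont : ContinuousOn (fun s => dP H (φ s w).1 (φ s w).2) (Icc 0 r) := fun s hs =>
          ((h.isTraj_of_mem w.2.1 hs.1).hasDerivAt_comp (h.core.differentiableAt_dP
            (h.isTraj_of_mem w.2.1 hs.1).1)).continuousAt.continuousWithinAt
        have hr2 : 0 < -dP H (h.semiflow δ r w).1.1 (h.semiflow δ r w).1.2 := hr.2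
        rw [h.coe_semiflow hr0] at hr2
        obtain ⟨s, hs', hs0'⟩ := intermediate_value_Icc' hr0 hcont
          ⟨(neg_pos.1 hr2).le, by simpa only [h.flow.zero] using hs.2.le⟩
        have h1 := hle w w.2.1 (sub_eq_zero.1 hs.1) s ⟨hs'.1, hs'.2.trans hlt.le⟩ hs0'
        have h2 : H w.1.1 w.1.2 = H y (deriv I₀ y) := by
          rw [hw, h.coe_semiflow hs0]
          exact h.energy_eq (harc y hy).1.1 hs0
        linarith)
    refine ⟨t₀, ht₀, x₀, hx₀, fun t ht => ?_⟩
    have ht0 : 0 ≤ t := ht₀.le.trans ht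
    obtain ⟨⟨y₁, hy₁, hy₁'⟩, y₂, hy₂, hy₂'⟩ := hov t ht
    beta_reduce at hy₁ hy₁' hy₂ hy₂'
    rw [h.coe_semiflow ht0] at hy₁ hy₁' hy₂ hy₂'
    have hpush : ∀ y : Ioc a b, φ t (κ y) ∈ pushGraph M H I₀ t := fun y =>
      ⟨t + 1, _, _, ⟨ht0, by linarith⟩, hsol _ (harc y y.2).1 _,
        by simpa only [h.flow.zero] using hgraph y y.2, rfl⟩
    have hx₁ : (φ t (κ y₁)).1 = x₀ := sub_eq_zero.1 hy₁
    have hx₂ : (φ t (κ y₂)).1 = x₀ := sub_eq_zero.1 (neg_eq_zero.1 hy₂)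
    refine ⟨hW.mem_interior (Ioo_subset_Icc_self hx₀), (φ t (κ y₁)).2, (φ t (κ y₂)).2,
      fun heq => ?_, ?_, ?_⟩
    -- Equal momenta over x₀ would give equal velocities, but one is positive and the other
    -- negative.
    · rw [hx₁, heq] at hy₁'
      rw [hx₂] at hy₂'
      linarith
    · rw [← hx₁]; exact hpush y₁
    · rw [← hx₂]; exact hpush y₂

end SpinFlow

/-! ### The theorem -/

theorem mainTheorem6 (M : SpinFlow.Model) (H : ℝ → ℝ → ℝ) (I₀ : ℝ → ℝ)
    (hH : SpinFlow.Admissible M H) (hI : SpinFlow.IsCBoundary M 1 I₀) :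
    (∀ x₀ ∈ interior M.space, ∀ m c : ℝ,
      m = SpinFlow.dX M (SpinFlow.dP H) x₀ 0 →
      c = SpinFlow.dP (SpinFlow.dP H) x₀ 0 →
      deriv I₀ x₀ = 0 →
      SpinFlow.IsStationary M H (x₀, 0) →
      ContDiffAt ℝ 2 I₀ x₀ →
      deriv (deriv I₀) x₀ < min (-(2 * m / c)) 0 →
      SpinFlow.HasC1Linearization M H x₀ →
      ∀ t : ℝ, SpinFlow.verticalTime m c (deriv (deriv I₀) x₀) < t →
        SpinFlow.HasOverhang M H I₀ t x₀) ∧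
    (ContDiffOn ℝ 3 (Function.uncurry H) (M.space ×ˢ Set.univ) →
      ∀ m₁ ∈ interior M.space, ∀ m₂ ∈ interior M.space, m₁ < m₂ →
      SpinFlow.dP H m₁ 0 = 0 → SpinFlow.dP H m₂ 0 = 0 →
      (∀ x ∈ Set.Ioo m₁ m₂, SpinFlow.dP H x 0 ≠ 0) →
      SpinFlow.dX M (SpinFlow.dP H) m₁ 0 ≠ 0 →
      SpinFlow.dX M (SpinFlow.dP H) m₂ 0 ≠ 0 →
      (SpinFlow.gradGraph M I₀ ∩ {z | z.1 ∈ Set.Ioo m₁ m₂ ∧ H z.1 z.2 < 0}).Nonempty →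
      (∃ L : Set (ℝ × ℝ), SpinFlow.IsRotatingLoop M H L ∧
        (SpinFlow.gradGraph M I₀ ∩ L).Nonempty) ∧
      ∃ t₀ : ℝ, 0 < t₀ ∧ ∃ x₀ ∈ Set.Ioo m₁ m₂, ∀ t : ℝ, t₀ ≤ t →
        SpinFlow.HasOverhang M H I₀ t x₀) := by
  refine ⟨fun x₀ hx₀ m c hm hc hI0 _ _ hI2 hlin t ht => ?_, ?_⟩
  · subst hm hc
    exact SpinFlow.hasOverhang_of_linearization hH hI hx₀ hI0 hI2 hlin ht
  · intro _ m₁ hm₁ m₂ hm₂ hlt hP₁ hP₂ hne hX₁ hX₂ hmeet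
    exact SpinFlow.exists_loop_and_overhang hH.core hI ⟨hm₁, hm₂, hP₁, hP₂, hne, hX₁, hX₂⟩ hlt hmeet
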